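/- **Setting.** Let $\rho_l>0$, $g>0$, $f\ge 0$, $\gamma>1$, $0\le\alpha<1/\gamma$, $\theta\in(0,\tfrac{\gamma}{2}]\cap(0,\gamma-1]\cap(0,1-\alpha\gamma]$, and let $0<C_1\le C_2$, $0<C_3\le C_4$. Put $h(Q)=f\rho_l^2\,\frac{Q^2}{(1+Q)^2}$ and $cQ_\infty(x)=(gx)^{1/\gamma}$. For initial data $c_0$ (measurable), $Q_0$, $u_0$ on $[0,1]$ consider, on $0<x<1$, $t>0$, with $c(x,t)=c_0(x)$, the problem $$Q_t+\rho_lQ^2u_x=0,\qquad u_t+\big((cQ)^\gamma\big)_x=-h(Q)u|u|+g+\big(c^\theta Q^{1+\theta}u_x\big)_x,$$ $$(cQ)(0,t)=0,\quad u(1,t)=0,\qquad (cQ,u)(x,0)=(c_0Q_0,u_0)(x).$$ **Assumptions on the data.** - (A1) $C_1x^{1/\gamma}\le c_0Q_0(x)\le C_2x^{1/\gamma}$ and $C_3x^\alpha\le c_0(x)\le C_4x^\alpha$ for $x\in[0,1]$. - (A2) $u_0\in H^1(0,1)\cap L^5(0,1)$ and $\int_0^1x^{\frac{(2+\alpha)\gamma-\theta-1}{\gamma}}\Big(\big((c_0Q_0)^\theta-(cQ_\infty)^\theta\big)_x\Big)^2dx<\infty$.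 - (A3) $\big(c_0^\theta Q_0^{1+\theta}u_{0x}\big)_x\in L^2(0,1)$. **Weak solutions.** A pair $(cQ,u)$ with $Q\ge0$ is a weak solution if $cQ,u\in L^\infty([0,1]\times[0,\infty))\cap C^1([0,\infty);L^2(0,1))$; $u(\cdot,t)$ has a weak derivative $u_x(\cdot,t)\in L^1_{loc}(0,1)$ for every $t\ge0$; $c^\theta Q^{1+\theta}u_x\in L^\infty([0,1]\times[0,\infty))\cap C^{1/2}([0,\infty);L^2(0,1))$ (Hölder continuity on bounded time intervals); $Q_t+\rho_lQ^2u_x=0$ a.e.; $cQ(\cdot,0)=c_0Q_0$ a.e.; for every $t>0$, $cQ(x,t)\to0$ as $x\to0^+$ and $u(x,t)\to0$ as $x\to1^-$ (essential limits); and $$\int_0^\infty\!\!\int_0^1\Big\{u\phi_t+\big((cQ)^\gamma-c^\theta Q^{1+\theta}u_x\big)\phi_x+g\phi-h(Q)u|u|\phi\Big\}\,dx\,dt+\int_0^1u_0(x)\phi(x,0)\,dx=0$$ for every $\phi\in C_0^\infty([0,1)\times[0,\infty))$, i.e. every restriction of a function in $C^\infty(\mathbb R^2)$ whose support is compact and contained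 in $\{x<1\}$. **Theorem 2.3.** There is a constant $0<\epsilon_0<1$, depending only on $\rho_l,g,f,\gamma,\alpha,\theta,C_1,C_2,C_3,C_4$, such that for all data satisfying (A1)–(A3) and $$\|u_0\|_{L^2(0,1)}^2\le\epsilon_0,\qquad \int_0^1x^{1-3/\gamma}(c_0Q_0-cQ_\infty)^2\,dx\le\epsilon_0,$$ every weak solution $(cQ,u)$ has the following properties. For every $t\ge 0$, $cQ(\cdot,t)$ has a representative continuous on $[0,1]$ and $u(\cdot,t)$ has one continuous on $(0,1]$; for these representatives, $$\lim_{t\to\infty}(cQ)(x,t)=(gx)^{1/\gamma}\ \text{ uniformly in }x\in[0,1],\qquad \lim_{t\to\infty}\sup_{x\in[\delta,1]}|u(x,t)|=0\ \text{ for every }0<\delta<1.$$ If moreover $\theta<\gamma-1$, then for every $t\ge0$ the representative of $u(\cdot,t)$ extends continuously to $[0,1]$, and $$\lim_{t\to\infty}\sup_{x\in[0,1]}|u(x,t)|=0.$$ -/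

import Mathlib

open MeasureTheory Set Filter Topology

/-- Lebesgue measure on the unit interval `(0,1)`. -/
noncomputable abbrev unitMeasure : Measure ℝ := volume.restrict (Ioo (0 : ℝ) 1)

/-- `v` is the weak derivative of `f` on `(0,1)`: `v` is locally integrable on `(0,1)` and `f`
agrees almost everywhere with a (locally absolutely continuous) primitive of `v`. -/
def HasWeakDeriv (f v : ℝ → ℝ) : Prop :=
  LocallyIntegrableOn v (Ioo (0 : ℝ) 1) ∧
    ∃ C : ℝ, ∀ᵐ x ∂unitMeasure, f x = C + ∫ y in (1 / 2 : ℝ)..x, v y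

/-- The time-dependent function `w` (time is the first argument) belongs to
`C¹([0,∞); L²(0,1))`, with time derivative `wt`. -/
def IsC1InL2 (w wt : ℝ → ℝ → ℝ) : Prop :=
  ∃ G : ℝ → Lp ℝ 2 unitMeasure, ContDiffOn ℝ 1 G (Ici 0) ∧
    (∀ t, 0 ≤ t → G t =ᵐ[unitMeasure] w t) ∧
    ∀ t, 0 ≤ t → (derivWithin G (Ici 0) t : Lp ℝ 2 unitMeasure) =ᵐ[unitMeasure] wt t

/-- The time-dependent function `w` belongs to `C^{1/2}([0,∞); L²(0,1))`
(Hölder continuous on every bounded time interval). -/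
def IsHolderHalfInL2 (w : ℝ → ℝ → ℝ) : Prop :=
  ∃ G : ℝ → Lp ℝ 2 unitMeasure, (∀ t, 0 ≤ t → G t =ᵐ[unitMeasure] w t) ∧
    ∀ T : ℝ, ∃ K : NNReal, HolderOnWith K (1 / 2) G (Icc 0 T)

/-- The time-dependent function `w` belongs to `L^∞([0,1] × [0,∞))`. It is used for
functions that are continuous in time with values in `L²(0,1)`. -/
def IsBoundedInTimeSpace (w : ℝ → ℝ → ℝ) : Prop :=
  ∃ M : ℝ, ∀ t, 0 ≤ t → ∀ᵐ x ∂unitMeasure, |w t x| ≤ M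

/-- The friction coefficient `h(Q) = f ρ_l² Q² / (1 + Q)²`. -/
noncomputable def frictionCoeff (f ρl q : ℝ) : ℝ := f * ρl ^ 2 * (q ^ 2 / (1 + q) ^ 2)

/-- The stationary profile `cQ_∞(x) = (g x)^{1/γ}`. -/
noncomputable def cQInfty (g γ x : ℝ) : ℝ := (g * x) ^ (1 / γ)

/-- The pointwise bounds on the initial data. -/
def AssumptionA1 (γ α C₁ C₂ C₃ C₄ : ℝ) (c₀ Q₀ : ℝ → ℝ) : Prop :=
  ∀ x ∈ Icc (0 : ℝ) 1,
    C₁ * x ^ (1 / γ) ≤ c₀ x * Q₀ x ∧ c₀ x * Q₀ x ≤ C₂ * x ^ (1 / γ) ∧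
    C₃ * x ^ α ≤ c₀ x ∧ c₀ x ≤ C₄ * x ^ α

/-- `u₀ ∈ H¹ ∩ L⁵`, and `((c₀Q₀)^θ - (cQ_∞)^θ)_x` lies in the weighted `L²` space with weight
`x^{((2+α)γ-θ-1)/γ}`. -/
def AssumptionA2 (g γ α θ : ℝ) (c₀ Q₀ u₀ : ℝ → ℝ) : Prop :=
  (MemLp u₀ 2 unitMeasure ∧ ∃ v, HasWeakDeriv u₀ v ∧ MemLp v 2 unitMeasure) ∧
  MemLp u₀ 5 unitMeasure ∧
  ∃ v, HasWeakDeriv (fun x => (c₀ x * Q₀ x) ^ θ - cQInfty g γ x ^ θ) v ∧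
    Integrable (fun x => x ^ (((2 + α) * γ - θ - 1) / γ) * v x ^ 2) unitMeasure

/-- `(c₀^θ Q₀^{1+θ} u₀ₓ)ₓ ∈ L²(0,1)`. -/
def AssumptionA3 (θ : ℝ) (c₀ Q₀ u₀ : ℝ → ℝ) : Prop :=
  ∃ v k, HasWeakDeriv u₀ v ∧
    HasWeakDeriv (fun x => c₀ x ^ θ * Q₀ x ^ (1 + θ) * v x) k ∧ MemLp k 2 unitMeasure

/-- Test functions `φ(x,t)`: (restrictions of) smooth functions with compact support in
`{x < 1}`. They need not vanish at `x = 0` nor at `t = 0`. -/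
def IsTestFunction (φ : ℝ × ℝ → ℝ) : Prop :=
  ContDiff ℝ ((⊤ : ℕ∞) : WithTop ℕ∞) φ ∧ HasCompactSupport φ ∧
    tsupport φ ⊆ {p : ℝ × ℝ | p.1 < 1}

/-- `(c₀ Q, u)`, with `Q = Q t x` and `u = u t x`, is a weak solution of
`Q_t + ρ_l Q² u_x = 0`,
`u_t + ((c₀Q)^γ)_x = -h(Q) u|u| + g + (c₀^θ Q^{1+θ} u_x)_x`
on `0 < x < 1`, `t > 0`, with boundary values `(c₀Q)(0,t) = 0`, `u(1,t) = 0` and initial data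
`(c₀Q₀, u₀)`; `ux` is the weak derivative of `u` in `x` and `wt` the time derivative of `c₀Q`.
Only the classes of `Q t` and `u t` modulo null sets matter, and the boundary values are taken
as essential one-sided limits. -/
structure IsWeakSolutionWith (ρl g f γ θ : ℝ) (c₀ Q₀ u₀ : ℝ → ℝ)
    (Q u ux wt : ℝ → ℝ → ℝ) : Prop where
  nonneg : ∀ t, 0 ≤ t → ∀ᵐ x ∂unitMeasure, 0 ≤ Q t x
  weakDeriv : ∀ t, 0 ≤ t → HasWeakDeriv (u t) (ux t)
  cQ_bounded : IsBoundedInTimeSpace (fun t x => c₀ x * Q t x)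
  cQ_C1 : IsC1InL2 (fun t x => c₀ x * Q t x) wt
  u_bounded : IsBoundedInTimeSpace u
  u_C1 : ∃ ut, IsC1InL2 u ut
  flux_bounded : IsBoundedInTimeSpace (fun t x => c₀ x ^ θ * Q t x ^ (1 + θ) * ux t x)
  flux_holder : IsHolderHalfInL2 (fun t x => c₀ x ^ θ * Q t x ^ (1 + θ) * ux t x)
  /-- the mass equation, multiplied by the positive, time independent function `c₀` -/
  mass : ∀ᵐ t ∂(volume.restrict (Ioi (0 : ℝ))), ∀ᵐ x ∂unitMeasure,
    wt t x + ρl * (c₀ x * Q t x ^ 2 * ux t x) = 0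
  initial_cQ : ∀ᵐ x ∂unitMeasure, c₀ x * Q 0 x = c₀ x * Q₀ x
  boundary_cQ : ∀ t, 0 < t →
    Tendsto (fun x => c₀ x * Q t x) (𝓝[>] (0 : ℝ) ⊓ ae volume) (𝓝 0)
  boundary_u : ∀ t, 0 < t → Tendsto (u t) (𝓝[<] (1 : ℝ) ⊓ ae volume) (𝓝 0)
  momentum : ∀ φ : ℝ × ℝ → ℝ, IsTestFunction φ →
    (∫ t in Ioi (0 : ℝ), ∫ x in Ioo (0 : ℝ) 1,
        (u t x * deriv (fun s => φ (x, s)) t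
          + ((c₀ x * Q t x) ^ γ - c₀ x ^ θ * Q t x ^ (1 + θ) * ux t x)
              * deriv (fun y => φ (y, t)) x
          + g * φ (x, t)
          - frictionCoeff f ρl (Q t x) * u t x * |u t x| * φ (x, t)))
      + (∫ x in Ioo (0 : ℝ) 1, u₀ x * φ (x, 0)) = 0

/-- `(c₀ Q, u)` is a weak solution of the initial boundary value problem. -/
def IsWeakSolution (ρl g f γ θ : ℝ) (c₀ Q₀ u₀ : ℝ → ℝ) (Q u : ℝ → ℝ → ℝ) : Prop :=
  ∃ ux wt, IsWeakSolutionWith ρl g f γ θ c₀ Q₀ u₀ Q u ux wt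

/-- For every time `t ≥ 0`, `w t` is the representative of `v t` that is continuous on
`s ⊆ [0,1]` (unique on `s` if `s` is an interval of positive length). -/
def IsContinuousVersion (w v : ℝ → ℝ → ℝ) (s : Set ℝ) : Prop :=
  ∀ t, 0 ≤ t → ContinuousOn (w t) s ∧ w t =ᵐ[unitMeasure] v t

/-!
Let `W = (c Q)^θ`, and let `S = c^θ Q^{1+θ} u_x` be the viscous flux. The mass equation says
`W_t = -θ ρ S`, and the momentum equation, integrated over `(0,x)` with the boundary condition at
`x = 0`, says `S = W^{γ/θ} - g x + ∫₀ˣ (u_t + H)`, where `H = h(Q) u|u|` is the friction force. So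
`W` solves an ordinary differential equation in `t` at every `x`, whose forcing is continuous in
`x`. A solution in `L²(0,1)` is unique by monotonicity, and hence `W` has a continuous version that
solves the equation pointwise. The passage from a weak solution to these pointwise relations, which
`RegularFlow` collects, is `IsWeakSolutionWith.exists_regularFlow`; it rests on
`IsWeakSolutionWith.flux_eq`, `IsWeakSolutionWith.mass_forall`, `exists_rpow_curve` (the chain rule
for `(c Q)^θ`, also where `Q = 0`) and `exists_pointwise_solution`.

The asymptotic analysis compares `W` with `x^{θ/γ}`, the order of the stationary profile
`(g x)^{θ/γ}`. As long as `m x^{θ/γ} ≤ W ≤ R x^{θ/γ}`, one has `u_x = (c / W^{(1+θ)/θ}) S`, where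
the weight `c / W^{(1+θ)/θ}` is `O(x^{α-(1+θ)/γ})`, hence `O(1/x)` because `θ ≤ γ - 1`. This is just
enough to justify the energy balance `hasDerivAt_flowEnergy`. The potential energy is nonnegative
and vanishes at the stationary state, by Bernoulli's inequality, so that the energy `E` stays below
its initial value, which is small by assumption.

The two-sided bound itself follows by a continuity argument (`RegularFlow.global_bounds`). The
quantity `W + θ ρ ∫₀ˣ u` obeys an equation without `u_t`, and `∫₀ˣ u` is small compared with
`x^{θ/γ}` by Cauchy-Schwarz because `θ ≤ γ/2`. By `RegularFlow.abs_force_primitive_le` the impulse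
of the friction is at most `A x^{1/γ-α}` times the dissipation `-E'` plus a small multiple of `g x`.
Adding or subtracting `θ ρ A x^{1/γ-α} E` therefore gives barriers, and these are perturbations of
`W` that are small compared with `x^{θ/γ}` because `θ ≤ 1 - α γ`. The smallness threshold that this
requires depends only on the parameters (`exists_small_data_bounds`).

For the decay, a Poincaré inequality bounds the kinetic energy by the dissipation, which is
integrable in time, and the kinetic energy grows at a bounded rate; so it tends to `0`
(`RegularFlow.tendsto_integral_sq`). Then `∫₀ˣ u` and `∫₀ˣ H` tend to `0` uniformly, and the equation
for `W + θ ρ ∫₀ˣ u` drives `W` to the root of `W^{γ/θ} = g x`, uniformly in `x`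
(`RegularFlow.tendstoUniformlyOn_W`). Finally `|u_x| ≤ C x^{α-(1+θ)/γ}` gives `u(·,t)` a modulus of
continuity that does not depend on `t`, on `[δ,1]`, and on `[0,1]` if `θ < γ - 1`, since then the
exponent exceeds `-1`. With the decay in `L²(0,1)` this yields uniform decay
(`RegularFlow.velocity_decay`).
-/

open scoped BoundedContinuousFunction NNReal

/-! ### Curves in `L²(0,1)` and the Cauchy-Schwarz inequality -/

/-- A curve of functions on `(0,1)` converges almost everywhere along a subsequence of every
sequence of nonnegative times that converges. Curves that are continuous in `L²(0,1)` have this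
property, and it is stable under composition with continuous functions. -/
def SubseqAEContinuous (a : ℝ → ℝ → ℝ) : Prop :=
  ∀ (s : ℕ → ℝ) (t : ℝ), 0 ≤ t → Tendsto s atTop (𝓝[Ici 0] t) →
    ∃ φ : ℕ → ℕ, StrictMono φ ∧
      ∀ᵐ x ∂unitMeasure, Tendsto (fun n => a (s (φ n)) x) atTop (𝓝 (a t x))

theorem SubseqAEContinuous.of_Lp {G : ℝ → Lp ℝ 2 unitMeasure} {a : ℝ → ℝ → ℝ}
    (hG : ContinuousOn G (Ici 0)) (ha : ∀ t, 0 ≤ t → G t =ᵐ[unitMeasure] a t) :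
    SubseqAEContinuous a := by
  intro s t ht hs
  have h1 : Tendsto (fun n => G (s n)) atTop (𝓝 (G t)) := (hG t ht).tendsto.comp hs
  have h2 := h1.eventually_mem (univ_mem)
  obtain ⟨N, hN⟩ := eventually_atTop.1 (hs.eventually (eventually_mem_nhdsWithin))
  obtain ⟨φ, hφ, hφ'⟩ := (tendstoInMeasure_of_tendsto_Lp h1).exists_seq_tendsto_ae
  refine ⟨fun n => φ (n + N), hφ.comp (strictMono_id.add_const N), ?_⟩
  have h3 : ∀ᵐ x ∂unitMeasure, ∀ n, G (s (φ (n + N))) x = a (s (φ (n + N))) x := by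
    rw [ae_all_iff]
    intro n
    exact ha _ (hN _ (le_trans (Nat.le_add_left N n) (hφ.id_le _)))
  filter_upwards [h3, hφ', ha t ht] with x h3 h4 h5
  rw [← h5]
  refine Tendsto.congr (fun n => h3 n) ?_
  exact h4.comp (tendsto_add_atTop_nat N)

theorem SubseqAEContinuous.comp₂ {a b : ℝ → ℝ → ℝ} (ha : SubseqAEContinuous a)
    (hb : SubseqAEContinuous b) (Ψ : ℝ → ℝ → ℝ → ℝ)
    (hΨ : ∀ t, 0 ≤ t → ∀ᵐ x ∂unitMeasure,
      ContinuousAt (fun p : ℝ × ℝ => Ψ x p.1 p.2) (a t x, b t x)) :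
    SubseqAEContinuous (fun t x => Ψ x (a t x) (b t x)) := by
  intro s t ht hs
  obtain ⟨φ, hφ, h1⟩ := ha s t ht hs
  obtain ⟨ψ, hψ, h2⟩ := hb (s ∘ φ) t ht (hs.comp hφ.tendsto_atTop)
  refine ⟨φ ∘ ψ, hφ.comp hψ, ?_⟩
  filter_upwards [h1, h2, hΨ t ht] with x h1 h2 h3
  exact h3.tendsto.comp ((h1.comp hψ.tendsto_atTop).prodMk_nhds h2)

theorem SubseqAEContinuous.comp {a : ℝ → ℝ → ℝ} (ha : SubseqAEContinuous a) (Ψ : ℝ → ℝ → ℝ)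
    (hΨ : ∀ t, 0 ≤ t → ∀ᵐ x ∂unitMeasure, ContinuousAt (Ψ x) (a t x)) :
    SubseqAEContinuous (fun t x => Ψ x (a t x)) := by
  intro s t ht hs
  obtain ⟨φ, hφ, h1⟩ := ha s t ht hs
  refine ⟨φ, hφ, ?_⟩
  filter_upwards [h1, hΨ t ht] with x h1 h3
  exact h3.tendsto.comp h1

theorem SubseqAEContinuous.continuousOn_integral {a : ℝ → ℝ → ℝ} (ha : SubseqAEContinuous a)
    (hm : ∀ t, 0 ≤ t → AEStronglyMeasurable (a t) unitMeasure) {b : ℝ → ℝ}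
    (hb : Integrable b unitMeasure) (hab : ∀ t, 0 ≤ t → ∀ᵐ x ∂unitMeasure, |a t x| ≤ b x) :
    ContinuousOn (fun t => ∫ x, a t x ∂unitMeasure) (Ici 0) := by
  intro t ht
  refine tendsto_of_subseq_tendsto fun s hs => ?_
  obtain ⟨N, hN⟩ := eventually_atTop.1 (hs.eventually (eventually_mem_nhdsWithin))
  obtain ⟨φ, hφ, h1⟩ := ha s t ht hs
  have hk : ∀ n, 0 ≤ s (φ (n + N)) := fun n =>
    hN _ (le_trans (Nat.le_add_left N n) (hφ.id_le _))
  refine ⟨fun n => φ (n + N), ?_⟩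
  refine tendsto_integral_of_dominated_convergence b (fun n => hm _ (hk n)) hb
    (fun n => hab _ (hk n)) ?_
  filter_upwards [h1] with x h1
  exact h1.comp (tendsto_add_atTop_nat N)

/-- A bounded curve that is continuous in the sense of `SubseqAEContinuous` is continuous
in `L¹(0,1)`. -/
theorem SubseqAEContinuous.tendsto_integral_abs_sub {a : ℝ → ℝ → ℝ} (ha : SubseqAEContinuous a)
    (hm : ∀ t, 0 ≤ t → AEStronglyMeasurable (a t) unitMeasure) {M : ℝ}
    (hM : ∀ t, 0 ≤ t → ∀ᵐ x ∂unitMeasure, |a t x| ≤ M) {t : ℝ} (ht : 0 ≤ t) :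
    Tendsto (fun s => ∫ x, |a s x - a t x| ∂unitMeasure) (𝓝[Ici 0] t) (𝓝 0) := by
  have h1 : SubseqAEContinuous (fun s x => |a s x - a t x|) :=
    ha.comp (fun x y => |y - a t x|) fun s _ => ae_of_all _ fun x => by fun_prop
  have h2 := h1.continuousOn_integral (fun s hs => ((hm s hs).sub (hm t ht)).norm)
    (integrable_const (2 * M)) (fun s hs => by
      filter_upwards [hM s hs, hM t ht] with x h1 h2
      rw [abs_abs]
      calc |a s x - a t x| ≤ |a s x| + |a t x| := abs_sub _ _
        _ ≤ 2 * M := by linarith) t ht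
  simpa using h2.tendsto

/-- Cauchy-Schwarz inequality for integrals of real functions. -/
theorem sq_integral_mul_le {X : Type*} [MeasurableSpace X] {ν : Measure X} {a b : X → ℝ}
    (ha : Integrable (fun x => a x ^ 2) ν) (hb : Integrable (fun x => b x ^ 2) ν)
    (hab : Integrable (fun x => a x * b x) ν) :
    (∫ x, a x * b x ∂ν) ^ 2 ≤ (∫ x, a x ^ 2 ∂ν) * ∫ x, b x ^ 2 ∂ν := by
  have h : ∀ s : ℝ, 0 ≤ (∫ x, b x ^ 2 ∂ν) * (s * s) + (-2 * ∫ x, a x * b x ∂ν) * s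
      + ∫ x, a x ^ 2 ∂ν := by
    intro s
    have h0 : 0 ≤ ∫ x, (a x - s * b x) ^ 2 ∂ν := integral_nonneg fun x => sq_nonneg _
    have h1 : ∫ x, (a x - s * b x) ^ 2 ∂ν
        = ∫ x, (b x ^ 2 * (s * s) + (a x * b x) * (-2 * s)) + a x ^ 2 ∂ν := by
      congr 1; ext x; ring
    have h2 : Integrable (fun x => b x ^ 2 * (s * s) + (a x * b x) * (-2 * s)) ν :=
      (hb.mul_const _).add (hab.mul_const _)
    rw [h1, integral_add h2 ha,
      integral_add (hb.mul_const _) (hab.mul_const _), integral_mul_const,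
      integral_mul_const] at h0
    linarith
  have := discrim_le_zero h
  rw [discrim] at this
  nlinarith

theorem Lp_two_integral_sq (G : Lp ℝ 2 unitMeasure) : ∫ x, G x ^ 2 ∂unitMeasure = ‖G‖ ^ 2 := by
  rw [← real_inner_self_eq_norm_sq, L2.inner_def]
  congr 1; ext x; simp [sq]

theorem integrable_sq_Lp_two (G : Lp ℝ 2 unitMeasure) :
    Integrable (fun x => G x ^ 2) unitMeasure :=
  (Lp.memLp G).integrable_sq

theorem integral_abs_le_norm_Lp_two (G : Lp ℝ 2 unitMeasure) :
    ∫ x, |G x| ∂unitMeasure ≤ ‖G‖ := by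
  have h1 : Integrable (fun x => |G x|) unitMeasure := ((Lp.memLp G).integrable (by norm_num)).abs
  have h := sq_integral_mul_le (ν := unitMeasure) (a := fun x => |G x|) (b := fun _ => 1)
    (by simpa using integrable_sq_Lp_two G) (by simp) (by simpa using h1)
  simp only [mul_one, sq_abs, one_pow, Lp_two_integral_sq] at h
  have h2 : ∫ x, (1 : ℝ) ∂unitMeasure = 1 := by simp
  rw [h2, mul_one] at h
  exact (le_abs_self _).trans (abs_le_of_sq_le_sq h (norm_nonneg _))

/-! ### Weak time derivatives and test functions on the unit interval -/

theorem integrable_unitMeasure_iff {f : ℝ → ℝ} :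
    Integrable f unitMeasure ↔ IntervalIntegrable f volume 0 1 :=
  (intervalIntegrable_iff_integrableOn_Ioo_of_le zero_le_one).symm

theorem integral_unitMeasure (f : ℝ → ℝ) : ∫ x, f x ∂unitMeasure = ∫ x in (0 : ℝ)..1, f x := by
  rw [intervalIntegral.integral_of_le zero_le_one, integral_Ioc_eq_integral_Ioo]

/-- Integration by parts for primitives of integrable functions. -/
theorem integral_primitive_mul {f v : ℝ → ℝ} {a b c d p₀ v₀ : ℝ}
    (hf : IntervalIntegrable f volume a b) (hv : IntervalIntegrable v volume a b)
    (hc : c ∈ uIcc a b) (hd : d ∈ uIcc a b) :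
    ∫ x in a..b, (v₀ + ∫ y in d..x, v y) * f x
      = (v₀ + ∫ y in d..b, v y) * (p₀ + ∫ y in c..b, f y)
        - (v₀ + ∫ y in d..a, v y) * (p₀ + ∫ y in c..a, f y)
        - ∫ x in a..b, v x * (p₀ + ∫ y in c..x, f y) := by
  have hV : AbsolutelyContinuousOnInterval (fun x => v₀ + ∫ y in d..x, v y) a b :=
    ((contDiffOn_const (c := v₀) (n := 1)).absolutelyContinuousOnInterval).fun_add
      (hv.absolutelyContinuousOnInterval_intervalIntegral hd)
  have hP : AbsolutelyContinuousOnInterval (fun x => p₀ + ∫ y in c..x, f y) a b :=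
    ((contDiffOn_const (c := p₀) (n := 1)).absolutelyContinuousOnInterval).fun_add
      (hf.absolutelyContinuousOnInterval_intervalIntegral hc)
  have h := hV.integral_mul_deriv_eq_deriv_mul hP
  have h1 : ∫ x in a..b, (v₀ + ∫ y in d..x, v y) * deriv (fun x => p₀ + ∫ y in c..x, f y) x
      = ∫ x in a..b, (v₀ + ∫ y in d..x, v y) * f x := by
    refine intervalIntegral.integral_congr_ae ?_
    filter_upwards [hf.ae_hasDerivAt_integral] with x hx hx'
    rw [((hx (uIoc_subset_uIcc hx') c hc).const_add p₀).deriv]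
  have h2 : ∫ x in a..b, deriv (fun x => v₀ + ∫ y in d..x, v y) x * (p₀ + ∫ y in c..x, f y)
      = ∫ x in a..b, v x * (p₀ + ∫ y in c..x, f y) := by
    refine intervalIntegral.integral_congr_ae ?_
    filter_upwards [hv.ae_hasDerivAt_integral] with x hx hx'
    rw [((hx (uIoc_subset_uIcc hx') d hd).const_add v₀).deriv]
  rw [h1, h2] at h
  exact h

theorem integrableOn_Ioi_of_eventually_zero {k : ℝ → ℝ} {R : ℝ} (hk : ContinuousOn k (Ici 0))
    (hR : ∀ t, R ≤ t → k t = 0) : IntegrableOn k (Ioi 0) := by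
  have h1 : IntegrableOn k (Icc 0 R) :=
    (hk.mono Icc_subset_Ici_self).integrableOn_Icc
  have h2 : IntegrableOn k (Ici R) := by
    refine (integrableOn_congr_fun (g := fun _ => (0 : ℝ)) ?_ measurableSet_Ici).2 (by simp)
    intro t ht
    exact hR t ht
  refine (h1.union h2).mono_set ?_
  intro t ht
  rcases le_total t R with h | h
  · exact Or.inl ⟨le_of_lt ht, h⟩
  · exact Or.inr h

/-- A differential equation in time, with its initial value, in the sense of distributions on
`[0,∞)` holds pointwise if all functions are continuous. -/
theorem eq_of_weak_time_derivative {A A' B : ℝ → ℝ} {a₀ : ℝ}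
    (hA : ∀ t, 0 ≤ t → HasDerivWithinAt A (A' t) (Ici 0) t) (hA' : ContinuousOn A' (Ici 0))
    (hB : ContinuousOn B (Ici 0))
    (h : ∀ η : ℝ → ℝ, ContDiff ℝ ((⊤ : ℕ∞) : WithTop ℕ∞) η → HasCompactSupport η →
      (∫ t in Ioi (0 : ℝ), (A t * deriv η t + B t * η t)) + a₀ * η 0 = 0) :
    (∀ t, 0 ≤ t → A' t = B t) ∧ A 0 = a₀ := by
  have hAc : ContinuousOn A (Ici 0) := fun t ht => (hA t ht).continuousWithinAt
  -- integrate by parts in time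
  have key : ∀ η : ℝ → ℝ, ContDiff ℝ ((⊤ : ℕ∞) : WithTop ℕ∞) η → HasCompactSupport η →
      (∫ t in Ioi (0 : ℝ), η t • (B t - A' t)) + (a₀ - A 0) * η 0 = 0 := by
    intro η hη hηs
    obtain ⟨R, hR⟩ := hηs.isCompact.isBounded.bddAbove
    have hz : ∀ t, R + 1 ≤ t → η t = 0 := by
      intro t ht
      by_contra hne
      have := hR (subset_tsupport η hne)
      linarith
    have hz' : ∀ t, R + 1 ≤ t → deriv η t = 0 := by
      intro t ht
      by_contra hne
      have := hR (tsupport_deriv_subset (f := η) (𝕜 := ℝ) (subset_tsupport _ hne))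
      linarith
    have hηc : Continuous η := hη.continuous
    have hηd : Continuous (deriv η) := hη.continuous_deriv (by simp)
    have hηd' : ∀ t, HasDerivAt η (deriv η t) t := fun t =>
      (hη.differentiable (by simp) t).hasDerivAt
    have i1 : IntegrableOn (fun t => A t * deriv η t + A' t * η t) (Ioi 0) :=
      integrableOn_Ioi_of_eventually_zero (R := R + 1)
        ((hAc.mul hηd.continuousOn).add (hA'.mul hηc.continuousOn))
        (fun t ht => by rw [hz t ht, hz' t ht]; ring)
    have i2 : IntegrableOn (fun t => A t * deriv η t + B t * η t) (Ioi 0) :=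
      integrableOn_Ioi_of_eventually_zero (R := R + 1)
        ((hAc.mul hηd.continuousOn).add (hB.mul hηc.continuousOn))
        (fun t ht => by rw [hz t ht, hz' t ht]; ring)
    have e1 : ∫ t in Ioi (0 : ℝ), (A t * deriv η t + A' t * η t) = 0 - A 0 * η 0 := by
      refine integral_Ioi_of_hasDerivAt_of_tendsto (f := fun t => A t * η t) ?_ ?_ i1 ?_
      · exact (hAc.mul hηc.continuousOn) 0 (by simp)
      · intro t ht
        exact (((hA t (le_of_lt ht)).hasDerivAt (Ici_mem_nhds ht)).mul (hηd' t)).congr_deriv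
          (by ring)
      · refine tendsto_const_nhds.congr' ?_
        filter_upwards [eventually_ge_atTop (R + 1)] with t ht
        rw [hz t ht, mul_zero]
    have e2 := h η hη hηs
    have e3 : ∫ t in Ioi (0 : ℝ), η t • (B t - A' t)
        = (∫ t in Ioi (0 : ℝ), (A t * deriv η t + B t * η t))
          - ∫ t in Ioi (0 : ℝ), (A t * deriv η t + A' t * η t) := by
      rw [← integral_sub i2 i1]
      congr 1; ext t; simp only [smul_eq_mul]; ring
    rw [e3, e1]
    linarith
  have hd : ContinuousOn (fun t => B t - A' t) (Ici 0) := hB.sub hA'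
  -- test functions supported in `(0,∞)` give the equation, a bump at `0` the initial value
  have h1 : ∀ᵐ t ∂(volume : Measure ℝ), t ∈ Ioi (0 : ℝ) → B t - A' t = 0 := by
    refine isOpen_Ioi.ae_eq_zero_of_integral_contDiff_smul_eq_zero
      ((hd.mono Ioi_subset_Ici_self).locallyIntegrableOn measurableSet_Ioi) ?_
    intro η hη hηs hηt
    have h0 : η 0 = 0 := by
      by_contra hne
      exact lt_irrefl (0 : ℝ) (hηt (subset_tsupport η hne))
    have := key η hη hηs
    rw [h0, mul_zero, add_zero] at this
    rw [← this]
    symm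
    refine setIntegral_eq_integral_of_forall_compl_eq_zero ?_
    intro t ht
    have : η t = 0 := by
      by_contra hne
      exact ht (hηt (subset_tsupport η hne))
    rw [this, zero_smul]
  have h2 : EqOn (fun t => B t - A' t) (fun _ => 0) (Ioi 0) := by
    refine Measure.eqOn_open_of_ae_eq (μ := volume) ?_ isOpen_Ioi
      (hd.mono Ioi_subset_Ici_self) continuousOn_const
    exact (ae_restrict_iff' measurableSet_Ioi).2 h1
  have h3 : EqOn (fun t => B t - A' t) (fun _ => 0) (Ici 0) := by
    refine h2.of_subset_closure hd continuousOn_const Ioi_subset_Ici_self ?_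
    rw [closure_Ioi]
  refine ⟨fun t ht => by have := h3 ht; simp only at this; linarith, ?_⟩
  let bump : ContDiffBump (0 : ℝ) := ⟨1, 2, by norm_num, by norm_num⟩
  have h4 := key bump bump.contDiff bump.hasCompactSupport
  have h5 : ∫ t in Ioi (0 : ℝ), bump t • (B t - A' t) = 0 := by
    refine setIntegral_eq_zero_of_forall_eq_zero fun t ht => ?_
    have := h2 ht
    simp only at this
    simp [this]
  rw [h5, bump.one_of_mem_closedBall (by simp [bump.rIn_pos.le])] at h4
  linarith

/-- A primitive of `χ - χ(· + 2)`: a test function on `{x < 1}` whose derivative is `χ`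
on `(0,1)`. -/
theorem exists_test_primitive {χ : ℝ → ℝ} (hχ : ContDiff ℝ ((⊤ : ℕ∞) : WithTop ℕ∞) χ)
    (hχs : HasCompactSupport χ) (hχt : tsupport χ ⊆ Ioo 0 1) :
    ∃ ψ : ℝ → ℝ, ContDiff ℝ ((⊤ : ℕ∞) : WithTop ℕ∞) ψ ∧ HasCompactSupport ψ ∧
      tsupport ψ ⊆ Iio 1 ∧ ∀ x ∈ Ioo (0 : ℝ) 1, deriv ψ x = χ x := by
  obtain ⟨b, hb1, hb⟩ : ∃ b < 1, ∀ x, b ≤ x → χ x = 0 := by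
    rcases (tsupport χ).eq_empty_or_nonempty with he | hne
    · refine ⟨0, by norm_num, fun x _ => ?_⟩
      exact image_eq_zero_of_notMem_tsupport (by rw [he]; simp)
    · obtain ⟨m, hm, hm'⟩ := hχs.isCompact.exists_isGreatest hne
      have := (hχt hm).2
      refine ⟨(m + 1) / 2, by linarith, fun x hx => ?_⟩
      by_contra hne
      have := hm' (subset_tsupport χ hne)
      linarith
  have h0 : ∀ x, x ≤ 0 → χ x = 0 := by
    intro x hx
    by_contra hne
    exact absurd (hχt (subset_tsupport χ hne)).1 (not_lt.2 hx)
  have hc : Continuous χ := hχ.continuous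
  have hc2 : Continuous fun y => χ (y + 2) := hc.comp (continuous_id.add continuous_const)
  have hcd : Continuous fun y => χ y - χ (y + 2) := hc.sub hc2
  set ψ : ℝ → ℝ := fun x => ∫ y in (-5 : ℝ)..x, (χ y - χ (y + 2)) with hψ
  have hd : ∀ x, HasDerivAt ψ (χ x - χ (x + 2)) x := fun x =>
    intervalIntegral.integral_hasDerivAt_right (hcd.intervalIntegrable _ _)
      (hcd.stronglyMeasurableAtFilter _ _) hcd.continuousAt
  have hd' : deriv ψ = fun x => χ x - χ (x + 2) := funext fun x => (hd x).deriv
  have hsmooth : ContDiff ℝ ((⊤ : ℕ∞) : WithTop ℕ∞) ψ := by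
    rw [contDiff_infty_iff_deriv]
    refine ⟨fun x => (hd x).differentiableAt, ?_⟩
    rw [hd']
    exact hχ.sub (hχ.comp (contDiff_id.add contDiff_const))
  have hsplit : ∀ x, ψ x = (∫ y in (-5 : ℝ)..x, χ y) - ∫ y in (-3 : ℝ)..(x + 2), χ y := by
    intro x
    rw [hψ]
    simp only
    rw [intervalIntegral.integral_sub (hc.intervalIntegrable _ _) (hc2.intervalIntegrable _ _),
      intervalIntegral.integral_comp_add_right (fun y => χ y) 2]
    norm_num
  have hzero : ∀ a c, (∀ y ∈ uIcc a c, χ y = 0) → ∫ y in a..c, χ y = 0 := by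
    intro a c h
    rw [intervalIntegral.integral_congr (g := fun _ => (0 : ℝ)) h]
    simp
  have hleft : ∀ x, x ≤ -2 → ψ x = 0 := by
    intro x hx
    rw [hsplit, hzero, hzero, sub_zero]
    · intro y hy
      exact h0 y (hy.2.trans (sup_le (by norm_num) (by linarith)))
    · intro y hy
      exact h0 y (hy.2.trans (sup_le (by norm_num) (by linarith)))
  have hright : ∀ x, b ≤ x → ψ x = 0 := by
    intro x hx
    have e1 := intervalIntegral.integral_add_adjacent_intervals
      (hc.intervalIntegrable (μ := volume) (-5) (-3)) (hc.intervalIntegrable (-3) x)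
    have e2 := intervalIntegral.integral_add_adjacent_intervals
      (hc.intervalIntegrable (μ := volume) (-3) x) (hc.intervalIntegrable x (x + 2))
    have z1 : ∫ y in (-5 : ℝ)..(-3), χ y = 0 := hzero _ _ fun y hy =>
      h0 y (hy.2.trans (sup_le (by norm_num) (by norm_num)))
    have z2 : ∫ y in x..(x + 2), χ y = 0 := hzero _ _ fun y hy =>
      hb y ((le_inf hx (by linarith)).trans hy.1)
    rw [hsplit, ← e1, ← e2, z1, z2]
    ring
  have hsub : tsupport ψ ⊆ Icc (-2) b := by
    refine closure_minimal (fun x hx => ?_) isClosed_Icc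
    constructor
    · by_contra hlt
      exact hx (hleft x (le_of_not_ge hlt))
    · by_contra hlt
      exact hx (hright x (le_of_not_ge hlt))
  refine ⟨ψ, hsmooth, isCompact_Icc.of_isClosed_subset (isClosed_tsupport ψ) hsub,
    fun x hx => lt_of_le_of_lt (hsub hx).2 hb1, fun x hx => ?_⟩
  rw [hd']
  simp only
  rw [hb (x + 2) (by linarith [hx.1]), sub_zero]

/-- If `k' = -f` on `(0,1)` in the sense of distributions, with the natural boundary condition
at `0`, then `k` is minus the primitive of `f` that vanishes at `0`. -/
theorem ae_eq_neg_primitive {k f : ℝ → ℝ} (hk : Integrable k unitMeasure)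
    (hf : Integrable f unitMeasure)
    (h : ∀ ψ : ℝ → ℝ, ContDiff ℝ ((⊤ : ℕ∞) : WithTop ℕ∞) ψ → HasCompactSupport ψ →
      tsupport ψ ⊆ Iio 1 →
      ∫ x, k x * deriv ψ x ∂unitMeasure = ∫ x, f x * ψ x ∂unitMeasure) :
    ∀ᵐ x ∂unitMeasure, k x = - ∫ y in (0 : ℝ)..x, f y := by
  have hf' := integrable_unitMeasure_iff.1 hf
  have hPc : ContinuousOn (fun x => ∫ y in (0 : ℝ)..x, f y) (uIcc 0 1) :=
    intervalIntegral.continuousOn_primitive_interval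
      (by rw [uIcc_of_le zero_le_one]; exact (integrableOn_Icc_iff_integrableOn_Ioo).2 hf)
  have hPi : Integrable (fun x => ∫ y in (0 : ℝ)..x, f y) unitMeasure :=
    integrable_unitMeasure_iff.2 hPc.intervalIntegrable
  have hki : Integrable (fun x => k x + ∫ y in (0 : ℝ)..x, f y) unitMeasure := hk.add hPi
  have h1 : ∀ᵐ x ∂(volume : Measure ℝ), x ∈ Ioo (0 : ℝ) 1 →
      k x + (∫ y in (0 : ℝ)..x, f y) = 0 := by
    refine isOpen_Ioo.ae_eq_zero_of_integral_contDiff_smul_eq_zero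
      (IntegrableOn.locallyIntegrableOn hki) ?_
    intro χ hχ hχs hχt
    -- `χ` is arbitrary; on `(0,1)` it is the derivative of an admissible test function
    obtain ⟨ψ, hψ, hψs, hψt, hψd⟩ := exists_test_primitive hχ hχs hχt
    have e1 := h ψ hψ hψs hψt
    have hψ1 : ψ 1 = 0 := by
      by_contra hne
      exact lt_irrefl (1 : ℝ) (hψt (subset_tsupport ψ hne))
    have hdc : Continuous (deriv ψ) := hψ.continuous_deriv (by simp)
    have hψi : ∀ x, ψ 0 + ∫ y in (0 : ℝ)..x, deriv ψ y = ψ x := by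
      intro x
      rw [intervalIntegral.integral_deriv_eq_sub (fun y _ => hψ.differentiable (by simp) y)
        (hdc.intervalIntegrable _ _)]
      ring
    have e2 := integral_primitive_mul (p₀ := 0) (v₀ := ψ 0) (c := 0) (d := 0) hf'
      (hdc.intervalIntegrable 0 1) (by simp) (by simp)
    simp only [hψi, hψ1, zero_add, intervalIntegral.integral_same, zero_mul, mul_zero,
      sub_zero, zero_sub] at e2
    have e3 : ∫ x, f x * ψ x ∂unitMeasure
        = - ∫ x, deriv ψ x * (∫ y in (0 : ℝ)..x, f y) ∂unitMeasure := by
      rw [integral_unitMeasure, integral_unitMeasure, ← e2]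
      congr 1; ext x; ring
    have e4 : ∫ x, χ x • (k x + ∫ y in (0 : ℝ)..x, f y) ∂(volume : Measure ℝ)
        = ∫ x, (k x * deriv ψ x + deriv ψ x * (∫ y in (0 : ℝ)..x, f y)) ∂unitMeasure := by
      rw [← setIntegral_eq_integral_of_forall_compl_eq_zero (s := Ioo 0 1)]
      · refine setIntegral_congr_fun measurableSet_Ioo fun x hx => ?_
        simp only [smul_eq_mul, hψd x hx]
        ring
      · intro x hx
        have : χ x = 0 := by
          by_contra hne
          exact hx (hχt (subset_tsupport χ hne))
        rw [this, zero_smul]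
    obtain ⟨C, hC⟩ := isCompact_Icc.exists_bound_of_continuousOn (s := Icc (0:ℝ) 1)
      hdc.continuousOn
    have hCae : ∀ᵐ x ∂unitMeasure, ‖deriv ψ x‖ ≤ C :=
      (ae_restrict_iff' measurableSet_Ioo).2 (ae_of_all _ fun x hx => hC x ⟨hx.1.le, hx.2.le⟩)
    have j1 : Integrable (fun x => k x * deriv ψ x) unitMeasure := by
      have := hk.bdd_mul hdc.aestronglyMeasurable hCae
      simpa only [mul_comm] using this
    have j2 : Integrable (fun x => deriv ψ x * ∫ y in (0 : ℝ)..x, f y) unitMeasure :=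
      hPi.bdd_mul hdc.aestronglyMeasurable hCae
    rw [e4, integral_add j1 j2, e1, e3]
    ring
  refine (ae_restrict_iff' measurableSet_Ioo).2 ?_
  filter_upwards [h1] with x hx hx'
  linarith [hx hx']

/-! ### Calculus of `C¹` curves in `L²(0,1)` -/

theorem SubseqAEContinuous.congr {a b : ℝ → ℝ → ℝ} (ha : SubseqAEContinuous a)
    (hab : ∀ t, 0 ≤ t → a t =ᵐ[unitMeasure] b t) : SubseqAEContinuous b := by
  intro s t ht hs
  obtain ⟨φ, hφ, h1⟩ := ha s t ht hs
  obtain ⟨N, hN⟩ := eventually_atTop.1 (hs.eventually (eventually_mem_nhdsWithin))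
  refine ⟨fun n => φ (n + N), hφ.comp (strictMono_id.add_const N), ?_⟩
  have h3 : ∀ᵐ x ∂unitMeasure, ∀ n, a (s (φ (n + N))) x = b (s (φ (n + N))) x := by
    rw [ae_all_iff]
    intro n
    exact hab _ (hN _ (le_trans (Nat.le_add_left N n) (hφ.id_le _)))
  filter_upwards [h1, h3, hab t ht] with x h1 h3 h4
  rw [← h4]
  exact Tendsto.congr (fun n => h3 n) (h1.comp (tendsto_add_atTop_nat N))

theorem ContDiffOn.hasDerivWithinAt_Ici {E : Type*} [NormedAddCommGroup E] [NormedSpace ℝ E]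
    {G : ℝ → E} (hG : ContDiffOn ℝ 1 G (Ici 0)) {t : ℝ} (ht : 0 ≤ t) :
    HasDerivWithinAt G (derivWithin G (Ici 0) t) (Ici 0) t :=
  ((hG.differentiableOn (by simp)) t ht).hasDerivWithinAt

theorem ContDiffOn.continuousOn_derivWithin_Ici {E : Type*} [NormedAddCommGroup E]
    [NormedSpace ℝ E] {G : ℝ → E} (hG : ContDiffOn ℝ 1 G (Ici 0)) :
    ContinuousOn (derivWithin G (Ici 0)) (Ici 0) :=
  hG.continuousOn_derivWithin (uniqueDiffOn_Ici 0) le_rfl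

namespace IsC1InL2

variable {w wt : ℝ → ℝ → ℝ}

theorem subseqAEContinuous (h : IsC1InL2 w wt) : SubseqAEContinuous w := by
  obtain ⟨G, hG, h1, -⟩ := h
  exact .of_Lp hG.continuousOn h1

theorem subseqAEContinuous_deriv (h : IsC1InL2 w wt) : SubseqAEContinuous wt := by
  obtain ⟨G, hG, -, h1⟩ := h
  exact .of_Lp hG.continuousOn_derivWithin_Ici h1

theorem memLp (h : IsC1InL2 w wt) {t : ℝ} (ht : 0 ≤ t) : MemLp (w t) 2 unitMeasure := by
  obtain ⟨G, -, h1, -⟩ := h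
  exact (memLp_congr_ae (h1 t ht)).1 (Lp.memLp _)

theorem memLp_deriv (h : IsC1InL2 w wt) {t : ℝ} (ht : 0 ≤ t) : MemLp (wt t) 2 unitMeasure := by
  obtain ⟨G, -, -, h1⟩ := h
  exact (memLp_congr_ae (h1 t ht)).1 (Lp.memLp _)

theorem integrable (h : IsC1InL2 w wt) {t : ℝ} (ht : 0 ≤ t) : Integrable (w t) unitMeasure :=
  (h.memLp ht).integrable (by norm_num)

theorem integrable_deriv (h : IsC1InL2 w wt) {t : ℝ} (ht : 0 ≤ t) :
    Integrable (wt t) unitMeasure :=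
  (h.memLp_deriv ht).integrable (by norm_num)

/-- Pairing a `C¹` curve in `L²(0,1)` with a fixed `L²` function. -/
theorem hasDerivWithinAt_integral_mul (h : IsC1InL2 w wt) {ψ : ℝ → ℝ}
    (hψ : MemLp ψ 2 unitMeasure) {t : ℝ} (ht : 0 ≤ t) :
    HasDerivWithinAt (fun t => ∫ x, w t x * ψ x ∂unitMeasure) (∫ x, wt t x * ψ x ∂unitMeasure)
      (Ici 0) t := by
  obtain ⟨G, hG, h1, h2⟩ := h
  have e : ∀ (F : Lp ℝ 2 unitMeasure) (v : ℝ → ℝ), F =ᵐ[unitMeasure] v →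
      ∫ x, v x * ψ x ∂unitMeasure = Inner.inner ℝ (hψ.toLp ψ) F := by
    intro F v hF
    rw [L2.inner_def]
    refine integral_congr_ae ?_
    filter_upwards [hF, hψ.coeFn_toLp] with x h3 h4
    simp [h3, h4]
  have hd := (HasDerivWithinAt.inner ℝ (hasDerivWithinAt_const t (Ici 0) (hψ.toLp ψ))
    (hG.hasDerivWithinAt_Ici ht))
  rw [inner_zero_left, add_zero, ← e _ _ (h2 t ht)] at hd
  exact hd.congr (fun s hs => e _ _ (h1 s hs)) (e _ _ (h1 t ht))

theorem continuousOn_integral_deriv_mul (h : IsC1InL2 w wt) {ψ : ℝ → ℝ}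
    (hψ : MemLp ψ 2 unitMeasure) :
    ContinuousOn (fun t => ∫ x, wt t x * ψ x ∂unitMeasure) (Ici 0) := by
  obtain ⟨G, hG, h1, h2⟩ := h
  have e : ∀ (F : Lp ℝ 2 unitMeasure) (v : ℝ → ℝ), F =ᵐ[unitMeasure] v →
      ∫ x, v x * ψ x ∂unitMeasure = Inner.inner ℝ (hψ.toLp ψ) F := by
    intro F v hF
    rw [L2.inner_def]
    refine integral_congr_ae ?_
    filter_upwards [hF, hψ.coeFn_toLp] with x h3 h4
    simp [h3, h4]
  have := (continuousOn_const (c := hψ.toLp ψ)).inner (𝕜 := ℝ)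
    (hG.continuousOn_derivWithin_Ici)
  exact this.congr fun t ht => e _ _ (h2 t ht)

theorem tendsto_integral_abs_deriv_sub (h : IsC1InL2 w wt) {t : ℝ} (ht : 0 ≤ t) :
    Tendsto (fun s => ∫ x, |wt s x - wt t x| ∂unitMeasure) (𝓝[Ici 0] t) (𝓝 0) := by
  obtain ⟨G, hG, h1, h2⟩ := h
  have h3 : Tendsto (fun s => ‖derivWithin G (Ici 0) s - derivWithin G (Ici 0) t‖)
      (𝓝[Ici 0] t) (𝓝 0) :=
    tendsto_iff_norm_sub_tendsto_zero.1 (hG.continuousOn_derivWithin_Ici t ht).tendsto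
  refine squeeze_zero' (Eventually.of_forall fun s => integral_nonneg fun x => abs_nonneg _) ?_ h3
  filter_upwards [self_mem_nhdsWithin] with s hs
  refine le_trans (le_of_eq ?_) (integral_abs_le_norm_Lp_two _)
  refine integral_congr_ae ?_
  filter_upwards [h2 s hs, h2 t ht, Lp.coeFn_sub (derivWithin G (Ici 0) s)
    (derivWithin G (Ici 0) t)] with x h4 h5 h6
  rw [h6, Pi.sub_apply, h4, h5]

/-- Half of the squared `L²` norm of a `C¹` curve. -/
theorem hasDerivWithinAt_half_integral_sq (h : IsC1InL2 w wt) {t : ℝ} (ht : 0 ≤ t) :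
    HasDerivWithinAt (fun t => (∫ x, w t x ^ 2 ∂unitMeasure) / 2)
      (∫ x, w t x * wt t x ∂unitMeasure) (Ici 0) t := by
  obtain ⟨G, hG, h1, h2⟩ := h
  have e : ∀ s, 0 ≤ s → (∫ x, w s x ^ 2 ∂unitMeasure) / 2 = ‖G s‖ ^ 2 / 2 := by
    intro s hs
    rw [← Lp_two_integral_sq]
    congr 1
    refine integral_congr_ae ?_
    filter_upwards [h1 s hs] with x h3
    rw [h3]
  have hd := ((hG.hasDerivWithinAt_Ici ht).norm_sq).div_const 2
  refine (hd.congr_deriv ?_).congr (fun s hs => e s hs) (e t ht)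
  rw [mul_div_cancel_left₀ _ two_ne_zero, L2.inner_def]
  refine integral_congr_ae ?_
  filter_upwards [h1 t ht, h2 t ht] with x h3 h4
  simp [h3, h4, mul_comm]

end IsC1InL2

theorem frictionCoeff_nonneg {f ρl q : ℝ} (hf : 0 ≤ f) : 0 ≤ frictionCoeff f ρl q := by
  unfold frictionCoeff
  positivity

theorem frictionCoeff_le {f ρl q : ℝ} (hf : 0 ≤ f) (hq : 0 ≤ q) :
    frictionCoeff f ρl q ≤ f * ρl ^ 2 := by
  unfold frictionCoeff
  have : q ^ 2 / (1 + q) ^ 2 ≤ 1 := by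
    rw [div_le_one (by positivity)]
    nlinarith
  have h2 : 0 ≤ f * ρl ^ 2 := by positivity
  nlinarith

theorem frictionCoeff_le_sq {f ρl q : ℝ} (hf : 0 ≤ f) (hq : 0 ≤ q) :
    frictionCoeff f ρl q ≤ f * ρl ^ 2 * q ^ 2 := by
  unfold frictionCoeff
  have : q ^ 2 / (1 + q) ^ 2 ≤ q ^ 2 := div_le_self (by positivity) (by nlinarith)
  have h2 : 0 ≤ f * ρl ^ 2 := by positivity
  nlinarith

theorem continuousAt_frictionCoeff {f ρl q : ℝ} (hq : 0 ≤ q) :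
    ContinuousAt (frictionCoeff f ρl) q := by
  unfold frictionCoeff
  have : (1 + q) ^ 2 ≠ 0 := by positivity
  exact continuousAt_const.mul (ContinuousAt.div (by fun_prop) (by fun_prop) this)

theorem measurable_frictionCoeff (f ρl : ℝ) : Measurable (frictionCoeff f ρl) := by
  unfold frictionCoeff
  fun_prop

theorem isTestFunction_mul {ψ η : ℝ → ℝ} (hψ : ContDiff ℝ ((⊤ : ℕ∞) : WithTop ℕ∞) ψ)
    (hψs : HasCompactSupport ψ) (hψt : tsupport ψ ⊆ Iio 1)
    (hη : ContDiff ℝ ((⊤ : ℕ∞) : WithTop ℕ∞) η) (hηs : HasCompactSupport η) :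
    IsTestFunction (fun p : ℝ × ℝ => ψ p.1 * η p.2) := by
  have hsub : tsupport (fun p : ℝ × ℝ => ψ p.1 * η p.2) ⊆ tsupport ψ ×ˢ tsupport η := by
    refine closure_minimal (fun p hp => ?_) ((isClosed_tsupport ψ).prod (isClosed_tsupport η))
    exact ⟨subset_tsupport ψ (left_ne_zero_of_mul hp), subset_tsupport η (right_ne_zero_of_mul hp)⟩
  refine ⟨(hψ.comp contDiff_fst).mul (hη.comp contDiff_snd), ?_, fun p hp => hψt (hsub hp).1⟩
  exact (hψs.isCompact.prod hηs.isCompact).of_isClosed_subset (isClosed_tsupport _) hsub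

/-! ### The flux of a weak solution and the mass equation at every time -/

/-- The viscous flux `c^θ Q^{1+θ} u_x`. -/
noncomputable def viscousFlux (θ : ℝ) (c : ℝ → ℝ) (Q ux : ℝ → ℝ → ℝ) (t x : ℝ) : ℝ :=
  c x ^ θ * Q t x ^ (1 + θ) * ux t x

/-- The friction force `h(Q) u |u|`. -/
noncomputable def frictionForce (f ρl : ℝ) (Q u : ℝ → ℝ → ℝ) (t x : ℝ) : ℝ :=
  frictionCoeff f ρl (Q t x) * u t x * |u t x|

theorem unitMeasure_ae {P : ℝ → Prop} (h : ∀ x ∈ Ioo (0 : ℝ) 1, P x) : ∀ᵐ x ∂unitMeasure, P x :=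
  (ae_restrict_iff' measurableSet_Ioo).2 (ae_of_all _ h)

theorem unitMeasure_ae_mem : ∀ᵐ x ∂unitMeasure, x ∈ Ioo (0 : ℝ) 1 :=
  unitMeasure_ae fun _ h => h

/-- A function that is orthogonal to all test functions on `(0,1)` vanishes. -/
theorem ae_eq_zero_of_integral_test {k : ℝ → ℝ} (hk : Integrable k unitMeasure)
    (h : ∀ ψ : ℝ → ℝ, ContDiff ℝ ((⊤ : ℕ∞) : WithTop ℕ∞) ψ → HasCompactSupport ψ →
      tsupport ψ ⊆ Iio 1 → ∫ x, k x * ψ x ∂unitMeasure = 0) :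
    ∀ᵐ x ∂unitMeasure, k x = 0 := by
  refine (ae_restrict_iff' measurableSet_Ioo).2 ?_
  refine isOpen_Ioo.ae_eq_zero_of_integral_contDiff_smul_eq_zero
    (IntegrableOn.locallyIntegrableOn hk) fun ψ hψ hψs hψt => ?_
  rw [← h ψ hψ hψs (hψt.trans Ioo_subset_Iio_self),
    ← setIntegral_eq_integral_of_forall_compl_eq_zero (s := Ioo 0 1)]
  · refine integral_congr_ae (ae_of_all _ fun x => ?_)
    simp only [smul_eq_mul]; ring
  · intro x hx
    have : ψ x = 0 := by
      by_contra hne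
      exact hx (hψt (subset_tsupport ψ hne))
    rw [this, zero_smul]

theorem memLp_of_continuous_compactSupport {ψ : ℝ → ℝ} (h : Continuous ψ)
    (hs : HasCompactSupport ψ) : MemLp ψ 2 unitMeasure := by
  obtain ⟨C, hC⟩ := h.bounded_above_of_compact_support hs
  exact MemLp.of_bound h.aestronglyMeasurable C (ae_of_all _ hC)

theorem integrable_of_bound {k : ℝ → ℝ} {M : ℝ} (hk : AEStronglyMeasurable k unitMeasure)
    (h : ∀ᵐ x ∂unitMeasure, |k x| ≤ M) : Integrable k unitMeasure :=
  Integrable.of_bound hk M h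

namespace IsWeakSolutionWith

variable {ρl g f γ θ : ℝ} {c₀ Q₀ u₀ : ℝ → ℝ} {Q u ux wt : ℝ → ℝ → ℝ}

theorem subseq_Q (h : IsWeakSolutionWith ρl g f γ θ c₀ Q₀ u₀ Q u ux wt)
    (hc : ∀ x ∈ Ioo (0 : ℝ) 1, 0 < c₀ x) : SubseqAEContinuous Q := by
  have h1 := h.cQ_C1.subseqAEContinuous.comp (fun x s => s / c₀ x)
    fun t _ => ae_of_all _ fun x => by fun_prop
  refine h1.congr fun t _ => ?_
  filter_upwards [unitMeasure_ae_mem] with x hx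
  rw [mul_div_cancel_left₀ _ (hc x hx).ne']

theorem subseq_u (h : IsWeakSolutionWith ρl g f γ θ c₀ Q₀ u₀ Q u ux wt) :
    SubseqAEContinuous u := by
  obtain ⟨ut, hut⟩ := h.u_C1
  exact hut.subseqAEContinuous

theorem subseq_friction (h : IsWeakSolutionWith ρl g f γ θ c₀ Q₀ u₀ Q u ux wt)
    (hc : ∀ x ∈ Ioo (0 : ℝ) 1, 0 < c₀ x) : SubseqAEContinuous (frictionForce f ρl Q u) := by
  refine (h.subseq_Q hc).comp₂ h.subseq_u (fun _ q v => frictionCoeff f ρl q * v * |v|) ?_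
  intro t ht
  filter_upwards [h.nonneg t ht] with x hx
  have h1 : ContinuousAt (fun p : ℝ × ℝ => frictionCoeff f ρl p.1) (Q t x, u t x) :=
    ContinuousAt.comp (f := Prod.fst) (g := frictionCoeff f ρl)
      (continuousAt_frictionCoeff hx) continuousAt_fst
  exact (h1.mul continuousAt_snd).mul continuousAt_snd.abs

theorem subseq_flux (h : IsWeakSolutionWith ρl g f γ θ c₀ Q₀ u₀ Q u ux wt) :
    SubseqAEContinuous (viscousFlux θ c₀ Q ux) := by
  obtain ⟨G, hG, hG'⟩ := h.flux_holder
  refine .of_Lp (G := G) (fun t ht => ?_) hG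
  obtain ⟨K, hK⟩ := hG' (t + 1)
  have h1 := (hK.continuousOn (by norm_num)) t ⟨ht, by linarith⟩
  refine h1.mono_of_mem_nhdsWithin ?_
  rw [← Ici_inter_Iic]
  exact inter_mem_nhdsWithin _ (Iic_mem_nhds (by linarith))

theorem flux_memLp (h : IsWeakSolutionWith ρl g f γ θ c₀ Q₀ u₀ Q u ux wt) {t : ℝ} (ht : 0 ≤ t) :
    MemLp (viscousFlux θ c₀ Q ux t) 2 unitMeasure := by
  obtain ⟨G, hG, hG'⟩ := h.flux_holder
  exact (memLp_congr_ae (hG t ht)).1 (Lp.memLp _)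

theorem aemeasurable_Q (h : IsWeakSolutionWith ρl g f γ θ c₀ Q₀ u₀ Q u ux wt)
    (hcm : AEMeasurable c₀ unitMeasure) (hc : ∀ x ∈ Ioo (0 : ℝ) 1, 0 < c₀ x) {t : ℝ}
    (ht : 0 ≤ t) : AEMeasurable (Q t) unitMeasure := by
  refine ((h.cQ_C1.memLp ht).aestronglyMeasurable.aemeasurable.div hcm).congr ?_
  filter_upwards [unitMeasure_ae_mem] with x hx
  simp only [Pi.div_apply]
  rw [mul_div_cancel_left₀ _ (hc x hx).ne']

theorem aestronglyMeasurable_u (h : IsWeakSolutionWith ρl g f γ θ c₀ Q₀ u₀ Q u ux wt) {t : ℝ}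
    (ht : 0 ≤ t) : AEStronglyMeasurable (u t) unitMeasure := by
  obtain ⟨ut, hut⟩ := h.u_C1
  exact (hut.memLp ht).aestronglyMeasurable

theorem aestronglyMeasurable_friction (h : IsWeakSolutionWith ρl g f γ θ c₀ Q₀ u₀ Q u ux wt)
    (hcm : AEMeasurable c₀ unitMeasure) (hc : ∀ x ∈ Ioo (0 : ℝ) 1, 0 < c₀ x) {t : ℝ}
    (ht : 0 ≤ t) : AEStronglyMeasurable (frictionForce f ρl Q u t) unitMeasure := by
  have hu := h.aestronglyMeasurable_u ht
  exact (((measurable_frictionCoeff f ρl).comp_aemeasurable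
    (h.aemeasurable_Q hcm hc ht)).aestronglyMeasurable.mul hu).mul hu.norm

theorem friction_bounded (h : IsWeakSolutionWith ρl g f γ θ c₀ Q₀ u₀ Q u ux wt) (hf : 0 ≤ f) :
    ∃ M, ∀ t, 0 ≤ t → ∀ᵐ x ∂unitMeasure, |frictionForce f ρl Q u t x| ≤ M := by
  obtain ⟨M, hM⟩ := h.u_bounded
  refine ⟨f * ρl ^ 2 * M * M, fun t ht => ?_⟩
  filter_upwards [hM t ht, h.nonneg t ht] with x h1 h2
  unfold frictionForce
  rw [abs_mul, abs_mul, abs_abs, abs_of_nonneg (frictionCoeff_nonneg hf)]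
  have h3 := frictionCoeff_le (ρl := ρl) hf h2
  have h4 : 0 ≤ frictionCoeff f ρl (Q t x) := frictionCoeff_nonneg hf
  have h5 := abs_nonneg (u t x)
  have h6 : 0 ≤ f * ρl ^ 2 := h4.trans h3
  have h7 : 0 ≤ M := h5.trans h1
  exact mul_le_mul (mul_le_mul h3 h1 h5 h6) h1 h5 (mul_nonneg h6 h7)

/-- The momentum equation integrated over `(0,x)`, which holds at every time, and the initial
value of `u`. -/
theorem flux_eq (h : IsWeakSolutionWith ρl g f γ θ c₀ Q₀ u₀ Q u ux wt)
    (hcm : AEMeasurable c₀ unitMeasure) (hc : ∀ x ∈ Ioo (0 : ℝ) 1, 0 < c₀ x)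
    (hf : 0 ≤ f) (hγ : 0 ≤ γ) (hu₀ : Integrable u₀ unitMeasure) {ut : ℝ → ℝ → ℝ}
    (hut : IsC1InL2 u ut) :
    (∀ t, 0 ≤ t → ∀ᵐ x ∂unitMeasure, viscousFlux θ c₀ Q ux t x
        = (c₀ x * Q t x) ^ γ - g * x + ∫ y in (0 : ℝ)..x, (ut t y + frictionForce f ρl Q u t y))
      ∧ u 0 =ᵐ[unitMeasure] u₀ := by
  obtain ⟨Mw, hMw⟩ := h.cQ_bounded
  obtain ⟨MS, hMS⟩ := h.flux_bounded
  obtain ⟨MH, hMH⟩ := h.friction_bounded hf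
  -- the total stress and the force
  set k : ℝ → ℝ → ℝ := fun t x => (c₀ x * Q t x) ^ γ - viscousFlux θ c₀ Q ux t x with hk
  set H := frictionForce f ρl Q u with hH
  have hkm : ∀ t, 0 ≤ t → AEStronglyMeasurable (k t) unitMeasure := fun t ht =>
    (((h.cQ_C1.memLp ht).aestronglyMeasurable.aemeasurable.pow_const γ).aestronglyMeasurable).sub
      (h.flux_memLp ht).aestronglyMeasurable
  have hHm : ∀ t, 0 ≤ t → AEStronglyMeasurable (H t) unitMeasure := fun t ht =>
    h.aestronglyMeasurable_friction hcm hc ht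
  have hkb : ∀ t, 0 ≤ t → ∀ᵐ x ∂unitMeasure, |k t x| ≤ Mw ^ γ + MS := by
    intro t ht
    filter_upwards [hMw t ht, hMS t ht, h.nonneg t ht, unitMeasure_ae_mem] with x h1 h2 h3 h4
    have h5 : 0 ≤ c₀ x * Q t x := mul_nonneg (hc x h4).le h3
    have h6 : (c₀ x * Q t x) ^ γ ≤ Mw ^ γ :=
      Real.rpow_le_rpow h5 ((le_abs_self _).trans h1) hγ
    calc |k t x| ≤ |(c₀ x * Q t x) ^ γ| + |viscousFlux θ c₀ Q ux t x| := abs_sub _ _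
      _ ≤ Mw ^ γ + MS := by
        rw [abs_of_nonneg (Real.rpow_nonneg h5 γ)]
        exact add_le_add h6 h2
  have hks : SubseqAEContinuous k :=
    h.cQ_C1.subseqAEContinuous.comp₂ h.subseq_flux (fun _ a b => a ^ γ - b) fun t _ =>
      ae_of_all _ fun x => ((Real.continuous_rpow_const hγ).continuousAt.comp
        (f := Prod.fst) continuousAt_fst).sub continuousAt_snd
  have hHs : SubseqAEContinuous H := h.subseq_friction hc
  -- test functions of the form `ψ(x) η(t)`
  have main : ∀ ψ : ℝ → ℝ, ContDiff ℝ ((⊤ : ℕ∞) : WithTop ℕ∞) ψ → HasCompactSupport ψ →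
      tsupport ψ ⊆ Iio 1 →
      (∀ t, 0 ≤ t → ∫ x, ut t x * ψ x ∂unitMeasure
        = ∫ x, (k t x * deriv ψ x + g * ψ x - H t x * ψ x) ∂unitMeasure) ∧
      ∫ x, u 0 x * ψ x ∂unitMeasure = ∫ x, u₀ x * ψ x ∂unitMeasure := by
    intro ψ hψ hψs hψt
    have hψc := hψ.continuous
    have hψd : Continuous (deriv ψ) := hψ.continuous_deriv (by simp)
    obtain ⟨C, hC⟩ := hψc.bounded_above_of_compact_support hψs
    obtain ⟨C', hC'⟩ := hψd.bounded_above_of_compact_support hψs.deriv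
    have hL := memLp_of_continuous_compactSupport hψc hψs
    have hBi : ∀ t, 0 ≤ t →
        Integrable (fun x => k t x * deriv ψ x + g * ψ x - H t x * ψ x) unitMeasure := by
      intro t ht
      refine ((Integrable.mul_bdd (c := C') (integrable_of_bound (hkm t ht) (hkb t ht))
        hψd.aestronglyMeasurable (ae_of_all _ hC')).add ?_).sub
        (Integrable.mul_bdd (c := C) (integrable_of_bound (hHm t ht) (hMH t ht))
          hψc.aestronglyMeasurable (ae_of_all _ hC))
      exact (hL.integrable (by norm_num)).const_mul g
    refine eq_of_weak_time_derivative (A := fun t => ∫ x, u t x * ψ x ∂unitMeasure)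
      (fun t ht => hut.hasDerivWithinAt_integral_mul hL ht)
      (hut.continuousOn_integral_deriv_mul hL) ?_ ?_
    · have hs := hks.comp₂ hHs (fun x a b => a * deriv ψ x + g * ψ x - b * ψ x) fun t _ =>
        ae_of_all _ fun x => by fun_prop
      refine hs.continuousOn_integral (fun t ht => (hBi t ht).aestronglyMeasurable)
        (integrable_const ((Mw ^ γ + MS) * C' + |g| * C + MH * C)) fun t ht => ?_
      filter_upwards [hkb t ht, hMH t ht] with x h1 h2
      have h3 := hC x
      have h4 := hC' x
      rw [Real.norm_eq_abs] at h3 h4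
      calc |k t x * deriv ψ x + g * ψ x - H t x * ψ x|
          ≤ |k t x * deriv ψ x| + |g * ψ x| + |H t x * ψ x| :=
            (abs_sub _ _).trans (add_le_add_left (abs_add_le _ _) _)
        _ ≤ _ := by
          rw [abs_mul, abs_mul, abs_mul]
          have := abs_nonneg (k t x)
          have := abs_nonneg (H t x)
          gcongr
          · linarith
          · linarith
    · intro η hη hηs
      have hm := h.momentum _ (isTestFunction_mul hψ hψs hψt hη hηs)
      have e1 : ∀ t ∈ Ioi (0 : ℝ), (∫ x in Ioo (0 : ℝ) 1,
          (u t x * deriv (fun s => ψ x * η s) t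
            + ((c₀ x * Q t x) ^ γ - c₀ x ^ θ * Q t x ^ (1 + θ) * ux t x)
              * deriv (fun y => ψ y * η t) x
            + g * (ψ x * η t) - frictionCoeff f ρl (Q t x) * u t x * |u t x| * (ψ x * η t)))
          = (∫ x, u t x * ψ x ∂unitMeasure) * deriv η t
            + (∫ x, (k t x * deriv ψ x + g * ψ x - H t x * ψ x) ∂unitMeasure) * η t := by
        intro t ht
        rw [← integral_mul_const, ← integral_mul_const, ← integral_add]
        · refine integral_congr_ae (ae_of_all _ fun x => ?_)
          simp only [deriv_const_mul_field', deriv_mul_const_field', hk, hH, viscousFlux,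
            frictionForce]
          ring
        · exact (Integrable.mul_bdd (c := C) (hut.integrable (le_of_lt ht))
            hψc.aestronglyMeasurable (ae_of_all _ hC)).mul_const _
        · exact (hBi t (le_of_lt ht)).mul_const _
      simp only at hm
      rw [setIntegral_congr_fun measurableSet_Ioi e1] at hm
      have e2 : (∫ x in Ioo (0 : ℝ) 1, u₀ x * (ψ x * η 0))
          = (∫ x, u₀ x * ψ x ∂unitMeasure) * η 0 := by
        rw [← integral_mul_const]
        refine integral_congr_ae (ae_of_all _ fun x => ?_)
        simp only
        ring
      rw [e2] at hm
      exact hm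
  constructor
  · intro t ht
    have hf : Integrable (fun x => ut t x + H t x - g) unitMeasure :=
      ((hut.integrable_deriv ht).add (integrable_of_bound (hHm t ht) (hMH t ht))).sub
        (integrable_const g)
    have h1 := ae_eq_neg_primitive (integrable_of_bound (hkm t ht) (hkb t ht)) hf ?_
    · filter_upwards [h1, unitMeasure_ae_mem] with x h1 hx
      have hsub : IntervalIntegrable (fun y => ut t y + H t y) volume 0 x := by
        have := integrable_unitMeasure_iff.1
          ((hut.integrable_deriv ht).add (integrable_of_bound (hHm t ht) (hMH t ht)))
        refine this.mono_set ?_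
        rw [uIcc_of_le hx.1.le, uIcc_of_le zero_le_one]
        exact Icc_subset_Icc_right hx.2.le
      rw [intervalIntegral.integral_sub hsub (by simp), intervalIntegral.integral_const,
        sub_zero, smul_eq_mul] at h1
      simp only [hk] at h1
      linarith
    · intro ψ hψ hψs hψt
      have h1 := (main ψ hψ hψs hψt).1 t ht
      have hψc := hψ.continuous
      have hψd : Continuous (deriv ψ) := hψ.continuous_deriv (by simp)
      obtain ⟨C, hC⟩ := hψc.bounded_above_of_compact_support hψs
      obtain ⟨C', hC'⟩ := hψd.bounded_above_of_compact_support hψs.deriv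
      have j1 := Integrable.mul_bdd (c := C') (integrable_of_bound (hkm t ht) (hkb t ht))
        hψd.aestronglyMeasurable (ae_of_all _ hC')
      have j2 := Integrable.mul_bdd (c := C) hf hψc.aestronglyMeasurable (ae_of_all _ hC)
      have j3 := Integrable.mul_bdd (c := C) (hut.integrable_deriv ht) hψc.aestronglyMeasurable
        (ae_of_all _ hC)
      have e1 : ∫ x, (k t x * deriv ψ x + g * ψ x - H t x * ψ x) ∂unitMeasure
          = ∫ x, (k t x * deriv ψ x - (ut t x + H t x - g) * ψ x + ut t x * ψ x)
            ∂unitMeasure := by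
        congr 1; ext x; ring
      have j4 : Integrable (fun x => k t x * deriv ψ x - (ut t x + H t x - g) * ψ x)
        unitMeasure := j1.sub j2
      rw [e1, integral_add j4 j3, integral_sub j1 j2] at h1
      linarith
  · have h1 : ∀ᵐ x ∂unitMeasure, u 0 x - u₀ x = 0 := by
      refine ae_eq_zero_of_integral_test ((hut.integrable le_rfl).sub hu₀) ?_
      intro ψ hψ hψs hψt
      have hψc := hψ.continuous
      obtain ⟨C, hC⟩ := hψc.bounded_above_of_compact_support hψs
      have j1 := Integrable.mul_bdd (c := C) (hut.integrable le_rfl) hψc.aestronglyMeasurable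
        (ae_of_all _ hC)
      have j2 := Integrable.mul_bdd (c := C) hu₀ hψc.aestronglyMeasurable (ae_of_all _ hC)
      have h2 := (main ψ hψ hψs hψt).2
      simp_rw [sub_mul]
      rw [integral_sub j1 j2, h2, sub_self]
    filter_upwards [h1] with x h1
    linarith

/-- The mass equation at every time, written in terms of `c₀ Q` and the flux. Both sides converge
almost everywhere along subsequences when the time converges, so that the equation passes from
almost every time to every time. -/
theorem mass_forall (h : IsWeakSolutionWith ρl g f γ θ c₀ Q₀ u₀ Q u ux wt)
    (hc : ∀ x ∈ Ioo (0 : ℝ) 1, 0 < c₀ x) (hθ₀ : 0 < θ) (hθ₁ : θ ≤ 1) {t : ℝ} (ht : 0 ≤ t) :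
    ∀ᵐ x ∂unitMeasure,
      wt t x = - ρl * ((c₀ x * Q t x) ^ (1 - θ) * viscousFlux θ c₀ Q ux t x) := by
  set R : ℝ → ℝ → ℝ := fun t x => - ρl * ((c₀ x * Q t x) ^ (1 - θ) * viscousFlux θ c₀ Q ux t x)
    with hR
  have hRs : SubseqAEContinuous R :=
    h.cQ_C1.subseqAEContinuous.comp₂ h.subseq_flux (fun _ a b => - ρl * (a ^ (1 - θ) * b))
      fun t _ => ae_of_all _ fun x => continuousAt_const.mul
        (((Real.continuous_rpow_const (by linarith)).continuousAt.comp
          (f := Prod.fst) continuousAt_fst).mul continuousAt_snd)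
  have hgood : ∀ᵐ t ∂(volume.restrict (Ioi (0 : ℝ))), ∀ᵐ x ∂unitMeasure, wt t x = R t x := by
    filter_upwards [h.mass, ae_restrict_mem measurableSet_Ioi] with t h1 h2
    filter_upwards [h1, h.nonneg t (le_of_lt h2), unitMeasure_ae_mem] with x h3 h4 h5
    have hcx := hc x h5
    have : wt t x = - (ρl * (c₀ x * Q t x ^ 2 * ux t x)) := by linarith
    rw [this, hR]
    simp only [viscousFlux]
    -- where `Q = 0`, both sides vanish, whatever the value of `ux`
    rcases h4.eq_or_lt with h6 | h6
    · rw [← h6, Real.zero_rpow (by linarith : (1 + θ) ≠ 0)]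
      simp
    · have e : (c₀ x * Q t x) ^ (1 - θ) * (c₀ x ^ θ * Q t x ^ (1 + θ)) = c₀ x * Q t x ^ 2 := by
        rw [Real.mul_rpow hcx.le h4]
        calc c₀ x ^ (1 - θ) * Q t x ^ (1 - θ) * (c₀ x ^ θ * Q t x ^ (1 + θ))
            = (c₀ x ^ (1 - θ) * c₀ x ^ θ) * (Q t x ^ (1 - θ) * Q t x ^ (1 + θ)) := by ring
          _ = c₀ x * Q t x ^ 2 := by
            rw [← Real.rpow_add hcx, ← Real.rpow_add h6]
            have e1 : 1 - θ + θ = 1 := by ring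
            have e2 : 1 - θ + (1 + θ) = 2 := by ring
            rw [e1, e2, Real.rpow_one, Real.rpow_two]
      linear_combination (-ρl * ux t x) * (- e)
  -- a sequence of good times that converges to `t`
  obtain ⟨s, hs, hs'⟩ : ∃ s : ℕ → ℝ, (∀ n, t < s n ∧ ∀ᵐ x ∂unitMeasure, wt (s n) x = R (s n) x) ∧
      Tendsto s atTop (𝓝 t) := by
    have hn : ∀ n : ℕ, ∃ s, s ∈ Ioo t (t + 1 / (n + 1)) ∧
        ∀ᵐ x ∂unitMeasure, wt s x = R s x := by
      intro n
      have hpos : (0 : ℝ) < 1 / (n + 1) := by positivity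
      have h1 : ∀ᵐ s ∂(volume.restrict (Ioo t (t + 1 / (n + 1 : ℝ)))),
          ∀ᵐ x ∂unitMeasure, wt s x = R s x :=
        ae_restrict_of_ae_restrict_of_subset (fun s hs => lt_of_le_of_lt ht hs.1) hgood
      have h2 := h1.and (ae_restrict_mem measurableSet_Ioo)
      have : (ae (volume.restrict (Ioo t (t + 1 / (n + 1 : ℝ))))).NeBot := by
        rw [ae_restrict_neBot, Real.volume_Ioo]
        simpa using hpos
      obtain ⟨s, hs⟩ := h2.exists
      exact ⟨s, hs.2, hs.1⟩
    choose s hs using hn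
    refine ⟨s, fun n => ⟨(hs n).1.1, (hs n).2⟩, ?_⟩
    refine tendsto_of_tendsto_of_tendsto_of_le_of_le tendsto_const_nhds ?_
      (fun n => (hs n).1.1.le) (fun n => (hs n).1.2.le)
    simpa using tendsto_const_nhds.add (tendsto_one_div_add_atTop_nhds_zero_nat (𝕜 := ℝ))
  have hs'' : Tendsto s atTop (𝓝[Ici 0] t) :=
    tendsto_nhdsWithin_iff.2 ⟨hs', Eventually.of_forall fun n => ht.trans (hs n).1.le⟩
  have hd := h.cQ_C1.subseqAEContinuous_deriv.comp₂ hRs (fun _ a b => a - b) fun t _ =>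
    ae_of_all _ fun x => by fun_prop
  obtain ⟨φ, -, hφ⟩ := hd s t ht hs''
  have h0 : ∀ᵐ x ∂unitMeasure, ∀ n, wt (s n) x = R (s n) x := by
    rw [ae_all_iff]
    exact fun n => (hs n).2
  filter_upwards [hφ, h0] with x h1 h2
  simp only [h2, sub_self] at h1
  have := tendsto_nhds_unique h1 tendsto_const_nhds
  linarith

end IsWeakSolutionWith

/-! ### Powers of a curve in `L²(0,1)` -/

/-- Second order Taylor estimate on a compact interval. -/
theorem exists_taylor_bound {η η' η'' : ℝ → ℝ} {a b : ℝ}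
    (hη : ∀ s ∈ Icc a b, HasDerivAt η (η' s) s) (hη' : ∀ s ∈ Icc a b, HasDerivAt η' (η'' s) s)
    (hc : ContinuousOn η'' (Icc a b)) :
    ∃ C, 0 ≤ C ∧ ∀ x ∈ Icc a b, ∀ y ∈ Icc a b,
      |η' y| ≤ C ∧ |η' y - η' x| ≤ C * |y - x| ∧ |η y - η x - η' x * (y - x)| ≤ C * (y - x) ^ 2 := by
  obtain ⟨C₂, hC₂⟩ := isCompact_Icc.exists_bound_of_continuousOn hc
  obtain ⟨C₁, hC₁⟩ := isCompact_Icc.exists_bound_of_continuousOn (s := Icc a b) (f := η')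
    fun s hs => (hη' s hs).continuousAt.continuousWithinAt
  have hlip : ∀ x ∈ Icc a b, ∀ y ∈ Icc a b, |η' y - η' x| ≤ C₂ * |y - x| := fun x hx y hy =>
    (convex_Icc a b).norm_image_sub_le_of_norm_hasDerivWithin_le
      (fun s hs => (hη' s hs).hasDerivWithinAt) hC₂ hx hy
  refine ⟨max (max C₁ C₂) 0, le_max_right _ _, fun x hx y hy => ⟨?_, ?_, ?_⟩⟩
  · exact (hC₁ y hy).trans ((le_max_left _ _).trans (le_max_left _ _))
  · refine (hlip x hx y hy).trans ?_
    gcongr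
    exact (le_max_right _ _).trans (le_max_left _ _)
  · have hsub : uIcc x y ⊆ Icc a b := uIcc_subset_Icc hx hy
    have hb : ∀ s ∈ uIcc x y, ‖η' s - η' x‖ ≤ C₂ * |y - x| := fun s hs => by
      refine (hlip x hx s (hsub hs)).trans ?_
      have h1 : |s - x| ≤ |y - x| := abs_sub_left_of_mem_uIcc hs
      have h2 : 0 ≤ C₂ := (norm_nonneg _).trans (hC₂ x hx)
      gcongr
    have h := (convex_uIcc x y).norm_image_sub_le_of_norm_hasDerivWithin_le
      (f := fun s => η s - η' x * s) (f' := fun s => η' s - η' x)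
      (fun s hs => (((hη s (hsub hs)).sub
        (((hasDerivAt_id s).const_mul (η' x)).congr_deriv (mul_one _)))).hasDerivWithinAt)
      hb left_mem_uIcc right_mem_uIcc
    rw [Real.norm_eq_abs, Real.norm_eq_abs] at h
    have e : η y - η x - η' x * (y - x) = η y - η' x * y - (η x - η' x * x) := by ring
    rw [e]
    refine h.trans ?_
    rw [mul_assoc, ← sq, sq_abs]
    have := sq_nonneg (y - x)
    gcongr
    exact (le_max_right _ _).trans (le_max_left _ _)

/-- Differentiation of the integral of a smooth function of a bounded curve that is `C¹` in
`L²(0,1)`. The quadratic Taylor remainder is `o(s - t)` in `L¹(0,1)`, since the curve is Lipschitz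
at `t` as a map to `L²(0,1)`. -/
theorem IsC1InL2.hasDerivWithinAt_setIntegral_comp {w wt : ℝ → ℝ → ℝ} (hw : IsC1InL2 w wt)
    {M L : ℝ} (hM : ∀ t, 0 ≤ t → ∀ᵐ x ∂unitMeasure, w t x ∈ Icc 0 M) {η η' : ℝ → ℝ}
    (hη : Measurable η) (hη' : Measurable η')
    (hT : ∀ x ∈ Icc 0 M, ∀ y ∈ Icc 0 M, |η' y| ≤ L ∧ |η' y - η' x| ≤ L * |y - x| ∧
      |η y - η x - η' x * (y - x)| ≤ L * (y - x) ^ 2)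
    {A : Set ℝ} {t : ℝ} (ht : 0 ≤ t) :
    HasDerivWithinAt (fun t => ∫ x in A, η (w t x) ∂unitMeasure)
      (∫ x in A, η' (w t x) * wt t x ∂unitMeasure) (Ici 0) t := by
  have hηb : ∃ B, ∀ y ∈ Icc 0 M, |η y| ≤ B := by
    refine ⟨|η 0| + L * M + L * M ^ 2, fun y hy => ?_⟩
    have h0 : (0 : ℝ) ∈ Icc 0 M := ⟨le_rfl, hy.1.trans hy.2⟩
    have hM0 := h0.2
    obtain ⟨h1, -, -⟩ := hT 0 h0 0 h0
    obtain ⟨-, -, h2⟩ := hT 0 h0 y hy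
    have hL : 0 ≤ L := (abs_nonneg _).trans h1
    have e : η y = (η y - η 0 - η' 0 * (y - 0)) + η 0 + η' 0 * y := by ring
    have h3 : |η' 0 * y| ≤ L * M := by
      rw [abs_mul, abs_of_nonneg hy.1]
      exact mul_le_mul h1 hy.2 hy.1 hL
    have h4 : L * (y - 0) ^ 2 ≤ L * M ^ 2 := by
      rw [sub_zero]
      have := hy.1; have := hy.2
      gcongr
    rw [e]
    refine (abs_add_le _ _).trans ?_
    have := abs_add_le (η y - η 0 - η' 0 * (y - 0)) (η 0)
    linarith
  obtain ⟨B, hB⟩ := hηb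
  have hwm : ∀ s, 0 ≤ s → AEMeasurable (w s) unitMeasure := fun s hs =>
    (hw.memLp hs).aestronglyMeasurable.aemeasurable
  have hi1 : ∀ s, 0 ≤ s → Integrable (fun x => η (w s x)) unitMeasure := fun s hs => by
    refine integrable_of_bound (M := B) (hη.comp_aemeasurable (hwm s hs)).aestronglyMeasurable ?_
    filter_upwards [hM s hs] with x hx using hB _ hx
  have hη'm := (hη'.comp_aemeasurable (hwm t ht)).aestronglyMeasurable
  have hη'b : ∀ᵐ x ∂unitMeasure, ‖η' (w t x)‖ ≤ L := by
    filter_upwards [hM t ht] with x hx using (hT _ hx _ hx).1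
  have hi2 : ∀ {v : ℝ → ℝ}, Integrable v unitMeasure →
      Integrable (fun x => η' (w t x) * v x) unitMeasure := fun hv =>
    hv.bdd_mul hη'm hη'b
  obtain ⟨G, hG, h1, h2⟩ := hw
  have hderiv := hG.hasDerivWithinAt_Ici ht
  have hL : 0 ≤ L := by
    have : (ae unitMeasure).NeBot := by
      rw [ae_restrict_neBot]; simp
    obtain ⟨x, hx⟩ := hη'b.exists
    exact (norm_nonneg _).trans hx
  rw [hasDerivWithinAt_iff_isLittleO] at hderiv ⊢
  have hlit : (fun s => ‖G s - G t - (s - t) • derivWithin G (Ici 0) t‖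
      + ‖G s - G t‖ * ‖G s - G t‖) =o[𝓝[Ici 0] t] fun s => s - t := by
    refine hderiv.norm_left.add ?_
    have hO : (fun s => ‖G s - G t‖) =O[𝓝[Ici 0] t] fun s => s - t :=
      ((hG.hasDerivWithinAt_Ici ht).hasFDerivWithinAt.isBigO_sub).norm_left
    have ho : (fun s => ‖G s - G t‖) =o[𝓝[Ici 0] t] fun _ => (1 : ℝ) := by
      rw [Asymptotics.isLittleO_one_iff]
      exact tendsto_iff_norm_sub_tendsto_zero.1 (hG.continuousOn t ht).tendsto
    simpa using ho.mul_isBigO hO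
  refine (Asymptotics.IsBigO.of_norm_eventuallyLE ?_).trans_isLittleO (hlit.const_mul_left L)
  filter_upwards [self_mem_nhdsWithin] with s hs
  rw [mem_Ici] at hs
  set V : Lp ℝ 2 unitMeasure := G s - G t - (s - t) • derivWithin G (Ici 0) t with hV
  set D : Lp ℝ 2 unitMeasure := G s - G t with hD
  have hVe : ∀ᵐ x ∂unitMeasure, V x = w s x - w t x - (s - t) * wt t x := by
    filter_upwards [h1 s hs, h1 t ht, h2 t ht, Lp.coeFn_sub (G s) (G t),
      Lp.coeFn_sub (G s - G t) ((s - t) • derivWithin G (Ici 0) t),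
      Lp.coeFn_smul (s - t) (derivWithin G (Ici 0) t)] with x a1 a2 a3 a4 a5 a6
    rw [hV, a5, Pi.sub_apply, a4, Pi.sub_apply, a6, Pi.smul_apply, a1, a2, a3, smul_eq_mul]
  have hDe : ∀ᵐ x ∂unitMeasure, D x = w s x - w t x := by
    filter_upwards [h1 s hs, h1 t ht, Lp.coeFn_sub (G s) (G t)] with x a1 a2 a4
    rw [hD, a4, Pi.sub_apply, a1, a2]
  have hws : Integrable (w s) unitMeasure :=
    ((memLp_congr_ae (h1 s hs)).1 (Lp.memLp _)).integrable (by norm_num)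
  have hwt' : Integrable (w t) unitMeasure :=
    ((memLp_congr_ae (h1 t ht)).1 (Lp.memLp _)).integrable (by norm_num)
  have hwtt : Integrable (wt t) unitMeasure :=
    ((memLp_congr_ae (h2 t ht)).1 (Lp.memLp _)).integrable (by norm_num)
  have e : (∫ x in A, η (w s x) ∂unitMeasure) - (∫ x in A, η (w t x) ∂unitMeasure)
      - (s - t) • ∫ x in A, η' (w t x) * wt t x ∂unitMeasure
      = ∫ x in A, (η (w s x) - η (w t x) - (s - t) * (η' (w t x) * wt t x)) ∂unitMeasure := by
    have k1 : Integrable (fun x => η (w s x) - η (w t x)) unitMeasure :=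
      (hi1 s hs).sub (hi1 t ht)
    rw [integral_sub k1.integrableOn ((hi2 hwtt).const_mul _).integrableOn,
      integral_sub (hi1 s hs).integrableOn (hi1 t ht).integrableOn, integral_const_mul,
      smul_eq_mul]
  rw [e]
  have hbound : ∀ᵐ x ∂unitMeasure, ‖η (w s x) - η (w t x) - (s - t) * (η' (w t x) * wt t x)‖
      ≤ L * (|V x| + D x ^ 2) := by
    filter_upwards [hVe, hDe, hM s hs, hM t ht] with x a1 a2 a3 a4
    rw [a1, a2, Real.norm_eq_abs]
    obtain ⟨b1, -, -⟩ := hT _ a4 _ a4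
    obtain ⟨-, -, b2⟩ := hT _ a4 _ a3
    have e2 : η (w s x) - η (w t x) - (s - t) * (η' (w t x) * wt t x)
        = (η (w s x) - η (w t x) - η' (w t x) * (w s x - w t x))
          + η' (w t x) * (w s x - w t x - (s - t) * wt t x) := by ring
    rw [e2]
    refine (abs_add_le _ _).trans ?_
    rw [abs_mul]
    have := abs_nonneg (w s x - w t x - (s - t) * wt t x)
    nlinarith [mul_le_mul_of_nonneg_right b1 this]
  have hVi : Integrable (fun x => |V x|) unitMeasure :=
    ((Lp.memLp V).integrable (by norm_num)).abs
  have hbi : Integrable (fun x => L * (|V x| + D x ^ 2)) unitMeasure :=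
    (hVi.add (integrable_sq_Lp_two D)).const_mul L
  calc ‖∫ x in A, (η (w s x) - η (w t x) - (s - t) * (η' (w t x) * wt t x)) ∂unitMeasure‖
      ≤ ∫ x in A, L * (|V x| + D x ^ 2) ∂unitMeasure :=
        norm_integral_le_of_norm_le hbi.integrableOn (ae_restrict_of_ae hbound)
    _ ≤ ∫ x, L * (|V x| + D x ^ 2) ∂unitMeasure :=
        setIntegral_le_integral hbi (ae_of_all _ fun x => by positivity)
    _ = L * ((∫ x, |V x| ∂unitMeasure) + ∫ x, D x ^ 2 ∂unitMeasure) := by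
        rw [integral_const_mul, integral_add hVi (integrable_sq_Lp_two D)]
    _ ≤ L * (‖V‖ + ‖D‖ * ‖D‖) := by
        rw [Lp_two_integral_sq, sq]
        gcongr
        exact integral_abs_le_norm_Lp_two V

/-- For `w_t = -ρ w^{1-θ} S`, where `S` vanishes wherever `w` does, the curve `w^θ` solves
`(w^θ)_t = -θ ρ S`, tested against indicator functions and integrated in time. Since `s^θ` is not
smooth at `0`, the chain rule is applied to `(w + δ)^θ`; the factor `w^{1-θ}` in `w_t` keeps its
derivative bounded as `δ → 0`. -/
theorem integral_rpow_curve_eq {w wt S : ℝ → ℝ → ℝ} {θ ρ M MS : ℝ} (hθ₀ : 0 < θ) (hθ₁ : θ ≤ 1)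
    (hw : IsC1InL2 w wt) (hM : ∀ t, 0 ≤ t → ∀ᵐ x ∂unitMeasure, w t x ∈ Icc 0 M)
    (hSs : SubseqAEContinuous S) (hSm : ∀ t, 0 ≤ t → AEStronglyMeasurable (S t) unitMeasure)
    (hS : ∀ t, 0 ≤ t → ∀ᵐ x ∂unitMeasure, |S t x| ≤ MS)
    (hmass : ∀ t, 0 ≤ t → ∀ᵐ x ∂unitMeasure, wt t x = -ρ * (w t x ^ (1 - θ) * S t x))
    (hzero : ∀ t, 0 ≤ t → ∀ᵐ x ∂unitMeasure, w t x = 0 → S t x = 0)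
    {A : Set ℝ} (hA : MeasurableSet A) {t : ℝ} (ht : 0 ≤ t) :
    (∫ x in A, w t x ^ θ ∂unitMeasure) - ∫ x in A, w 0 x ^ θ ∂unitMeasure
      = ∫ s in (0 : ℝ)..t, ∫ x in A, -(θ * ρ) * S s x ∂unitMeasure := by
  have hwm : ∀ s, 0 ≤ s → AEMeasurable (w s) unitMeasure := fun s hs =>
    (hw.memLp hs).aestronglyMeasurable.aemeasurable
  -- the integrand on the right hand side with `w^θ` replaced by `(w + δ)^θ`
  set R : ℝ → ℝ → ℝ → ℝ := fun δ s x => -(θ * ρ) * ((w s x / (w s x + δ)) ^ (1 - θ) * S s x)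
    with hR
  have hRb : ∀ δ, 0 < δ → ∀ s, 0 ≤ s → ∀ᵐ x ∂unitMeasure, |R δ s x| ≤ |θ * ρ| * MS := by
    intro δ hδ s hs
    filter_upwards [hM s hs, hS s hs] with x h1 h2
    have h3 : 0 ≤ w s x / (w s x + δ) := div_nonneg h1.1 (by linarith [h1.1])
    have h4 : w s x / (w s x + δ) ≤ 1 := (div_le_one (by linarith [h1.1])).2 (by linarith)
    have h5 : (w s x / (w s x + δ)) ^ (1 - θ) ≤ 1 := Real.rpow_le_one h3 h4 (by linarith)
    rw [hR]
    simp only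
    rw [abs_mul, abs_mul, abs_neg, abs_of_nonneg (Real.rpow_nonneg h3 _)]
    have h6 := abs_nonneg (S s x)
    have h7 := Real.rpow_nonneg h3 (1 - θ)
    have : (w s x / (w s x + δ)) ^ (1 - θ) * |S s x| ≤ 1 * MS :=
      mul_le_mul h5 h2 h6 zero_le_one
    gcongr
    linarith
  have hRm : ∀ δ s, 0 ≤ s → AEStronglyMeasurable (R δ s) unitMeasure := by
    intro δ s hs
    have h1 : AEMeasurable (fun x => (w s x / (w s x + δ)) ^ (1 - θ)) unitMeasure :=
      ((hwm s hs).div ((hwm s hs).add_const δ)).pow_const _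
    exact (h1.aestronglyMeasurable.mul (hSm s hs)).const_mul _
  have hRc : ∀ δ, 0 < δ → ContinuousOn (fun s => ∫ x in A, R δ s x ∂unitMeasure) (Ici 0) := by
    intro δ hδ
    have h1 : SubseqAEContinuous (fun s x => A.indicator (R δ s) x) := by
      have := hw.subseqAEContinuous.comp₂ hSs
        (fun x a b => A.indicator (fun _ => (1 : ℝ)) x
          * (-(θ * ρ) * ((a / (a + δ)) ^ (1 - θ) * b))) ?_
      · refine this.congr fun s _ => ae_of_all _ fun x => ?_
        by_cases hx : x ∈ A <;> simp [hx, hR]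
      · intro s hs
        filter_upwards [hM s hs] with x hx
        have h2 : w s x + δ ≠ 0 := by linarith [hx.1]
        have h3 : ContinuousAt (fun p : ℝ × ℝ => (p.1 / (p.1 + δ)) ^ (1 - θ)) (w s x, S s x) :=
          ContinuousAt.rpow_const (ContinuousAt.div continuousAt_fst (by fun_prop) h2)
            (Or.inr (by linarith))
        exact continuousAt_const.mul (continuousAt_const.mul (h3.mul continuousAt_snd))
    have h2 := h1.continuousOn_integral (fun s hs => (hRm δ s hs).indicator hA)
      (integrable_const (|θ * ρ| * MS)) fun s hs => by
        filter_upwards [hRb δ hδ s hs] with x hx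
        refine le_trans ?_ hx
        by_cases hxA : x ∈ A <;> simp [hxA]
    simpa only [integral_indicator hA] using h2
  have hreg : ∀ δ, 0 < δ → (∫ x in A, (w t x + δ) ^ θ ∂unitMeasure)
      - ∫ x in A, (w 0 x + δ) ^ θ ∂unitMeasure
      = ∫ s in (0 : ℝ)..t, ∫ x in A, R δ s x ∂unitMeasure := by
    intro δ hδ
    have hT := exists_taylor_bound (η := fun s => (s + δ) ^ θ)
      (η' := fun s => θ * (s + δ) ^ (θ - 1)) (η'' := fun s => θ * ((θ - 1) * (s + δ) ^ (θ - 1 - 1)))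
      (a := 0) (b := M)
      (fun s hs => by
        have hne : s + δ ≠ 0 := by linarith [hs.1]
        have := ((hasDerivAt_id s).add_const δ).rpow_const (p := θ) (Or.inl hne)
        exact this.congr_deriv (by simp))
      (fun s hs => by
        have hne : s + δ ≠ 0 := by linarith [hs.1]
        have := (((hasDerivAt_id s).add_const δ).rpow_const (p := θ - 1) (Or.inl hne)).const_mul θ
        exact this.congr_deriv (by simp))
      (fun s hs => by
        have hne : s + δ ≠ 0 := by linarith [hs.1]
        have h1 : ContinuousAt (fun y => (y + δ) ^ (θ - 1 - 1)) s :=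
          ContinuousAt.rpow_const (by fun_prop) (Or.inl hne)
        exact (continuousAt_const.mul (continuousAt_const.mul h1)).continuousWithinAt)
    obtain ⟨L, -, hL⟩ := hT
    have hd : ∀ s, 0 ≤ s → HasDerivWithinAt (fun s => ∫ x in A, (w s x + δ) ^ θ ∂unitMeasure)
        (∫ x in A, R δ s x ∂unitMeasure) (Ici 0) s := by
      intro s hs
      have := hw.hasDerivWithinAt_setIntegral_comp hM (η := fun s => (s + δ) ^ θ)
        (η' := fun s => θ * (s + δ) ^ (θ - 1)) (by fun_prop) (by fun_prop) hL (A := A) hs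
      refine this.congr_deriv ?_
      refine integral_congr_ae (ae_restrict_of_ae ?_)
      filter_upwards [hM s hs, hmass s hs] with x h1 h2
      simp only [hR]
      have hpos : 0 < w s x + δ := by linarith [h1.1]
      have e1 : θ - 1 = -(1 - θ) := by ring
      rw [h2, Real.div_rpow h1.1 hpos.le, e1, Real.rpow_neg hpos.le]
      ring
    symm
    refine intervalIntegral.integral_eq_sub_of_hasDerivAt_of_le
      (f := fun s => ∫ x in A, (w s x + δ) ^ θ ∂unitMeasure) ht ?_ ?_ ?_
    · exact fun s hs => (hd s hs.1).continuousWithinAt.mono Icc_subset_Ici_self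
    · exact fun s hs => (hd s hs.1.le).hasDerivAt (Ici_mem_nhds hs.1)
    · refine ContinuousOn.intervalIntegrable ((hRc δ hδ).mono ?_)
      rw [uIcc_of_le ht]
      exact Icc_subset_Ici_self
  -- the limit `δ → 0`
  set d : ℕ → ℝ := fun n => 1 / ((n : ℝ) + 1) with hd
  have hdpos : ∀ n, 0 < d n := fun n => by positivity
  have hd1 : ∀ n, d n ≤ 1 := fun n => by
    rw [hd]; simp only; rw [div_le_one (by positivity)]; linarith [(n.cast_nonneg : (0:ℝ) ≤ n)]
  have hdlim : Tendsto d atTop (𝓝 0) := tendsto_one_div_add_atTop_nhds_zero_nat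
  have hl : ∀ s, 0 ≤ s → Tendsto (fun n => ∫ x in A, (w s x + d n) ^ θ ∂unitMeasure) atTop
      (𝓝 (∫ x in A, w s x ^ θ ∂unitMeasure)) := by
    intro s hs
    refine tendsto_integral_of_dominated_convergence (fun _ => (M + 1) ^ θ)
      (fun n => (((hwm s hs).add_const _).pow_const _).aestronglyMeasurable.restrict)
      (integrable_const _) (fun n => ae_restrict_of_ae ?_) (ae_restrict_of_ae ?_)
    · filter_upwards [hM s hs] with x hx
      have h1 : 0 ≤ w s x + d n := by linarith [hx.1, hdpos n]
      rw [Real.norm_eq_abs, abs_of_nonneg (Real.rpow_nonneg h1 _)]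
      exact Real.rpow_le_rpow h1 (by linarith [hx.2, hd1 n]) hθ₀.le
    · refine ae_of_all _ fun x => ?_
      have h1 := ((Real.continuous_rpow_const hθ₀.le).tendsto (w s x + 0)).comp
        (hdlim.const_add (w s x))
      rw [add_zero] at h1
      exact h1
  have hr : ∀ s, 0 ≤ s → Tendsto (fun n => ∫ x in A, R (d n) s x ∂unitMeasure) atTop
      (𝓝 (∫ x in A, -(θ * ρ) * S s x ∂unitMeasure)) := by
    intro s hs
    refine tendsto_integral_of_dominated_convergence (fun _ => |θ * ρ| * MS)
      (fun n => (hRm (d n) s hs).restrict) (integrable_const _)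
      (fun n => ae_restrict_of_ae (hRb (d n) (hdpos n) s hs)) (ae_restrict_of_ae ?_)
    filter_upwards [hM s hs, hzero s hs] with x h1 h2
    simp only [hR]
    rcases h1.1.eq_or_lt with h3 | h3
    · simp [h2 h3.symm]
    · have h4 : Tendsto (fun n => w s x / (w s x + d n)) atTop (𝓝 1) := by
        have := (tendsto_const_nhds (x := w s x)).div (hdlim.const_add (w s x))
          (by linarith)
        rw [add_zero, div_self h3.ne'] at this
        exact this
      have h5 : Tendsto (fun n => (w s x / (w s x + d n)) ^ (1 - θ)) atTop (𝓝 1) := by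
        have := h4.rpow_const (p := 1 - θ) (Or.inl one_ne_zero)
        simpa using this
      simpa using (h5.mul_const (S s x)).const_mul (-(θ * ρ))
  have hLlim := (hl t ht).sub (hl 0 le_rfl)
  have hRlim : Tendsto (fun n => ∫ s in (0 : ℝ)..t, ∫ x in A, R (d n) s x ∂unitMeasure) atTop
      (𝓝 (∫ s in (0 : ℝ)..t, ∫ x in A, -(θ * ρ) * S s x ∂unitMeasure)) := by
    refine intervalIntegral.tendsto_integral_filter_of_dominated_convergence
      (fun _ => |θ * ρ| * MS) (Eventually.of_forall fun n => ?_)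
      (Eventually.of_forall fun n => ae_of_all _ fun s hs => ?_) (by simp)
      (ae_of_all _ fun s hs => ?_)
    · rw [uIoc_of_le ht]
      exact ((hRc (d n) (hdpos n)).mono (fun s hs => hs.1.le)).aestronglyMeasurable
        measurableSet_Ioc
    · rw [uIoc_of_le ht] at hs
      have h1 := norm_integral_le_of_norm_le (μ := unitMeasure.restrict A) (f := R (d n) s)
        (integrable_const (|θ * ρ| * MS))
        (ae_restrict_of_ae (hRb (d n) (hdpos n) s hs.1.le))
      refine h1.trans ?_
      rw [integral_const, smul_eq_mul]
      have h2 : 0 ≤ |θ * ρ| * MS := by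
        have : (ae unitMeasure).NeBot := by
          rw [ae_restrict_neBot]; simp
        obtain ⟨x, hx⟩ := (hRb (d n) (hdpos n) s hs.1.le).exists
        exact (abs_nonneg _).trans hx
      have h3 : (unitMeasure.restrict A).real univ ≤ 1 := by
        rw [measureReal_restrict_apply_univ]
        refine (measureReal_mono (subset_univ A)).trans ?_
        simp
      nlinarith
    · rw [uIoc_of_le ht] at hs
      exact hr s hs.1.le
  exact tendsto_nhds_unique (hLlim.congr fun n => hreg (d n) (hdpos n)) hRlim

/-- The curve `w^θ` is differentiable in `L²(0,1)`. -/
theorem exists_rpow_curve {w wt S : ℝ → ℝ → ℝ} {θ ρ M MS : ℝ} (hθ₀ : 0 < θ) (hθ₁ : θ ≤ 1)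
    (hw : IsC1InL2 w wt) (hM : ∀ t, 0 ≤ t → ∀ᵐ x ∂unitMeasure, w t x ∈ Icc 0 M)
    {G : ℝ → Lp ℝ 2 unitMeasure} (hGc : ContinuousOn G (Ici 0))
    (hG : ∀ t, 0 ≤ t → G t =ᵐ[unitMeasure] S t)
    (hS : ∀ t, 0 ≤ t → ∀ᵐ x ∂unitMeasure, |S t x| ≤ MS)
    (hmass : ∀ t, 0 ≤ t → ∀ᵐ x ∂unitMeasure, wt t x = -ρ * (w t x ^ (1 - θ) * S t x))
    (hzero : ∀ t, 0 ≤ t → ∀ᵐ x ∂unitMeasure, w t x = 0 → S t x = 0) :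
    ∃ V : ℝ → Lp ℝ 2 unitMeasure, (∀ t, 0 ≤ t → V t =ᵐ[unitMeasure] fun x => w t x ^ θ) ∧
      ∀ t, 0 ≤ t → HasDerivWithinAt V (-(θ * ρ) • G t) (Ici 0) t := by
  have hSm : ∀ t, 0 ≤ t → AEStronglyMeasurable (S t) unitMeasure := fun t ht =>
    (Lp.aestronglyMeasurable (G t)).congr (hG t ht)
  have hwm : ∀ s, 0 ≤ s → AEMeasurable (w s) unitMeasure := fun s hs =>
    (hw.memLp hs).aestronglyMeasurable.aemeasurable
  have hpb : ∀ s, 0 ≤ s → ∀ᵐ x ∂unitMeasure, |w s x ^ θ| ≤ M ^ θ := by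
    intro s hs
    filter_upwards [hM s hs] with x hx
    rw [abs_of_nonneg (Real.rpow_nonneg hx.1 _)]
    exact Real.rpow_le_rpow hx.1 hx.2 hθ₀.le
  have hpm : ∀ s, 0 ≤ s → AEStronglyMeasurable (fun x => w s x ^ θ) unitMeasure := fun s hs =>
    ((hwm s hs).pow_const θ).aestronglyMeasurable
  have hL0 : MemLp (fun x => w 0 x ^ θ) 2 unitMeasure :=
    MemLp.of_bound (hpm 0 le_rfl) (M ^ θ) (hpb 0 le_rfl)
  have hGm : Continuous fun t => G (max t 0) :=
    hGc.comp_continuous (continuous_id.max continuous_const) fun t => le_max_right t 0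
  have hKc : Continuous fun t => -(θ * ρ) • G (max t 0) :=
    hGm.const_smul (-(θ * ρ))
  refine ⟨fun t => hL0.toLp _ + ∫ s in (0 : ℝ)..t, -(θ * ρ) • G (max s 0), ?_, ?_⟩
  · intro t ht
    refine Integrable.ae_eq_of_forall_setIntegral_eq _ _
      ((Lp.memLp _).integrable (by norm_num)) (integrable_of_bound (hpm t ht) (hpb t ht)) ?_
    intro A hA _
    have e := integral_rpow_curve_eq hθ₀ hθ₁ hw hM (.of_Lp hGc hG) hSm hS hmass hzero hA ht
    set χ := indicatorConstLp 2 hA (measure_ne_top unitMeasure A) (1 : ℝ) with hχ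
    have hin : ∀ F : Lp ℝ 2 unitMeasure, Inner.inner ℝ χ F = ∫ x in A, F x ∂unitMeasure :=
      fun F => L2.inner_indicatorConstLp_one hA _ _
    have h1 : Inner.inner ℝ χ (∫ s in (0 : ℝ)..t, -(θ * ρ) • G (max s 0))
        = ∫ s in (0 : ℝ)..t, Inner.inner ℝ χ (-(θ * ρ) • G (max s 0)) :=
      ((innerSL ℝ χ).intervalIntegral_comp_comm (hKc.intervalIntegrable 0 t)).symm
    rw [← hin, inner_add_right, h1, hin]
    have h2 : ∫ x in A, (hL0.toLp _) x ∂unitMeasure = ∫ x in A, w 0 x ^ θ ∂unitMeasure :=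
      integral_congr_ae (ae_restrict_of_ae hL0.coeFn_toLp)
    have h3 : ∫ s in (0 : ℝ)..t, Inner.inner ℝ χ (-(θ * ρ) • G (max s 0))
        = ∫ s in (0 : ℝ)..t, ∫ x in A, -(θ * ρ) * S s x ∂unitMeasure := by
      refine intervalIntegral.integral_congr fun s hs => ?_
      rw [uIcc_of_le ht] at hs
      rw [hin, max_eq_left hs.1]
      refine integral_congr_ae (ae_restrict_of_ae ?_)
      filter_upwards [Lp.coeFn_smul (-(θ * ρ)) (G s), hG s hs.1] with x h4 h5
      rw [h4, Pi.smul_apply, h5, smul_eq_mul]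
    rw [h2, h3, ← e]
    ring
  · intro t ht
    have h1 := (hKc.integral_hasStrictDerivAt 0 t).hasDerivAt.const_add (hL0.toLp _)
    rw [max_eq_left ht] at h1
    exact h1.hasDerivWithinAt

/-! ### A pointwise solution of the equation for `(c Q)^θ` -/

/-- The power function truncated to `[0,R]`. -/
noncomputable def truncPow (p R s : ℝ) : ℝ := (max 0 (min s R)) ^ p

theorem truncPow_of_mem {p R s : ℝ} (hs : s ∈ Icc 0 R) : truncPow p R s = s ^ p := by
  rw [truncPow, min_eq_left hs.2, max_eq_right hs.1]

theorem truncPow_monotone {p R : ℝ} (hp : 0 ≤ p) : Monotone (truncPow p R) := fun _ _ h =>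
  Real.rpow_le_rpow (le_max_left _ _) (max_le_max le_rfl (min_le_min h le_rfl)) hp

theorem abs_truncPow_le {p R : ℝ} (hp : 0 ≤ p) (hR : 0 ≤ R) (s : ℝ) :
    |truncPow p R s| ≤ R ^ p := by
  rw [truncPow, abs_of_nonneg (Real.rpow_nonneg (le_max_left _ _) _)]
  exact Real.rpow_le_rpow (le_max_left _ _) (max_le hR (min_le_right _ _)) hp

theorem exists_lipschitzWith_truncPow {p R : ℝ} (hp : 1 ≤ p) (hR : 0 ≤ R) :
    ∃ K, LipschitzWith K (truncPow p R) := by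
  have h1 : LipschitzOnWith (p * R ^ (p - 1)).toNNReal (fun s : ℝ => s ^ p) (Icc 0 R) := by
    refine (convex_Icc 0 R).lipschitzOnWith_of_nnnorm_hasDerivWithin_le
      (fun s _ => (Real.hasDerivAt_rpow_const (Or.inr hp)).hasDerivWithinAt) fun s hs => ?_
    rw [← NNReal.coe_le_coe, coe_nnnorm, Real.coe_toNNReal _ (by positivity), Real.norm_eq_abs,
      abs_of_nonneg (mul_nonneg (by linarith) (Real.rpow_nonneg hs.1 _))]
    have := Real.rpow_le_rpow hs.1 hs.2 (by linarith : 0 ≤ p - 1)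
    gcongr
  have h2 : LipschitzWith 1 fun s : ℝ => max 0 (min s R) :=
    (LipschitzWith.id.min_const R).const_max 0
  refine ⟨(p * R ^ (p - 1)).toNNReal * 1, ?_⟩
  exact (lipschitzOnWith_univ.1 (h1.comp (h2.lipschitzOnWith (s := univ))
    fun s _ => ⟨le_max_left _ _, max_le hR (min_le_right _ _)⟩))

/-- Global solvability of an ordinary differential equation in the space of bounded continuous
functions, with a bounded Lipschitz nonlinearity that acts pointwise. -/
theorem exists_ode_solution {φ : ℝ → ℝ} {K : ℝ≥0} (hφ : LipschitzWith K φ) {B : ℝ}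
    (hB : ∀ s, |φ s| ≤ B) {F : ℝ → ℝ →ᵇ ℝ} (hF : ContinuousOn F (Ici 0)) (Y₀ : ℝ →ᵇ ℝ) (κ : ℝ)
    {T : ℝ} (hT : 0 ≤ T) :
    ∃ Y : ℝ → ℝ →ᵇ ℝ, Y 0 = Y₀ ∧ ∀ t ∈ Icc 0 T,
      HasDerivWithinAt Y (κ • (BoundedContinuousFunction.comp φ hφ (Y t) + F t)) (Icc 0 T) t := by
  have hFT : ContinuousOn F (Icc 0 T) := hF.mono Icc_subset_Ici_self
  obtain ⟨CF, hCF⟩ := isCompact_Icc.exists_bound_of_continuousOn hFT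
  have hB0 : 0 ≤ B := (abs_nonneg _).trans (hB 0)
  have hCF0 : 0 ≤ CF := (norm_nonneg _).trans (hCF 0 ⟨le_rfl, hT⟩)
  set L : ℝ≥0 := Real.toNNReal (|κ| * (B + CF)) with hL
  have hLc : (L : ℝ) = |κ| * (B + CF) := Real.coe_toNNReal _ (by positivity)
  set a : ℝ≥0 := L * Real.toNNReal T with ha
  have hPL : IsPicardLindelof
      (fun t (Y : ℝ →ᵇ ℝ) => κ • (BoundedContinuousFunction.comp φ hφ Y + F t))
      (tmin := 0) (tmax := T) ⟨0, ⟨le_rfl, hT⟩⟩ Y₀ a 0 L (‖κ‖₊ * K) := by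
    refine ⟨fun t _ => ?_, fun Y _ => ?_, fun t ht Y _ => ?_, ?_⟩
    · have h1 : LipschitzWith K fun Y : ℝ →ᵇ ℝ => BoundedContinuousFunction.comp φ hφ Y + F t := by
        have := (BoundedContinuousFunction.lipschitz_comp (α := ℝ) hφ).add
          (LipschitzWith.const (F t))
        simpa using this
      exact ((lipschitzWith_smul κ).comp h1).lipschitzOnWith
    · exact (continuousOn_const.add hFT).const_smul κ
    · rw [norm_smul, hLc, Real.norm_eq_abs]
      refine mul_le_mul_of_nonneg_left ((norm_add_le _ _).trans (add_le_add ?_ (hCF t ht)))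
        (abs_nonneg _)
      exact (BoundedContinuousFunction.norm_le hB0).2 fun x => hB _
    · simp only [sub_zero, NNReal.coe_zero, sub_self]
      rw [max_eq_left hT, ha, NNReal.coe_mul, Real.coe_toNNReal _ hT]
  obtain ⟨Y, hY0, hY⟩ := hPL.exists_eq_forall_mem_Icc_hasDerivWithinAt₀
  exact ⟨Y, hY0, hY⟩

/-- Two solutions of `Y' = -κ (φ(Y) + F)` with monotone `φ`, one of them a curve in `L²(0,1)` and
the other a curve of bounded continuous functions, agree if they agree initially. -/
theorem ae_eq_of_monotone_ode {φ : ℝ → ℝ} {K : ℝ≥0} (hφ : LipschitzWith K φ) (hmono : Monotone φ)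
    {F : ℝ → ℝ →ᵇ ℝ} {κ : ℝ} (hκ : 0 ≤ κ) {T : ℝ} {Y : ℝ → ℝ →ᵇ ℝ}
    (hY : ∀ t ∈ Icc 0 T, HasDerivWithinAt Y
      ((-κ) • (BoundedContinuousFunction.comp φ hφ (Y t) + F t)) (Icc 0 T) t)
    {V G : ℝ → Lp ℝ 2 unitMeasure} (hV : ∀ t, 0 ≤ t → HasDerivWithinAt V ((-κ) • G t) (Ici 0) t)
    (hG : ∀ t, 0 ≤ t → ∀ᵐ x ∂unitMeasure, G t x = φ (V t x) + F t x)
    (h0 : V 0 =ᵐ[unitMeasure] Y 0) {t : ℝ} (ht : t ∈ Icc 0 T) : V t =ᵐ[unitMeasure] Y t := by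
  set J : (ℝ →ᵇ ℝ) →L[ℝ] Lp ℝ 2 unitMeasure := BoundedContinuousFunction.toLp 2 unitMeasure ℝ
    with hJ
  have hJc : ∀ f : ℝ →ᵇ ℝ, J f =ᵐ[unitMeasure] f := fun f =>
    BoundedContinuousFunction.coeFn_toLp 2 unitMeasure ℝ f
  set N : ℝ → ℝ := fun s => ‖V s - J (Y s)‖ ^ 2 with hN
  have hd : ∀ s ∈ Icc 0 T, HasDerivWithinAt N (2 * Inner.inner ℝ (V s - J (Y s))
      ((-κ) • G s - J ((-κ) • (BoundedContinuousFunction.comp φ hφ (Y s) + F s)))) (Icc 0 T) s := by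
    intro s hs
    exact (((hV s hs.1).mono Icc_subset_Ici_self).sub
      (J.hasFDerivAt.comp_hasDerivWithinAt s (hY s hs))).norm_sq
  -- the squared `L²` distance is nonincreasing because `φ` is monotone
  have hneg : ∀ s ∈ Icc 0 T, Inner.inner ℝ (V s - J (Y s))
      ((-κ) • G s - J ((-κ) • (BoundedContinuousFunction.comp φ hφ (Y s) + F s))) ≤ 0 := by
    intro s hs
    rw [J.map_smul, ← smul_sub, inner_smul_right, L2.inner_def]
    have : 0 ≤ ∫ x, Inner.inner ℝ ((V s - J (Y s) : Lp ℝ 2 unitMeasure) x)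
        ((G s - J (BoundedContinuousFunction.comp φ hφ (Y s) + F s) : Lp ℝ 2 unitMeasure) x)
        ∂unitMeasure := by
      refine integral_nonneg_of_ae ?_
      filter_upwards [hJc (Y s), hJc (BoundedContinuousFunction.comp φ hφ (Y s) + F s),
        Lp.coeFn_sub (V s) (J (Y s)),
        Lp.coeFn_sub (G s) (J (BoundedContinuousFunction.comp φ hφ (Y s) + F s)), hG s hs.1]
        with x a1 a2 a3 a4 a5
      rw [a3, a4, Pi.sub_apply, Pi.sub_apply, a1, a2, a5]
      simp only [BoundedContinuousFunction.coe_add, Pi.add_apply, Pi.zero_apply]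
      change 0 ≤ (φ (V s x) + F s x - (φ (Y s x) + F s x)) * (V s x - Y s x)
      rcases le_total (V s x) (Y s x) with h | h
      · have := hmono h
        nlinarith
      · have := hmono h
        nlinarith
    nlinarith
  have hanti : AntitoneOn N (Icc 0 T) := by
    refine antitoneOn_of_deriv_nonpos (convex_Icc 0 T)
      (fun s hs => (hd s hs).continuousWithinAt) ?_ ?_
    · intro s hs
      rw [interior_Icc] at hs
      exact ((hd s (Ioo_subset_Icc_self hs)).hasDerivAt
        (Icc_mem_nhds hs.1 hs.2)).differentiableAt.differentiableWithinAt
    · intro s hs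
      rw [interior_Icc] at hs
      have hs' := Ioo_subset_Icc_self hs
      rw [((hd s hs').hasDerivAt (Icc_mem_nhds hs.1 hs.2)).deriv]
      linarith [hneg s hs']
  have hN0 : N 0 = 0 := by
    have : V 0 = J (Y 0) := Lp.ext (h0.trans (hJc _).symm)
    simp [hN, this]
  have hNt : N t ≤ 0 := by
    have := hanti ⟨le_rfl, ht.1.trans ht.2⟩ ht ht.1
    rwa [hN0] at this
  have h1 : V t - J (Y t) = 0 := by
    have h2 : ‖V t - J (Y t)‖ ^ 2 = 0 := le_antisymm hNt (by positivity)
    exact norm_eq_zero.1 (pow_eq_zero_iff two_ne_zero |>.1 h2)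
  rw [sub_eq_zero.1 h1]
  exact hJc _

/-- Continuous functions that agree almost everywhere on `(0,1)` agree on `[0,1]`. -/
theorem eqOn_Icc_of_ae_eq {a b : ℝ → ℝ} (ha : Continuous a) (hb : Continuous b)
    (h : a =ᵐ[unitMeasure] b) : EqOn a b (Icc 0 1) := by
  have h1 := Measure.eqOn_open_of_ae_eq h isOpen_Ioo ha.continuousOn hb.continuousOn
  have h2 := h1.closure ha hb
  rwa [closure_Ioo (by norm_num)] at h2

/-- Pointwise bounds that hold almost everywhere on `(0,1)` extend to `[0,1]` by continuity. -/
theorem le_on_Icc_of_ae_le {a b : ℝ → ℝ} (ha : ContinuousOn a (Icc 0 1))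
    (hb : ContinuousOn b (Icc 0 1)) (h : ∀ᵐ x ∂unitMeasure, a x ≤ b x) :
    ∀ x ∈ Icc (0 : ℝ) 1, a x ≤ b x := by
  have hm : ContinuousOn (fun x => max (a x) (b x)) (Icc 0 1) := ha.sup hb
  have h1 : EqOn (fun x => max (a x) (b x)) b (Ioo 0 1) := by
    refine Measure.eqOn_open_of_ae_eq (μ := volume) ?_ isOpen_Ioo (hm.mono Ioo_subset_Icc_self)
      (hb.mono Ioo_subset_Icc_self)
    filter_upwards [h] with x hx
    exact max_eq_right hx
  have h2 : EqOn (fun x => max (a x) (b x)) b (Icc 0 1) := by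
    refine h1.of_subset_closure hm hb Ioo_subset_Icc_self ?_
    rw [closure_Ioo (by norm_num)]
  intro x hx
  rw [← h2 hx]
  exact le_max_left _ _

/-- A nonnegative bounded solution `v` of `v' = -κ (v^p + F)` in `L²(0,1)` with continuous forcing
and continuous initial value has a version that is continuous in `x` and solves the equation
pointwise: the equation is solved in the space of bounded continuous functions, and this solution
is a version of `v` by uniqueness in `L²(0,1)`. -/
theorem exists_pointwise_solution {p R κ : ℝ} (hp : 1 ≤ p) (hR : 0 ≤ R) (hκ : 0 ≤ κ)
    {F : ℝ → ℝ →ᵇ ℝ} (hF : ContinuousOn F (Ici 0)) {Y₀ : ℝ →ᵇ ℝ}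
    {V G : ℝ → Lp ℝ 2 unitMeasure} {v : ℝ → ℝ → ℝ}
    (hV : ∀ t, 0 ≤ t → HasDerivWithinAt V ((-κ) • G t) (Ici 0) t)
    (hVv : ∀ t, 0 ≤ t → V t =ᵐ[unitMeasure] v t)
    (hv : ∀ t, 0 ≤ t → ∀ᵐ x ∂unitMeasure, v t x ∈ Icc 0 R)
    (hG : ∀ t, 0 ≤ t → ∀ᵐ x ∂unitMeasure, G t x = v t x ^ p + F t x)
    (h0 : v 0 =ᵐ[unitMeasure] Y₀) :
    ∃ W : ℝ → ℝ → ℝ, (∀ x ∈ Icc (0 : ℝ) 1, W 0 x = Y₀ x) ∧ ∀ t, 0 ≤ t →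
      Continuous (W t) ∧ W t =ᵐ[unitMeasure] v t ∧ (∀ x ∈ Icc (0 : ℝ) 1, W t x ∈ Icc 0 R) ∧
      ∀ x ∈ Icc (0 : ℝ) 1,
        HasDerivWithinAt (fun s => W s x) (-κ * (W t x ^ p + F t x)) (Ici 0) t := by
  obtain ⟨K, hK⟩ := exists_lipschitzWith_truncPow hp hR
  have hsol := fun n : ℕ => exists_ode_solution hK (abs_truncPow_le (by linarith) hR) hF Y₀ (-κ)
    (n.cast_nonneg : (0 : ℝ) ≤ n)
  choose Y hY0 hY using hsol
  have hYV : ∀ (n : ℕ) (t : ℝ), t ∈ Icc (0 : ℝ) n → Y n t =ᵐ[unitMeasure] v t := by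
    intro n t ht
    refine EventuallyEq.trans ?_ (hVv t ht.1)
    refine (ae_eq_of_monotone_ode hK (truncPow_monotone (by linarith)) hκ (hY n) hV ?_ ?_ ht).symm
    · intro s hs
      filter_upwards [hG s hs, hVv s hs, hv s hs] with x h1 h2 h3
      rw [h1, h2, truncPow_of_mem h3]
    · rw [hY0]
      exact (hVv 0 le_rfl).trans h0
  -- the solutions on `[0,n]` fit together, since each of them is a version of `v`
  have hYeq : ∀ (n m : ℕ) (t : ℝ), t ∈ Icc (0 : ℝ) n → t ∈ Icc (0 : ℝ) m →
      EqOn (Y n t) (Y m t) (Icc 0 1) := fun n m t hn hm =>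
    eqOn_Icc_of_ae_eq (Y n t).continuous (Y m t).continuous ((hYV n t hn).trans (hYV m t hm).symm)
  have hceil : ∀ t : ℝ, 0 ≤ t → t ∈ Ico (0 : ℝ) ((⌈t⌉₊ + 1 : ℕ) : ℝ) := fun t ht =>
    ⟨ht, by push_cast; linarith [Nat.le_ceil t]⟩
  have hrange : ∀ (n : ℕ) (t : ℝ), t ∈ Icc (0 : ℝ) n → ∀ x ∈ Icc (0 : ℝ) 1,
      Y n t x ∈ Icc 0 R := by
    intro n t ht x hx
    constructor
    · refine le_on_Icc_of_ae_le continuousOn_const (Y n t).continuous.continuousOn ?_ x hx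
      filter_upwards [hYV n t ht, hv t ht.1] with y h1 h2
      rw [h1]; exact h2.1
    · refine le_on_Icc_of_ae_le (Y n t).continuous.continuousOn continuousOn_const ?_ x hx
      filter_upwards [hYV n t ht, hv t ht.1] with y h1 h2
      rw [h1]; exact h2.2
  refine ⟨fun t x => Y (⌈t⌉₊ + 1) t x, fun x hx => by simp only [hY0], fun t ht => ?_⟩
  have hmem := Ico_subset_Icc_self (hceil t ht)
  refine ⟨(Y _ t).continuous, hYV _ t hmem, hrange _ t hmem, fun x hx => ?_⟩
  have h1 := (BoundedContinuousFunction.evalCLM ℝ x).hasFDerivAt.comp_hasDerivWithinAt t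
    (hY (⌈t⌉₊ + 1) t hmem)
  have h2 : HasDerivWithinAt (fun s => Y (⌈t⌉₊ + 1) s x)
      (-κ * (Y (⌈t⌉₊ + 1) t x ^ p + F t x)) (Icc 0 ((⌈t⌉₊ + 1 : ℕ) : ℝ)) t := by
    refine h1.congr_deriv ?_
    change -κ * (truncPow p R (Y (⌈t⌉₊ + 1) t x) + F t x) = _
    rw [truncPow_of_mem (hrange _ t hmem x hx)]
  have h3 : HasDerivWithinAt (fun s => Y (⌈s⌉₊ + 1) s x)
      (-κ * (Y (⌈t⌉₊ + 1) t x ^ p + F t x)) (Icc 0 ((⌈t⌉₊ + 1 : ℕ) : ℝ)) t :=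
    h2.congr (fun s hs => hYeq _ _ s (Ico_subset_Icc_self (hceil s hs.1)) hs hx) rfl
  refine h3.mono_of_mem_nhdsWithin ?_
  rw [← Ici_inter_Iic]
  exact inter_mem_nhdsWithin _ (Iic_mem_nhds (hceil t ht).2)

/-- The primitive that vanishes at `0` of an integrable function on `(0,1)`, extended to the real
line by constants. -/
noncomputable def primitiveBCF (k : ℝ → ℝ) (hk : Integrable k unitMeasure) : ℝ →ᵇ ℝ :=
  BoundedContinuousFunction.ofNormedAddCommGroup
    (fun x => ∫ y in (0 : ℝ)..x, (Ioo (0 : ℝ) 1).indicator k y)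
    (intervalIntegral.continuous_primitive
      (fun _ _ => ((integrable_indicator_iff measurableSet_Ioo).2 hk).intervalIntegrable) 0)
    (∫ x, |k x| ∂unitMeasure) (by
      intro x
      have hi := (integrable_indicator_iff measurableSet_Ioo).2 hk
      refine (intervalIntegral.norm_integral_le_integral_norm_uIoc).trans ?_
      refine (setIntegral_le_integral hi.norm (ae_of_all _ fun y => norm_nonneg _)).trans ?_
      simp_rw [norm_indicator_eq_indicator_norm]
      rw [integral_indicator measurableSet_Ioo]
      rfl)

theorem primitiveBCF_apply {k : ℝ → ℝ} (hk : Integrable k unitMeasure) {x : ℝ}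
    (hx : x ∈ Icc (0 : ℝ) 1) : primitiveBCF k hk x = ∫ y in (0 : ℝ)..x, k y := by
  change ∫ y in (0 : ℝ)..x, (Ioo (0 : ℝ) 1).indicator k y = _
  refine intervalIntegral.integral_congr_ae ?_
  have : ∀ᵐ y ∂(volume : Measure ℝ), y ≠ 1 := by simp [ae_iff]
  filter_upwards [this] with y hy hy'
  rw [uIoc_of_le hx.1] at hy'
  have hmem : y ∈ Ioo (0 : ℝ) 1 := ⟨hy'.1, lt_of_le_of_ne (hy'.2.trans hx.2) hy⟩
  exact indicator_of_mem hmem _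

theorem dist_primitiveBCF_le {k l : ℝ → ℝ} (hk : Integrable k unitMeasure)
    (hl : Integrable l unitMeasure) :
    dist (primitiveBCF k hk) (primitiveBCF l hl) ≤ ∫ x, |k x - l x| ∂unitMeasure := by
  refine (BoundedContinuousFunction.dist_le (integral_nonneg fun x => abs_nonneg _)).2 fun x => ?_
  have hi := (integrable_indicator_iff measurableSet_Ioo).2 hk
  have hi' := (integrable_indicator_iff measurableSet_Ioo).2 hl
  change dist (∫ y in (0 : ℝ)..x, (Ioo (0 : ℝ) 1).indicator k y)
    (∫ y in (0 : ℝ)..x, (Ioo (0 : ℝ) 1).indicator l y) ≤ _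
  rw [dist_eq_norm, ← intervalIntegral.integral_sub hi.intervalIntegrable hi'.intervalIntegrable]
  have hisub := hi.sub hi'
  refine (intervalIntegral.norm_integral_le_integral_norm_uIoc).trans ?_
  refine (setIntegral_le_integral hisub.norm (ae_of_all _ fun y => norm_nonneg _)).trans ?_
  rw [← integral_indicator measurableSet_Ioo]
  refine le_of_eq (integral_congr_ae (ae_of_all _ fun y => ?_))
  by_cases hy : y ∈ Ioo (0 : ℝ) 1 <;> simp [hy]

/-! ### The regular flow of a weak solution -/

/-- The pointwise information on a weak solution that the asymptotic analysis uses. Here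
`W = (c Q)^θ`, `S = W^{γ/θ} - g x + ∫₀ˣ (u_t + H)` is the viscous flux, `H = h u|u|` the friction
force and `h` the friction coefficient. In contrast to `c Q`, the function `W` is continuous in
`x` and solves an ordinary differential equation in time at every `x`. -/
structure RegularFlow (ρ g f γ α θ C₁ C₂ C₃ C₄ : ℝ) (c : ℝ → ℝ) (W S u ux ut H h : ℝ → ℝ → ℝ) :
    Prop where
  c_meas : AEMeasurable c unitMeasure
  c_lower : ∀ x ∈ Icc (0 : ℝ) 1, C₃ * x ^ α ≤ c x
  c_upper : ∀ x ∈ Icc (0 : ℝ) 1, c x ≤ C₄ * x ^ α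
  W_cont : ∀ t, 0 ≤ t → Continuous (W t)
  W_nonneg : ∀ t, 0 ≤ t → ∀ x ∈ Icc (0 : ℝ) 1, 0 ≤ W t x
  W_init : ∀ x ∈ Icc (0 : ℝ) 1, C₁ ^ θ * x ^ (θ / γ) ≤ W 0 x ∧ W 0 x ≤ C₂ ^ θ * x ^ (θ / γ)
  W_ode : ∀ t, 0 ≤ t → ∀ x ∈ Icc (0 : ℝ) 1,
    HasDerivWithinAt (fun s => W s x) (-(θ * ρ) * S t x) (Ici 0) t
  S_eq : ∀ t, 0 ≤ t → ∀ x ∈ Icc (0 : ℝ) 1,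
    S t x = W t x ^ (γ / θ) - g * x + ∫ y in (0 : ℝ)..x, (ut t y + H t y)
  S_bdd : IsBoundedInTimeSpace S
  u_C1 : IsC1InL2 u ut
  u_bdd : IsBoundedInTimeSpace u
  weakDeriv : ∀ t, 0 ≤ t → HasWeakDeriv (u t) (ux t)
  boundary_u : ∀ t, 0 < t → Tendsto (u t) (𝓝[<] (1 : ℝ) ⊓ ae volume) (𝓝 0)
  ux_eq : ∀ t, 0 ≤ t → ∀ᵐ x ∂unitMeasure, W t x ^ ((1 + θ) / θ) * ux t x = c x * S t x
  H_eq : ∀ t, 0 ≤ t → ∀ᵐ x ∂unitMeasure, H t x = h t x * u t x * |u t x|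
  h_meas : ∀ t, 0 ≤ t → AEStronglyMeasurable (h t) unitMeasure
  h_nonneg : ∀ t, 0 ≤ t → ∀ᵐ x ∂unitMeasure, 0 ≤ h t x
  h_le : ∀ t, 0 ≤ t → ∀ᵐ x ∂unitMeasure, h t x ≤ f * ρ ^ 2
  h_le_sq : ∀ t, 0 ≤ t → ∀ᵐ x ∂unitMeasure,
    h t x ≤ f * ρ ^ 2 * (W t x ^ (1 / θ) / c x) ^ 2

theorem IntervalIntegrable.of_Ioo {v : ℝ → ℝ} {a b : ℝ} (hab : a ≤ b)
    (h : IntegrableOn v (Ioo a b)) : IntervalIntegrable v volume a b :=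
  (intervalIntegrable_iff_integrableOn_Ioo_of_le hab).2 h

/-- A primitive based at `1/2` of a function that is integrable away from `0`. -/
theorem continuousOn_primitive_Ioc {v : ℝ → ℝ}
    (hv : ∀ a ∈ Ioo (0 : ℝ) 1, IntervalIntegrable v volume a 1) :
    ContinuousOn (fun x => ∫ y in (1 / 2 : ℝ)..x, v y) (Ioc 0 1) := by
  intro x hx
  set a := min (x / 2) (1 / 2) with ha
  have ha0 : 0 < a := lt_min (by linarith [hx.1]) (by norm_num)
  have hax : a < x := lt_of_le_of_lt (min_le_left _ _) (by linarith [hx.1])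
  have ha1 : a < 1 := lt_of_le_of_lt (min_le_right _ _) (by norm_num)
  have h1 := intervalIntegral.continuousOn_primitive_interval' (hv a ⟨ha0, ha1⟩)
    (a := 1 / 2) (by rw [uIcc_of_le ha1.le]; exact ⟨min_le_right _ _, by norm_num⟩)
  rw [uIcc_of_le ha1.le] at h1
  refine (h1 x ⟨hax.le, hx.2⟩).mono_of_mem_nhdsWithin ?_
  refine mem_of_superset (inter_mem_nhdsWithin _ (Ioi_mem_nhds hax)) ?_
  exact fun y hy => ⟨le_of_lt hy.2, hy.1.2⟩

theorem intervalIntegrable_of_locallyIntegrableOn {v : ℝ → ℝ}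
    (hv : LocallyIntegrableOn v (Ioo (0 : ℝ) 1)) {a b : ℝ} (ha : a ∈ Ioo (0 : ℝ) 1)
    (hb : b ∈ Ioo (0 : ℝ) 1) : IntervalIntegrable v volume a b := by
  have hsub : uIcc a b ⊆ Ioo 0 1 := fun x hx =>
    ⟨lt_of_lt_of_le (lt_min ha.1 hb.1) hx.1, lt_of_le_of_lt hx.2 (max_lt ha.2 hb.2)⟩
  exact ((hv.integrableOn_compact_subset hsub isCompact_uIcc)).intervalIntegrable

/-- The initial value of `(c Q)^θ` is continuous on `[0,1]`: away from `0` because it has a weak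
derivative that is integrable there, and at `0` because it is bounded by a multiple of
`x^{θ/γ}`. -/
theorem exists_continuous_initial {g γ α θ C₁ C₂ C₃ C₄ : ℝ} {c₀ Q₀ u₀ : ℝ → ℝ} (hγ : 1 < γ)
    (hθ₀ : 0 < θ) (hC₁ : 0 < C₁) (hC₁₂ : C₁ ≤ C₂)
    (hA1 : AssumptionA1 γ α C₁ C₂ C₃ C₄ c₀ Q₀) (hA2 : AssumptionA2 g γ α θ c₀ Q₀ u₀) :
    ∃ Y₀ : ℝ →ᵇ ℝ, (fun x => (c₀ x * Q₀ x) ^ θ) =ᵐ[unitMeasure] Y₀ ∧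
      ∀ x ∈ Icc (0 : ℝ) 1, C₁ ^ θ * x ^ (θ / γ) ≤ Y₀ x ∧ Y₀ x ≤ C₂ ^ θ * x ^ (θ / γ) := by
  obtain ⟨-, -, v, ⟨hvl, C, hC⟩, hvi⟩ := hA2
  have hγ0 : 0 < γ := by linarith
  have hC₂ : 0 < C₂ := hC₁.trans_le hC₁₂
  have hv : ∀ a ∈ Ioo (0 : ℝ) 1, IntervalIntegrable v volume a 1 := by
    intro a ha
    have hhalf : (1 / 2 : ℝ) ∈ Ioo (0 : ℝ) 1 := by norm_num
    refine (intervalIntegrable_of_locallyIntegrableOn hvl ha hhalf).trans ?_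
    refine IntervalIntegrable.of_Ioo (by norm_num) ?_
    set q := ((2 + α) * γ - θ - 1) / γ with hq
    have hsub : Ioo (1 / 2 : ℝ) 1 ⊆ Ioo 0 1 := Ioo_subset_Ioo_left (by norm_num)
    have h1 : IntegrableOn (fun x => x ^ q * v x ^ 2) (Ioo (1 / 2) 1) :=
      IntegrableOn.mono_set hvi hsub
    obtain ⟨B, hB⟩ := isCompact_Icc.exists_bound_of_continuousOn (s := Icc (1 / 2 : ℝ) 1)
      (f := fun x => x ^ (-q)) (fun x hx => (Real.continuousAt_rpow_const x (-q)
        (Or.inl (by linarith [hx.1]))).continuousWithinAt)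
    have h2 : IntegrableOn (fun x => x ^ (-q) * (x ^ q * v x ^ 2)) (Ioo (1 / 2) 1) := by
      refine Integrable.bdd_mul (c := B) h1 (by fun_prop) ?_
      exact (ae_restrict_iff' measurableSet_Ioo).2 (ae_of_all _ fun x hx =>
        hB x (Ioo_subset_Icc_self hx))
    have hvm : AEStronglyMeasurable v (volume.restrict (Ioo (1 / 2 : ℝ) 1)) :=
      hvl.aestronglyMeasurable.mono_measure (Measure.restrict_mono hsub le_rfl)
    refine Integrable.mono' ((integrable_const (1 : ℝ)).add h2) hvm ?_
    refine (ae_restrict_iff' measurableSet_Ioo).2 (ae_of_all _ fun x hx => ?_)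
    have hx0 : 0 < x := by linarith [hx.1]
    have e : x ^ (-q) * (x ^ q * v x ^ 2) = v x ^ 2 := by
      rw [← mul_assoc, ← Real.rpow_add hx0]; simp
    simp only [Pi.add_apply]
    rw [e, Real.norm_eq_abs]
    nlinarith [sq_abs (v x), sq_nonneg (|v x| - 1)]
  have hprim := continuousOn_primitive_Ioc hv
  set V : ℝ → ℝ := fun x => C + (∫ y in (1 / 2 : ℝ)..x, v y) + cQInfty g γ x ^ θ with hV
  have hcQ : Continuous fun x => cQInfty g γ x ^ θ := by
    unfold cQInfty
    exact (Real.continuous_rpow_const hθ₀.le).comp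
      ((Real.continuous_rpow_const (by positivity)).comp (continuous_const.mul continuous_id))
  have hVc : ContinuousOn V (Ioc 0 1) :=
    (continuousOn_const.add hprim).add hcQ.continuousOn
  have hVe : ∀ᵐ x ∂unitMeasure, (c₀ x * Q₀ x) ^ θ = V x := by
    filter_upwards [hC] with x hx
    rw [hV]
    simp only
    linarith
  have hpow : ∀ C' x : ℝ, 0 ≤ C' → 0 ≤ x → (C' * x ^ (1 / γ)) ^ θ = C' ^ θ * x ^ (θ / γ) := by
    intro C' x hC' hx
    rw [Real.mul_rpow hC' (Real.rpow_nonneg hx _), ← Real.rpow_mul hx]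
    congr 2
    ring
  have hb : ∀ᵐ x ∂unitMeasure, C₁ ^ θ * x ^ (θ / γ) ≤ V x ∧ V x ≤ C₂ ^ θ * x ^ (θ / γ) := by
    filter_upwards [hVe, unitMeasure_ae_mem] with x h1 h2
    obtain ⟨h3, h4, -, -⟩ := hA1 x (Ioo_subset_Icc_self h2)
    have hx0 := h2.1.le
    have h5 : 0 ≤ C₁ * x ^ (1 / γ) := by positivity
    rw [← h1, ← hpow C₁ x hC₁.le hx0, ← hpow C₂ x hC₂.le hx0]
    exact ⟨Real.rpow_le_rpow h5 h3 hθ₀.le, Real.rpow_le_rpow (h5.trans h3) h4 hθ₀.le⟩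
  have hβc : Continuous fun x : ℝ => x ^ (θ / γ) := Real.continuous_rpow_const (by positivity)
  have hb' : ∀ x ∈ Ioo (0 : ℝ) 1, |V x| ≤ C₂ ^ θ * x ^ (θ / γ) := by
    have h1 : EqOn (fun x => max |V x| (C₂ ^ θ * x ^ (θ / γ)))
        (fun x => C₂ ^ θ * x ^ (θ / γ)) (Ioo 0 1) := by
      have hVc' := hVc.mono Ioo_subset_Ioc_self
      refine Measure.eqOn_open_of_ae_eq (μ := volume) ?_ isOpen_Ioo
        (hVc'.abs.sup (continuous_const.mul hβc).continuousOn)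
        (continuous_const.mul hβc).continuousOn
      filter_upwards [hb, unitMeasure_ae_mem] with x hx h2
      have h3 : 0 ≤ C₁ ^ θ * x ^ (θ / γ) :=
        mul_nonneg (Real.rpow_nonneg hC₁.le _) (Real.rpow_nonneg h2.1.le _)
      rw [abs_of_nonneg (h3.trans hx.1)]
      exact max_eq_right hx.2
    intro x hx
    exact (le_max_left _ _).trans_eq (h1 hx)
  set y₀ : ℝ → ℝ := fun x => if x = 0 then 0 else V x with hy₀
  have hyc : ContinuousOn y₀ (Icc 0 1) := by
    intro x hx
    rcases hx.1.eq_or_lt with h0 | h0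
    · rw [← h0, ContinuousWithinAt]
      have h1 : y₀ 0 = 0 := by simp [hy₀]
      rw [h1]
      have h2 : Tendsto (fun x : ℝ => C₂ ^ θ * x ^ (θ / γ)) (𝓝[Icc 0 1] 0) (𝓝 0) := by
        have := (hβc.const_mul (C₂ ^ θ)).tendsto 0
        rw [Real.zero_rpow (by positivity), mul_zero] at this
        exact this.mono_left nhdsWithin_le_nhds
      refine squeeze_zero_norm' ?_ h2
      have h3 : ∀ᶠ y : ℝ in 𝓝[Icc 0 1] 0, y < 1 :=
        mem_nhdsWithin_of_mem_nhds (Iio_mem_nhds one_pos)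
      filter_upwards [h3, self_mem_nhdsWithin] with y h4 h5
      rcases h5.1.eq_or_lt with h6 | h6
      · rw [← h6, h1, norm_zero, Real.zero_rpow (by positivity), mul_zero]
      · rw [hy₀]
        simp only [h6.ne', if_false]
        exact hb' y ⟨h6, h4⟩
    · have h1 : ContinuousWithinAt V (Icc 0 1) x := by
        refine (hVc x ⟨h0, hx.2⟩).mono_of_mem_nhdsWithin ?_
        refine mem_of_superset (inter_mem_nhdsWithin _ (Ioi_mem_nhds h0)) ?_
        exact fun y hy => ⟨hy.2, hy.1.2⟩
      refine h1.congr_of_eventuallyEq ?_ (by simp [hy₀, h0.ne'])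
      have : ∀ᶠ y : ℝ in 𝓝[Icc 0 1] x, 0 < y := mem_nhdsWithin_of_mem_nhds (Ioi_mem_nhds h0)
      filter_upwards [this] with y hy
      simp [hy₀, hy.ne']
  obtain ⟨B, hB⟩ := isCompact_Icc.exists_bound_of_continuousOn hyc
  obtain ⟨Y₀, hY₀⟩ : ∃ Y₀ : ℝ →ᵇ ℝ, ∀ x ∈ Icc (0 : ℝ) 1, Y₀ x = y₀ x := by
    have hcont : Continuous fun x => y₀ (projIcc (0 : ℝ) 1 zero_le_one x) :=
      hyc.comp_continuous (continuous_subtype_val.comp continuous_projIcc) fun x =>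
        (projIcc 0 1 zero_le_one x).2
    refine ⟨BoundedContinuousFunction.ofNormedAddCommGroup _ hcont B
      (fun x => hB _ (projIcc 0 1 zero_le_one x).2), fun x hx => ?_⟩
    change y₀ (projIcc (0 : ℝ) 1 zero_le_one x) = y₀ x
    rw [projIcc_of_mem _ hx]
  refine ⟨Y₀, ?_, ?_⟩
  · filter_upwards [hVe, unitMeasure_ae_mem] with x h1 h2
    rw [h1, hY₀ x (Ioo_subset_Icc_self h2)]
    simp [hy₀, h2.1.ne']
  · intro x hx
    rw [hY₀ x hx]
    have hb'' : ∀ᵐ x ∂unitMeasure, C₁ ^ θ * x ^ (θ / γ) ≤ y₀ x ∧ y₀ x ≤ C₂ ^ θ * x ^ (θ / γ) := by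
      filter_upwards [hb, unitMeasure_ae_mem] with x h1 h2
      simp only [hy₀, h2.1.ne', if_false]
      exact h1
    exact ⟨le_on_Icc_of_ae_le (continuous_const.mul hβc).continuousOn hyc
        (hb''.mono fun _ h => h.1) x hx,
      le_on_Icc_of_ae_le hyc (continuous_const.mul hβc).continuousOn
        (hb''.mono fun _ h => h.2) x hx⟩

/-- Every weak solution is a `RegularFlow`: the mass equation for `(c Q)^θ` reads
`W_t = -θ ρ (W^{γ/θ} + F)`, where the forcing `F` is continuous in `x`. -/
theorem IsWeakSolutionWith.exists_regularFlow {ρl g f γ α θ C₁ C₂ C₃ C₄ : ℝ}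
    (hρl : 0 < ρl) (hf : 0 ≤ f) (hγ : 1 < γ) (hθ₀ : 0 < θ) (hθ₁ : θ ≤ γ / 2)
    (hθ₃ : θ ≤ 1) (hC₁ : 0 < C₁) (hC₁₂ : C₁ ≤ C₂) (hC₃ : 0 < C₃)
    {c₀ Q₀ u₀ : ℝ → ℝ} {Q u ux wt : ℝ → ℝ → ℝ} (hcm : AEMeasurable c₀ unitMeasure)
    (hA1 : AssumptionA1 γ α C₁ C₂ C₃ C₄ c₀ Q₀) (hA2 : AssumptionA2 g γ α θ c₀ Q₀ u₀)
    (h : IsWeakSolutionWith ρl g f γ θ c₀ Q₀ u₀ Q u ux wt) :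
    ∃ W S ut H η : ℝ → ℝ → ℝ, RegularFlow ρl g f γ α θ C₁ C₂ C₃ C₄ c₀ W S u ux ut H η ∧
      (∀ t, 0 ≤ t → (fun x => W t x ^ (1 / θ)) =ᵐ[unitMeasure] fun x => c₀ x * Q t x) ∧
      u 0 =ᵐ[unitMeasure] u₀ := by
  have hγ0 : 0 < γ := by linarith
  have hc : ∀ x ∈ Ioo (0 : ℝ) 1, 0 < c₀ x := fun x hx =>
    lt_of_lt_of_le (mul_pos hC₃ (Real.rpow_pos_of_pos hx.1 α))
      (hA1 x (Ioo_subset_Icc_self hx)).2.2.1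
  obtain ⟨Y₀, hY₀, hY₀b⟩ := exists_continuous_initial hγ hθ₀ hC₁ hC₁₂ hA1 hA2
  obtain ⟨ut, hut⟩ := h.u_C1
  have hu₀ : Integrable u₀ unitMeasure := hA2.1.1.integrable (by norm_num)
  obtain ⟨hflux, hu0⟩ := h.flux_eq hcm hc hf hγ0.le hu₀ hut
  obtain ⟨Mw, hMw⟩ := h.cQ_bounded
  obtain ⟨MS, hMS⟩ := h.flux_bounded
  obtain ⟨MH, hMH⟩ := h.friction_bounded hf
  set H := frictionForce f ρl Q u with hH
  have hHm : ∀ t, 0 ≤ t → AEStronglyMeasurable (H t) unitMeasure := fun t ht =>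
    h.aestronglyMeasurable_friction hcm hc ht
  have hHi : ∀ t, 0 ≤ t → Integrable (H t) unitMeasure := fun t ht =>
    integrable_of_bound (hHm t ht) (hMH t ht)
  have hHs : SubseqAEContinuous H := h.subseq_friction hc
  have hki : ∀ t, 0 ≤ t → Integrable (fun y => ut t y + H t y) unitMeasure := fun t ht =>
    (hut.integrable_deriv ht).add (hHi t ht)
  have hkg : ∀ t : ℝ, Integrable (fun y => ut (max t 0) y + H (max t 0) y - g) unitMeasure :=
    fun t => (hki _ (le_max_right t 0)).sub (integrable_const g)
  -- the forcing `∫₀ˣ (u_t + H) - g x` as a curve of bounded continuous functions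
  set F : ℝ → ℝ →ᵇ ℝ := fun t => primitiveBCF _ (hkg t) with hF
  have hFx : ∀ t, 0 ≤ t → ∀ x ∈ Icc (0 : ℝ) 1,
      F t x = (∫ y in (0 : ℝ)..x, (ut t y + H t y)) - g * x := by
    intro t ht x hx
    rw [hF]
    simp only
    rw [primitiveBCF_apply _ hx]
    simp only [max_eq_left ht]
    have hsub : IntervalIntegrable (fun y => ut t y + H t y) volume 0 x := by
      refine (integrable_unitMeasure_iff.1 (hki t ht)).mono_set ?_
      rw [uIcc_of_le hx.1, uIcc_of_le zero_le_one]
      exact Icc_subset_Icc_right hx.2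
    rw [intervalIntegral.integral_sub hsub (by simp), intervalIntegral.integral_const, sub_zero,
      smul_eq_mul, mul_comm]
  have hFc : ContinuousOn F (Ici 0) := by
    intro t ht
    rw [ContinuousWithinAt, tendsto_iff_dist_tendsto_zero]
    have h1 := (hut.tendsto_integral_abs_deriv_sub ht).add
      (hHs.tendsto_integral_abs_sub hHm hMH ht)
    rw [add_zero] at h1
    refine squeeze_zero' (Eventually.of_forall fun s => dist_nonneg) ?_ h1
    filter_upwards [self_mem_nhdsWithin] with s hs
    refine (dist_primitiveBCF_le (hkg s) (hkg t)).trans ?_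
    have hs' : (0 : ℝ) ≤ s := hs
    have ht' : (0 : ℝ) ≤ t := ht
    have i1 : Integrable (fun x => |ut s x - ut t x|) unitMeasure :=
      ((hut.integrable_deriv hs').sub (hut.integrable_deriv ht')).abs
    have i2 : Integrable (fun x => |H s x - H t x|) unitMeasure :=
      ((hHi s hs').sub (hHi t ht')).abs
    rw [← integral_add i1 i2, max_eq_left hs', max_eq_left ht']
    refine integral_mono ((((hki s hs').sub (integrable_const g)).sub
      ((hki t ht').sub (integrable_const g))).abs) (i1.add i2) fun x => ?_
    have e : ut s x + H s x - g - (ut t x + H t x - g)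
        = (ut s x - ut t x) + (H s x - H t x) := by ring
    rw [e]
    exact abs_add_le _ _
  have hwM : ∀ t, 0 ≤ t → ∀ᵐ x ∂unitMeasure, c₀ x * Q t x ∈ Icc 0 Mw := by
    intro t ht
    filter_upwards [hMw t ht, h.nonneg t ht, unitMeasure_ae_mem] with x h1 h2 h3
    exact ⟨mul_nonneg (hc x h3).le h2, (le_abs_self _).trans h1⟩
  have hMw0 : 0 ≤ Mw := by
    have : (ae unitMeasure).NeBot := by
      rw [ae_restrict_neBot]; simp
    obtain ⟨x, hx⟩ := (hwM 0 le_rfl).exists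
    exact hx.1.trans hx.2
  obtain ⟨G, hGc, hG⟩ : ∃ G : ℝ → Lp ℝ 2 unitMeasure, ContinuousOn G (Ici 0) ∧
      ∀ t, 0 ≤ t → G t =ᵐ[unitMeasure] viscousFlux θ c₀ Q ux t := by
    obtain ⟨G, hG, hG'⟩ := h.flux_holder
    refine ⟨G, fun t ht => ?_, hG⟩
    obtain ⟨K, hK⟩ := hG' (t + 1)
    have h1 := (hK.continuousOn (by norm_num)) t ⟨ht, by linarith⟩
    refine h1.mono_of_mem_nhdsWithin ?_
    rw [← Ici_inter_Iic]
    exact inter_mem_nhdsWithin _ (Iic_mem_nhds (by linarith))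
  obtain ⟨V, hVw, hVd⟩ := exists_rpow_curve hθ₀ hθ₃ h.cQ_C1 hwM hGc hG hMS
    (fun t ht => h.mass_forall hc hθ₀ hθ₃ ht) (fun t ht => by
      filter_upwards [unitMeasure_ae_mem] with x hx h0
      have : Q t x = 0 := by
        rcases mul_eq_zero.1 h0 with h1 | h1
        · exact absurd h1 (hc x hx).ne'
        · exact h1
      simp [viscousFlux, this, Real.zero_rpow (by linarith : 1 + θ ≠ 0)])
  have hp1 : 1 ≤ γ / θ := by rw [le_div_iff₀ hθ₀]; linarith
  have hpow : ∀ w : ℝ, 0 ≤ w → (w ^ θ) ^ (γ / θ) = w ^ γ := fun w hw => by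
    rw [← Real.rpow_mul hw, mul_div_cancel₀ _ hθ₀.ne']
  obtain ⟨W, hW0, hW⟩ := exists_pointwise_solution (p := γ / θ) (R := Mw ^ θ) (κ := θ * ρl)
    (Y₀ := Y₀) (G := G) (v := fun t x => (c₀ x * Q t x) ^ θ) hp1 (by positivity) (by positivity)
    hFc hVd hVw
    (fun t ht => by
      filter_upwards [hwM t ht] with x hx
      exact ⟨Real.rpow_nonneg hx.1 _, Real.rpow_le_rpow hx.1 hx.2 hθ₀.le⟩)
    (fun t ht => by
      filter_upwards [hG t ht, hflux t ht, hwM t ht, unitMeasure_ae_mem] with x h1 h2 h3 h4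
      rw [h1, h2, hpow _ h3.1, hFx t ht x (Ioo_subset_Icc_self h4)]
      ring)
    (by
      refine EventuallyEq.trans ?_ hY₀
      filter_upwards [h.initial_cQ] with x hx
      rw [hx])
  have hWw : ∀ t, 0 ≤ t → ∀ᵐ x ∂unitMeasure, W t x = (c₀ x * Q t x) ^ θ := fun t ht =>
    (hW t ht).2.1
  have hWw' : ∀ t, 0 ≤ t → ∀ᵐ x ∂unitMeasure, W t x ^ (1 / θ) = c₀ x * Q t x := by
    intro t ht
    filter_upwards [hWw t ht, hwM t ht] with x h1 h2
    rw [h1, ← Real.rpow_mul h2.1, mul_one_div_cancel hθ₀.ne', Real.rpow_one]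
  have hWq : ∀ t, 0 ≤ t → ∀ᵐ x ∂unitMeasure,
      W t x ^ ((1 + θ) / θ) = (c₀ x * Q t x) ^ (1 + θ) := by
    intro t ht
    filter_upwards [hWw t ht, hwM t ht] with x h1 h2
    rw [h1, ← Real.rpow_mul h2.1, mul_div_cancel₀ _ hθ₀.ne']
  set S : ℝ → ℝ → ℝ := fun t x =>
    W t x ^ (γ / θ) - g * x + ∫ y in (0 : ℝ)..x, (ut t y + H t y) with hS
  have hSflux : ∀ t, 0 ≤ t → ∀ᵐ x ∂unitMeasure, S t x = viscousFlux θ c₀ Q ux t x := by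
    intro t ht
    filter_upwards [hflux t ht, hWw t ht, hwM t ht] with x h1 h2 h3
    rw [h1, hS]
    simp only
    rw [h2, hpow _ h3.1]
  refine ⟨W, S, ut, H, fun t x => frictionCoeff f ρl (Q t x), ?_, fun t ht => hWw' t ht, hu0⟩
  exact
    { c_meas := hcm
      c_lower := fun x hx => (hA1 x hx).2.2.1
      c_upper := fun x hx => (hA1 x hx).2.2.2
      W_cont := fun t ht => (hW t ht).1
      W_nonneg := fun t ht x hx => ((hW t ht).2.2.1 x hx).1
      W_init := fun x hx => by rw [hW0 x hx]; exact hY₀b x hx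
      W_ode := fun t ht x hx => by
        refine ((hW t ht).2.2.2 x hx).congr_deriv ?_
        rw [hFx t ht x hx, hS]
        ring
      S_eq := fun t ht x hx => rfl
      S_bdd := ⟨MS, fun t ht => by
        filter_upwards [hSflux t ht, hMS t ht] with x h1 h2
        rw [h1]; exact h2⟩
      u_C1 := hut
      u_bdd := h.u_bounded
      weakDeriv := h.weakDeriv
      boundary_u := h.boundary_u
      ux_eq := fun t ht => by
        filter_upwards [hSflux t ht, hWq t ht, h.nonneg t ht, unitMeasure_ae_mem] with x h1 h2 h3 h4
        have hcx := hc x h4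
        rw [h1, h2, viscousFlux, Real.mul_rpow hcx.le h3, Real.rpow_add hcx, Real.rpow_one]
        ring
      H_eq := fun t ht => ae_of_all _ fun x => rfl
      h_meas := fun t ht => ((measurable_frictionCoeff f ρl).comp_aemeasurable
        (h.aemeasurable_Q hcm hc ht)).aestronglyMeasurable
      h_nonneg := fun t ht => ae_of_all _ fun x => frictionCoeff_nonneg hf
      h_le := fun t ht => by
        filter_upwards [h.nonneg t ht] with x hx using frictionCoeff_le hf hx
      h_le_sq := fun t ht => by
        filter_upwards [h.nonneg t ht, hWw' t ht, unitMeasure_ae_mem] with x h1 h2 h3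
        rw [h2, mul_div_cancel_left₀ _ (hc x h3).ne']
        exact frictionCoeff_le_sq hf h1 }

/-! ### Parameters, and integration by parts with a singular weight -/

/-- Standing assumptions on the parameters. In the names of the consequences below, `β = θ/γ` is the
exponent of the profile of `W = (c Q)^θ`, and `p = γ/θ`, `q = (1+θ)/θ`, `κ = 1/γ - α`. -/
structure AdmissibleParams (ρ g f γ α θ C₁ C₂ C₃ C₄ : ℝ) : Prop where
  ρ_pos : 0 < ρ
  g_pos : 0 < g
  f_nonneg : 0 ≤ f
  one_lt_γ : 1 < γ
  α_nonneg : 0 ≤ α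
  α_lt : α < 1 / γ
  θ_pos : 0 < θ
  θ_le_half : θ ≤ γ / 2
  θ_le_sub : θ ≤ γ - 1
  θ_le_one_sub : θ ≤ 1 - α * γ
  C₁_pos : 0 < C₁
  C₁_le : C₁ ≤ C₂
  C₃_pos : 0 < C₃
  C₃_le : C₃ ≤ C₄

namespace AdmissibleParams

variable {ρ g f γ α θ C₁ C₂ C₃ C₄ : ℝ} (hp : AdmissibleParams ρ g f γ α θ C₁ C₂ C₃ C₄)
include hp

theorem γ_pos : 0 < γ := by linarith [hp.one_lt_γ]
theorem C₂_pos : 0 < C₂ := hp.C₁_pos.trans_le hp.C₁_le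
theorem C₄_pos : 0 < C₄ := hp.C₃_pos.trans_le hp.C₃_le
theorem θ_le_one : θ ≤ 1 := by
  have := mul_nonneg hp.α_nonneg hp.γ_pos.le
  linarith [hp.θ_le_one_sub]
theorem β_pos : 0 < θ / γ := div_pos hp.θ_pos hp.γ_pos
theorem β_le_half : θ / γ ≤ 1 / 2 := by
  rw [div_le_iff₀ hp.γ_pos]; linarith [hp.θ_le_half]
theorem β_le_κ : θ / γ ≤ 1 / γ - α := by
  rw [div_le_iff₀ hp.γ_pos, sub_mul, div_mul_cancel₀ _ hp.γ_pos.ne']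
  exact hp.θ_le_one_sub
theorem q_pos : 0 < (1 + θ) / θ := div_pos (by linarith [hp.θ_pos]) hp.θ_pos
theorem one_le_p : 1 ≤ γ / θ := by
  rw [le_div_iff₀ hp.θ_pos]; linarith [hp.θ_le_sub]
theorem p_pos : 0 < γ / θ := lt_of_lt_of_le one_pos hp.one_le_p
theorem β_mul_p : θ / γ * (γ / θ) = 1 := by
  have := hp.γ_pos.ne'; have := hp.θ_pos.ne'; field_simp
theorem β_mul_q : θ / γ * ((1 + θ) / θ) = (1 + θ) / γ := by
  have := hp.γ_pos.ne'; have := hp.θ_pos.ne'; field_simp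
theorem βq_le_one : (1 + θ) / γ ≤ 1 := by
  rw [div_le_one hp.γ_pos]; linarith [hp.θ_le_sub]

/-- Powers of a multiple of the profile `x^{θ/γ}`. -/
theorem profile_rpow_p {r x : ℝ} (hr : 0 ≤ r) (hx : 0 ≤ x) :
    (r * x ^ (θ / γ)) ^ (γ / θ) = r ^ (γ / θ) * x := by
  rw [Real.mul_rpow hr (Real.rpow_nonneg hx _), ← Real.rpow_mul hx, hp.β_mul_p, Real.rpow_one]

theorem profile_rpow_q {r x : ℝ} (hr : 0 ≤ r) (hx : 0 ≤ x) :
    (r * x ^ (θ / γ)) ^ ((1 + θ) / θ) = r ^ ((1 + θ) / θ) * x ^ ((1 + θ) / γ) := by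
  rw [Real.mul_rpow hr (Real.rpow_nonneg hx _), ← Real.rpow_mul hx, hp.β_mul_q]

theorem le_rpow_β {x : ℝ} (hx : x ∈ Icc (0 : ℝ) 1) : x ≤ x ^ (θ / γ) := by
  have := Real.rpow_le_rpow_of_exponent_ge' hx.1 hx.2 hp.β_pos.le
    (by linarith [hp.β_le_half] : θ / γ ≤ 1)
  rwa [Real.rpow_one] at this

theorem sqrt_le_rpow_β {x : ℝ} (hx : x ∈ Icc (0 : ℝ) 1) : √x ≤ x ^ (θ / γ) := by
  rw [Real.sqrt_eq_rpow]
  exact Real.rpow_le_rpow_of_exponent_ge' hx.1 hx.2 hp.β_pos.le hp.β_le_half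

end AdmissibleParams

/-- Cauchy-Schwarz estimate for the primitive of an `L²` function. -/
theorem abs_primitive_le {k : ℝ → ℝ} (hk : MemLp k 2 unitMeasure) {x : ℝ}
    (hx : x ∈ Icc (0 : ℝ) 1) :
    |∫ y in (0 : ℝ)..x, k y| ≤ √(∫ y, k y ^ 2 ∂unitMeasure) * √x := by
  have hsq : IntegrableOn (fun y => k y ^ 2) (Ioc 0 1) :=
    (integrableOn_Ioc_iff_integrableOn_Ioo (by simp)).2 hk.integrable_sq
  have hk1 : IntegrableOn k (Ioc 0 1) :=
    (integrableOn_Ioc_iff_integrableOn_Ioo (by simp)).2 (hk.integrable (by norm_num))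
  have hsub : Ioc 0 x ⊆ Ioc 0 1 := Ioc_subset_Ioc_right hx.2
  have h1 := sq_integral_mul_le (ν := volume.restrict (Ioc 0 x)) (a := k) (b := fun _ => 1)
    (hsq.mono_set hsub) (by simp)
    (by simp only [mul_one]; exact hk1.mono_set hsub)
  have h2 : ∫ y in Ioc 0 x, k y ^ 2 ≤ ∫ y, k y ^ 2 ∂unitMeasure := by
    rw [← integral_Ioc_eq_integral_Ioo]
    exact setIntegral_mono_set hsq (ae_of_all _ fun y => sq_nonneg _) hsub.eventuallyLE
  have h3 : ∫ _ in Ioc 0 x, (1 : ℝ) ^ 2 = x := by simp [hx.1]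
  rw [intervalIntegral.integral_of_le hx.1, ← Real.sqrt_mul (integral_nonneg fun y => sq_nonneg _)]
  refine Real.abs_le_sqrt ?_
  simp only [mul_one] at h1
  rw [h3] at h1
  exact h1.trans (mul_le_mul_of_nonneg_right h2 hx.1)

theorem intervalIntegrable_sub_zero {k : ℝ → ℝ} (hk : Integrable k unitMeasure) {x : ℝ}
    (hx : x ∈ Icc (0 : ℝ) 1) : IntervalIntegrable k volume 0 x := by
  refine (integrable_unitMeasure_iff.1 hk).mono_set ?_
  rw [uIcc_of_le hx.1, uIcc_of_le zero_le_one]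
  exact Icc_subset_Icc_right hx.2

theorem continuousOn_primitive_Icc {k : ℝ → ℝ} (hk : Integrable k unitMeasure) :
    ContinuousOn (fun x => ∫ y in (0 : ℝ)..x, k y) (Icc 0 1) := by
  have := intervalIntegral.continuousOn_primitive_interval' (integrable_unitMeasure_iff.1 hk)
    (a := 0) (by simp)
  rwa [uIcc_of_le zero_le_one] at this

theorem aestronglyMeasurable_of_continuousOn_Icc {k : ℝ → ℝ} (hk : ContinuousOn k (Icc 0 1)) :
    AEStronglyMeasurable k unitMeasure :=
  (hk.mono Ioo_subset_Icc_self).aestronglyMeasurable measurableSet_Ioo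

theorem integrable_rpow_unitMeasure {r : ℝ} (hr : -1 < r) :
    Integrable (fun x : ℝ => x ^ r) unitMeasure :=
  integrable_unitMeasure_iff.2 (intervalIntegral.intervalIntegrable_rpow' hr)

/-- A function bounded by `C / x` is integrable away from `0`. -/
theorem intervalIntegrable_of_le_div {v : ℝ → ℝ} {C : ℝ} (hv : AEStronglyMeasurable v unitMeasure)
    (hC : ∀ᵐ x ∂unitMeasure, |v x| ≤ C / x) {a : ℝ} (ha : a ∈ Ioo (0 : ℝ) 1) :
    IntervalIntegrable v volume a 1 := by
  have hsub : Ioo a 1 ⊆ Ioo 0 1 := Ioo_subset_Ioo_left ha.1.le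
  have hle : volume.restrict (Ioo a 1) ≤ unitMeasure := Measure.restrict_mono hsub le_rfl
  refine IntervalIntegrable.of_Ioo ha.2.le ?_
  refine Integrable.of_bound (hv.mono_measure hle) (|C| / a) ?_
  filter_upwards [ae_mono hle hC, ae_restrict_mem measurableSet_Ioo] with x h1 h2
  refine h1.trans ?_
  have hx : 0 < x := ha.1.trans h2.1
  calc C / x ≤ |C| / x := by gcongr; exact le_abs_self C
    _ ≤ |C| / a := div_le_div_of_nonneg_left (abs_nonneg _) ha.1 h2.1.le

/-- Integration by parts on `(0,1)` for `∫ ũ k`, where `ũ' = v` may be singular like `1/x` at `0`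
and `ũ(1) = 0`. -/
theorem integral_mul_eq_neg_integral_mul_primitive {k v : ℝ → ℝ} {C M C₀ : ℝ}
    (hk : MemLp k 2 unitMeasure) (hv : AEStronglyMeasurable v unitMeasure)
    (hvC : ∀ᵐ x ∂unitMeasure, |v x| ≤ C / x)
    (hM : ∀ x ∈ Ioo (0 : ℝ) 1, |C₀ + ∫ y in (1 / 2 : ℝ)..x, v y| ≤ M)
    (h1 : C₀ + ∫ y in (1 / 2 : ℝ)..1, v y = 0) :
    ∫ x, (C₀ + ∫ y in (1 / 2 : ℝ)..x, v y) * k x ∂unitMeasure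
      = - ∫ x, v x * (∫ y in (0 : ℝ)..x, k y) ∂unitMeasure := by
  have hki : Integrable k unitMeasure := hk.integrable (by norm_num)
  set P : ℝ → ℝ := fun x => ∫ y in (0 : ℝ)..x, k y with hP
  set U : ℝ → ℝ := fun x => C₀ + ∫ y in (1 / 2 : ℝ)..x, v y with hU
  set K := √(∫ y, k y ^ 2 ∂unitMeasure) with hK
  have hPK : ∀ x ∈ Icc (0 : ℝ) 1, |P x| ≤ K * √x := fun x hx => abs_primitive_le hk hx
  have hPc : ContinuousOn P (Icc 0 1) := continuousOn_primitive_Icc hki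
  have hvi : ∀ a ∈ Ioo (0 : ℝ) 1, IntervalIntegrable v volume a 1 := fun a ha =>
    intervalIntegrable_of_le_div hv hvC ha
  have hUc : ContinuousOn U (Ioc 0 1) := continuousOn_const.add (continuousOn_primitive_Ioc hvi)
  have hUm : AEStronglyMeasurable U unitMeasure :=
    (hUc.mono Ioo_subset_Ioc_self).aestronglyMeasurable measurableSet_Ioo
  have i1 : Integrable (fun x => U x * k x) unitMeasure :=
    hki.bdd_mul hUm (unitMeasure_ae hM)
  have i2 : Integrable (fun x => v x * P x) unitMeasure := by
    refine Integrable.mono' ((integrable_rpow_unitMeasure (r := -1 / 2) (by norm_num)).const_mul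
      (C * K)) (hv.mul (aestronglyMeasurable_of_continuousOn_Icc hPc)) ?_
    filter_upwards [hvC, unitMeasure_ae_mem] with x h2 h3
    rw [Real.norm_eq_abs, abs_mul]
    have h4 := hPK x (Ioo_subset_Icc_self h3)
    have e : C * K * x ^ (-1 / 2 : ℝ) = (C / x) * (K * √x) := by
      have hx := h3.1
      have : x ^ (-1 / 2 : ℝ) = √x / x := by
        rw [Real.sqrt_eq_rpow, ← Real.rpow_sub_one hx.ne']
        norm_num
      rw [this]; ring
    rw [e]
    exact mul_le_mul h2 h4 (abs_nonneg _) ((abs_nonneg _).trans h2)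
  have j1 := integrable_unitMeasure_iff.1 i1
  have j2 := integrable_unitMeasure_iff.1 i2
  have hc1 := intervalIntegral.continuousOn_primitive_interval' j1 (a := 1) (by simp)
  have hc2 := intervalIntegral.continuousOn_primitive_interval' j2 (a := 1) (by simp)
  rw [uIcc_of_le zero_le_one] at hc1 hc2
  have hpart : ∀ a ∈ Ioo (0 : ℝ) 1,
      (∫ x in (1 : ℝ)..a, U x * k x) + ∫ x in (1 : ℝ)..a, v x * P x = U a * P a := by
    intro a ha
    have hsub : IntervalIntegrable k volume a 1 := by
      refine (integrable_unitMeasure_iff.1 hki).mono_set ?_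
      rw [uIcc_of_le ha.2.le, uIcc_of_le zero_le_one]
      exact Icc_subset_Icc_left ha.1.le
    have hka := intervalIntegrable_sub_zero hki (Ioo_subset_Icc_self ha)
    by_cases hhalf : a ≤ 1 / 2
    · have e := integral_primitive_mul (c := a) (d := 1 / 2) (v₀ := C₀) (p₀ := P a) hsub (hvi a ha)
        (by simp) (by rw [uIcc_of_le ha.2.le]; exact ⟨hhalf, by norm_num⟩)
      have e3 : ∫ x in a..1, v x * (P a + ∫ y in a..x, k y) = ∫ x in a..1, v x * P x := by
        refine intervalIntegral.integral_congr fun x hx => ?_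
        rw [uIcc_of_le ha.2.le] at hx
        have : IntervalIntegrable k volume a x := by
          refine hsub.mono_set ?_
          rw [uIcc_of_le ha.2.le, uIcc_of_le hx.1]
          exact Icc_subset_Icc_right hx.2
        simp only [hP]
        rw [intervalIntegral.integral_add_adjacent_intervals hka this]
      rw [e3, h1, intervalIntegral.integral_same] at e
      rw [intervalIntegral.integral_symm, intervalIntegral.integral_symm a 1]
      simp only [hU] at e ⊢
      linarith
    · have e := integral_primitive_mul (c := a) (d := a) (v₀ := U a) (p₀ := P a) hsub (hvi a ha)
        (by simp) (by simp)
      have hhalf' : (1 / 2 : ℝ) ∈ Ioo (0 : ℝ) 1 := by norm_num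
      have hUe : ∀ x ∈ Icc a 1, U a + ∫ y in a..x, v y = U x := by
        intro x hx
        have g1 : IntervalIntegrable v volume (1 / 2) a := (hvi _ hhalf').mono_set (by
          rw [uIcc_of_le (le_of_not_ge hhalf), uIcc_of_le (by norm_num)]
          exact Icc_subset_Icc_right ha.2.le)
        have g2 : IntervalIntegrable v volume a x := (hvi a ha).mono_set (by
          rw [uIcc_of_le ha.2.le, uIcc_of_le hx.1]
          exact Icc_subset_Icc_right hx.2)
        simp only [hU]
        rw [add_assoc, intervalIntegral.integral_add_adjacent_intervals g1 g2]
      have e3 : ∫ x in a..1, v x * (P a + ∫ y in a..x, k y) = ∫ x in a..1, v x * P x := by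
        refine intervalIntegral.integral_congr fun x hx => ?_
        rw [uIcc_of_le ha.2.le] at hx
        have : IntervalIntegrable k volume a x := by
          refine hsub.mono_set ?_
          rw [uIcc_of_le ha.2.le, uIcc_of_le hx.1]
          exact Icc_subset_Icc_right hx.2
        simp only [hP]
        rw [intervalIntegral.integral_add_adjacent_intervals hka this]
      have e4 : ∫ x in a..1, (U a + ∫ y in a..x, v y) * k x = ∫ x in a..1, U x * k x := by
        refine intervalIntegral.integral_congr fun x hx => ?_
        rw [uIcc_of_le ha.2.le] at hx
        rw [hUe x hx]
      rw [e3, e4, hUe 1 ⟨ha.2.le, le_rfl⟩, intervalIntegral.integral_same] at e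
      have h1' : U 1 = 0 := h1
      rw [h1'] at e
      simp only [intervalIntegral.integral_same, hU] at e ⊢
      simp only [hU] at h1'
      rw [intervalIntegral.integral_symm, intervalIntegral.integral_symm a 1]
      linarith
  have hlim : Tendsto (fun a => U a * P a) (𝓝[>] 0) (𝓝 0) := by
    have hs : Tendsto (fun a : ℝ => M * (K * √a)) (𝓝[>] 0) (𝓝 0) := by
      have : Tendsto (fun a : ℝ => M * (K * √a)) (𝓝 0) (𝓝 (M * (K * √0))) :=
        ((Real.continuous_sqrt.tendsto 0).const_mul K).const_mul M
      simp only [Real.sqrt_zero, mul_zero] at this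
      exact this.mono_left nhdsWithin_le_nhds
    refine squeeze_zero_norm' ?_ hs
    filter_upwards [Ioo_mem_nhdsGT (zero_lt_one (α := ℝ))] with a ha
    rw [Real.norm_eq_abs, abs_mul]
    exact mul_le_mul (hM a ha) (hPK a (Ioo_subset_Icc_self ha)) (abs_nonneg _)
      ((abs_nonneg _).trans (hM a ha))
  have hlim2 : Tendsto (fun a => U a * P a) (𝓝[>] 0)
      (𝓝 ((∫ x in (1 : ℝ)..0, U x * k x) + ∫ x in (1 : ℝ)..0, v x * P x)) := by
    have hc := (hc1.fun_add hc2) 0 (by simp)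
    have hc' : Tendsto (fun a => (∫ x in (1 : ℝ)..a, U x * k x) + ∫ x in (1 : ℝ)..a, v x * P x)
        (𝓝[>] 0) (𝓝 ((∫ x in (1 : ℝ)..0, U x * k x) + ∫ x in (1 : ℝ)..0, v x * P x)) := by
      refine hc.tendsto.mono_left ?_
      rw [nhdsWithin_le_iff]
      exact mem_of_superset (Ioo_mem_nhdsGT (zero_lt_one (α := ℝ))) Ioo_subset_Icc_self
    refine hc'.congr' ?_
    filter_upwards [Ioo_mem_nhdsGT (zero_lt_one (α := ℝ))] with a ha
    exact hpart a ha
  have hz := tendsto_nhds_unique hlim hlim2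
  rw [intervalIntegral.integral_symm, intervalIntegral.integral_symm 0 1] at hz
  rw [integral_unitMeasure, integral_unitMeasure]
  linarith

/-- A function that is a primitive near `1` and has the essential limit `0` at `1` vanishes
at `1`. -/
theorem primitive_one_eq_zero {w v : ℝ → ℝ} {C₀ : ℝ}
    (hv : ∀ a ∈ Ioo (0 : ℝ) 1, IntervalIntegrable v volume a 1)
    (hw : ∀ᵐ x ∂unitMeasure, w x = C₀ + ∫ y in (1 / 2 : ℝ)..x, v y)
    (hlim : Tendsto w (𝓝[<] (1 : ℝ) ⊓ ae volume) (𝓝 0)) :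
    C₀ + ∫ y in (1 / 2 : ℝ)..1, v y = 0 := by
  have hne : (𝓝[<] (1 : ℝ) ⊓ ae volume).NeBot := by
    rw [inf_neBot_iff]
    intro s hs t ht
    obtain ⟨a, ha, has⟩ := (mem_nhdsLT_iff_exists_Ioo_subset).1 hs
    by_contra hemp
    rw [not_nonempty_iff_eq_empty] at hemp
    have h1 : Ioo a 1 ⊆ tᶜ := fun x hx hxt => by
      have : x ∈ s ∩ t := ⟨has hx, hxt⟩
      rw [hemp] at this
      exact this
    have h2 : volume (Ioo a 1) = 0 := measure_mono_null h1 ht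
    rw [Real.volume_Ioo] at h2
    have h3 : (0 : ℝ) < 1 - a := sub_pos.2 ha
    simp only [ENNReal.ofReal_eq_zero] at h2
    linarith
  have hUc : ContinuousOn (fun x => C₀ + ∫ y in (1 / 2 : ℝ)..x, v y) (Ioc 0 1) :=
    continuousOn_const.fun_add (continuousOn_primitive_Ioc hv)
  have h1 : Tendsto (fun x => C₀ + ∫ y in (1 / 2 : ℝ)..x, v y) (𝓝[<] 1)
      (𝓝 (C₀ + ∫ y in (1 / 2 : ℝ)..1, v y)) := by
    refine (hUc 1 ⟨one_pos, le_rfl⟩).tendsto.mono_left ?_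
    rw [nhdsWithin_le_iff]
    exact mem_of_superset (Ioo_mem_nhdsLT (zero_lt_one (α := ℝ))) Ioo_subset_Ioc_self
  have h2 : w =ᶠ[𝓝[<] (1 : ℝ) ⊓ ae volume] fun x => C₀ + ∫ y in (1 / 2 : ℝ)..x, v y := by
    have h3 : ∀ᶠ x in ae (volume : Measure ℝ), x ∈ Ioo (0 : ℝ) 1 →
        w x = C₀ + ∫ y in (1 / 2 : ℝ)..x, v y := (ae_restrict_iff' measurableSet_Ioo).1 hw
    have h4 : ∀ᶠ x in 𝓝[<] (1 : ℝ), x ∈ Ioo (0 : ℝ) 1 := Ioo_mem_nhdsLT zero_lt_one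
    filter_upwards [h3.filter_mono inf_le_right, h4.filter_mono inf_le_left] with x h5 h6
    exact h5 h6
  exact tendsto_nhds_unique (h1.mono_left inf_le_left) (hlim.congr' h2)

/-! ### Bounds on bounded time intervals -/

theorem IsC1InL2.exists_deriv_bound {w wt : ℝ → ℝ → ℝ} (h : IsC1InL2 w wt) (T : ℝ) :
    ∃ K, 0 ≤ K ∧ ∀ t ∈ Icc 0 T, √(∫ x, wt t x ^ 2 ∂unitMeasure) ≤ K := by
  obtain ⟨G, hG, -, h2⟩ := h
  obtain ⟨K, hK⟩ := isCompact_Icc.exists_bound_of_continuousOn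
    (hG.continuousOn_derivWithin_Ici.mono (Icc_subset_Ici_self : Icc 0 T ⊆ Ici 0))
  refine ⟨|K|, abs_nonneg _, fun t ht => ?_⟩
  have e : ∫ x, wt t x ^ 2 ∂unitMeasure = ‖derivWithin G (Ici 0) t‖ ^ 2 := by
    rw [← Lp_two_integral_sq]
    refine integral_congr_ae ?_
    filter_upwards [h2 t ht.1] with x h3
    rw [h3]
  rw [e, Real.sqrt_sq (norm_nonneg _)]
  exact (hK t ht).trans (le_abs_self _)

/-- The primitive in space of a `C¹` curve in `L²(0,1)` is differentiable in time. -/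
theorem IsC1InL2.hasDerivWithinAt_primitive {w wt : ℝ → ℝ → ℝ} (h : IsC1InL2 w wt) {x : ℝ}
    (hx : x ∈ Icc (0 : ℝ) 1) {t : ℝ} (ht : 0 ≤ t) :
    HasDerivWithinAt (fun s => ∫ y in (0 : ℝ)..x, w s y) (∫ y in (0 : ℝ)..x, wt t y) (Ici 0) t := by
  have hψ : MemLp ((Ioo 0 x).indicator fun _ => (1 : ℝ)) 2 unitMeasure :=
    (memLp_const 1).indicator measurableSet_Ioo
  have e : ∀ v : ℝ → ℝ, ∫ y, v y * (Ioo 0 x).indicator (fun _ => (1 : ℝ)) y ∂unitMeasure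
      = ∫ y in (0 : ℝ)..x, v y := by
    intro v
    have h1 : (fun y => v y * (Ioo 0 x).indicator (fun _ => (1 : ℝ)) y) = (Ioo 0 x).indicator v := by
      ext y
      by_cases hy : y ∈ Ioo 0 x <;> simp [hy]
    rw [h1, integral_indicator measurableSet_Ioo, Measure.restrict_restrict measurableSet_Ioo,
      inter_eq_left.2 (Ioo_subset_Ioo_right hx.2), intervalIntegral.integral_of_le hx.1,
      integral_Ioc_eq_integral_Ioo]
  have := h.hasDerivWithinAt_integral_mul hψ ht
  simpa only [e] using this

namespace RegularFlow

variable {ρ g f γ α θ C₁ C₂ C₃ C₄ : ℝ} {c : ℝ → ℝ} {W S u ux ut H h : ℝ → ℝ → ℝ}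

theorem exists_u_bound (F : RegularFlow ρ g f γ α θ C₁ C₂ C₃ C₄ c W S u ux ut H h) :
    ∃ M, 0 ≤ M ∧ ∀ t, 0 ≤ t → ∀ᵐ x ∂unitMeasure, |u t x| ≤ M := by
  obtain ⟨M, hM⟩ := F.u_bdd
  exact ⟨|M|, abs_nonneg _, fun t ht => (hM t ht).mono fun x hx => hx.trans (le_abs_self M)⟩

theorem c_pos (F : RegularFlow ρ g f γ α θ C₁ C₂ C₃ C₄ c W S u ux ut H h) (hC₃ : 0 < C₃) {x : ℝ}
    (hx : x ∈ Ioo (0 : ℝ) 1) : 0 < c x :=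
  lt_of_lt_of_le (mul_pos hC₃ (Real.rpow_pos_of_pos hx.1 α)) (F.c_lower x (Ioo_subset_Icc_self hx))

theorem force_meas (F : RegularFlow ρ g f γ α θ C₁ C₂ C₃ C₄ c W S u ux ut H h) {t : ℝ}
    (ht : 0 ≤ t) : AEStronglyMeasurable (H t) unitMeasure := by
  have hu := (F.u_C1.memLp ht).aestronglyMeasurable
  refine (((F.h_meas t ht).mul hu).mul hu.norm).congr ?_
  filter_upwards [F.H_eq t ht] with x hx
  simp [hx]

theorem exists_force_bound (F : RegularFlow ρ g f γ α θ C₁ C₂ C₃ C₄ c W S u ux ut H h) :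
    ∃ M, 0 ≤ M ∧ ∀ t, 0 ≤ t → ∀ᵐ x ∂unitMeasure, |H t x| ≤ M := by
  obtain ⟨M, hM0, hM⟩ := F.exists_u_bound
  refine ⟨|f * ρ ^ 2| * M * M, by positivity, fun t ht => ?_⟩
  filter_upwards [hM t ht, F.H_eq t ht, F.h_nonneg t ht, F.h_le t ht] with x h1 h2 h3 h4
  rw [h2, abs_mul, abs_mul, abs_abs]
  gcongr

theorem memLp_force (F : RegularFlow ρ g f γ α θ C₁ C₂ C₃ C₄ c W S u ux ut H h) {t : ℝ}
    (ht : 0 ≤ t) : MemLp (H t) 2 unitMeasure := by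
  obtain ⟨M, -, hM⟩ := F.exists_force_bound
  exact MemLp.of_bound (F.force_meas ht) M (hM t ht)

theorem memLp_forcing (F : RegularFlow ρ g f γ α θ C₁ C₂ C₃ C₄ c W S u ux ut H h) {t : ℝ}
    (ht : 0 ≤ t) : MemLp (fun y => ut t y + H t y) 2 unitMeasure :=
  (F.u_C1.memLp_deriv ht).add (F.memLp_force ht)

theorem continuousOn_flux (F : RegularFlow ρ g f γ α θ C₁ C₂ C₃ C₄ c W S u ux ut H h)
    (hp : AdmissibleParams ρ g f γ α θ C₁ C₂ C₃ C₄) {t : ℝ} (ht : 0 ≤ t) :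
    ContinuousOn (S t) (Icc 0 1) := by
  have h1 : ContinuousOn (fun x => W t x ^ (γ / θ) - g * x + ∫ y in (0 : ℝ)..x, (ut t y + H t y))
      (Icc 0 1) :=
    ((((F.W_cont t ht).rpow_const fun x => Or.inr hp.p_pos.le).sub
      (continuous_const.mul continuous_id)).continuousOn).add
      (continuousOn_primitive_Icc ((F.memLp_forcing ht).integrable (by norm_num)))
  exact h1.congr fun x hx => F.S_eq t ht x hx

theorem exists_flux_bound (F : RegularFlow ρ g f γ α θ C₁ C₂ C₃ C₄ c W S u ux ut H h)
    (hp : AdmissibleParams ρ g f γ α θ C₁ C₂ C₃ C₄) :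
    ∃ M, 0 ≤ M ∧ ∀ t, 0 ≤ t → ∀ x ∈ Icc (0 : ℝ) 1, |S t x| ≤ M := by
  obtain ⟨M, hM⟩ := F.S_bdd
  refine ⟨|M|, abs_nonneg _, fun t ht => ?_⟩
  refine le_on_Icc_of_ae_le (F.continuousOn_flux hp ht).abs continuousOn_const ?_
  exact (hM t ht).mono fun x hx => hx.trans (le_abs_self M)

theorem exists_forcing_bound (F : RegularFlow ρ g f γ α θ C₁ C₂ C₃ C₄ c W S u ux ut H h) (T : ℝ) :
    ∃ K, 0 ≤ K ∧ ∀ t ∈ Icc 0 T, ∀ x ∈ Icc (0 : ℝ) 1,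
      |∫ y in (0 : ℝ)..x, (ut t y + H t y)| ≤ K * √x := by
  obtain ⟨K, hK0, hK⟩ := F.u_C1.exists_deriv_bound T
  obtain ⟨M, hM0, hM⟩ := F.exists_force_bound
  refine ⟨K + M, by positivity, fun t ht x hx => ?_⟩
  have i1 := intervalIntegrable_sub_zero (F.u_C1.integrable_deriv ht.1) hx
  have i2 := intervalIntegrable_sub_zero ((F.memLp_force ht.1).integrable (by norm_num)) hx
  rw [intervalIntegral.integral_add i1 i2, add_mul]
  refine (abs_add_le _ _).trans (add_le_add ?_ ?_)
  · exact (abs_primitive_le (F.u_C1.memLp_deriv ht.1) hx).trans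
      (mul_le_mul_of_nonneg_right (hK t ht) (Real.sqrt_nonneg _))
  · refine (abs_primitive_le (F.memLp_force ht.1) hx).trans
      (mul_le_mul_of_nonneg_right ?_ (Real.sqrt_nonneg _))
    refine Real.sqrt_le_iff.2 ⟨hM0, ?_⟩
    have : ∫ y, H t y ^ 2 ∂unitMeasure ≤ ∫ _, M ^ 2 ∂unitMeasure := by
      refine integral_mono_ae (F.memLp_force ht.1).integrable_sq (integrable_const _) ?_
      filter_upwards [hM t ht.1] with y hy
      exact sq_le_sq.2 (hy.trans (le_abs_self M))
    simpa using this

theorem continuousOn_W_time (F : RegularFlow ρ g f γ α θ C₁ C₂ C₃ C₄ c W S u ux ut H h) {x : ℝ}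
    (hx : x ∈ Icc (0 : ℝ) 1) : ContinuousOn (fun t => W t x) (Ici 0) := fun t ht =>
  (F.W_ode t ht x hx).continuousWithinAt

theorem hasDerivAt_W (F : RegularFlow ρ g f γ α θ C₁ C₂ C₃ C₄ c W S u ux ut H h) {t x : ℝ}
    (ht : 0 < t) (hx : x ∈ Icc (0 : ℝ) 1) :
    HasDerivAt (fun s => W s x) (-(θ * ρ) * S t x) t :=
  (F.W_ode t ht.le x hx).hasDerivAt (Ici_mem_nhds ht)

/-- On bounded time intervals `W` is at most a multiple of `x^{θ/γ}`. -/
theorem exists_W_upper (F : RegularFlow ρ g f γ α θ C₁ C₂ C₃ C₄ c W S u ux ut H h)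
    (hp : AdmissibleParams ρ g f γ α θ C₁ C₂ C₃ C₄) (T : ℝ) :
    ∃ R, 0 ≤ R ∧ ∀ t ∈ Icc 0 T, ∀ x ∈ Icc (0 : ℝ) 1, W t x ≤ R * x ^ (θ / γ) := by
  obtain ⟨K, hK0, hK⟩ := F.exists_forcing_bound T
  have hg := hp.g_pos
  have hlam : 0 < θ * ρ := mul_pos hp.θ_pos hp.ρ_pos
  have hC₂ := hp.C₂_pos
  by_cases hT : 0 ≤ T
  swap
  · exact ⟨0, le_rfl, fun t ht => absurd (ht.1.trans ht.2) hT⟩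
  refine ⟨C₂ ^ θ + θ * ρ * (g + K) * T, by positivity, fun t ht x hx => ?_⟩
  have hx0 : 0 ≤ x ^ (θ / γ) := Real.rpow_nonneg hx.1 _
  have hanti : AntitoneOn (fun s => W s x - θ * ρ * (g + K) * x ^ (θ / γ) * s) (Icc 0 T) := by
    refine antitoneOn_of_hasDerivWithinAt_nonpos (convex_Icc 0 T)
      (f' := fun s => -(θ * ρ) * S s x - θ * ρ * (g + K) * x ^ (θ / γ)) ?_ ?_ ?_
    · exact ((F.continuousOn_W_time hx).mono Icc_subset_Ici_self).sub (by fun_prop)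
    · intro s hs
      rw [interior_Icc] at hs
      have h1 : HasDerivAt (fun s => W s x - θ * ρ * (g + K) * x ^ (θ / γ) * s)
          (-(θ * ρ) * S s x - θ * ρ * (g + K) * x ^ (θ / γ) * 1) s :=
        (F.hasDerivAt_W hs.1 hx).fun_sub ((hasDerivAt_id s).const_mul _)
      rw [mul_one] at h1
      exact h1.hasDerivWithinAt
    · intro s hs
      rw [interior_Icc] at hs
      have h1 := abs_le.1 (hK s (Ioo_subset_Icc_self hs) x hx)
      have h2 : 0 ≤ W s x ^ (γ / θ) := Real.rpow_nonneg (F.W_nonneg s hs.1.le x hx) _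
      rw [F.S_eq s hs.1.le x hx]
      have h3 : K * √x ≤ K * x ^ (θ / γ) := mul_le_mul_of_nonneg_left (hp.sqrt_le_rpow_β hx) hK0
      have h4 : g * x ≤ g * x ^ (θ / γ) := mul_le_mul_of_nonneg_left (hp.le_rpow_β hx) hg.le
      nlinarith [h1.1]
  have h0 := hanti ⟨le_rfl, hT⟩ ht ht.1
  simp only [mul_zero, sub_zero] at h0
  have h1 := (F.W_init x hx).2
  have h2 : θ * ρ * (g + K) * x ^ (θ / γ) * t ≤ θ * ρ * (g + K) * x ^ (θ / γ) * T := by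
    have := ht.2
    gcongr
  nlinarith

/-- `W / x^{θ/γ}` is Lipschitz in time, uniformly in `x`, on bounded time intervals. -/
theorem exists_W_lipschitz (F : RegularFlow ρ g f γ α θ C₁ C₂ C₃ C₄ c W S u ux ut H h)
    (hp : AdmissibleParams ρ g f γ α θ C₁ C₂ C₃ C₄) (T : ℝ) :
    ∃ L, 0 ≤ L ∧ ∀ s ∈ Icc 0 T, ∀ t ∈ Icc 0 T, ∀ x ∈ Icc (0 : ℝ) 1,
      |W t x - W s x| ≤ L * x ^ (θ / γ) * |t - s| := by
  obtain ⟨K, hK0, hK⟩ := F.exists_forcing_bound T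
  obtain ⟨R, hR0, hR⟩ := F.exists_W_upper hp T
  have hg := hp.g_pos
  have hlam : 0 < θ * ρ := mul_pos hp.θ_pos hp.ρ_pos
  refine ⟨θ * ρ * (R ^ (γ / θ) + g + K), by positivity, fun s hs t ht x hx => ?_⟩
  have hx0 : 0 ≤ x ^ (θ / γ) := Real.rpow_nonneg hx.1 _
  have key : ∀ τ ∈ Icc 0 T, ‖-(θ * ρ) * S τ x‖ ≤ θ * ρ * (R ^ (γ / θ) + g + K) * x ^ (θ / γ) := by
    intro τ hτ
    have h1 := abs_le.1 (hK τ hτ x hx)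
    have h2 : 0 ≤ W τ x ^ (γ / θ) := Real.rpow_nonneg (F.W_nonneg τ hτ.1 x hx) _
    have h5 : W τ x ^ (γ / θ) ≤ R ^ (γ / θ) * x := by
      rw [← hp.profile_rpow_p hR0 hx.1]
      exact Real.rpow_le_rpow (F.W_nonneg τ hτ.1 x hx) (hR τ hτ x hx) hp.p_pos.le
    have h6 : R ^ (γ / θ) * x ≤ R ^ (γ / θ) * x ^ (θ / γ) :=
      mul_le_mul_of_nonneg_left (hp.le_rpow_β hx) (by positivity)
    have h3 : K * √x ≤ K * x ^ (θ / γ) := mul_le_mul_of_nonneg_left (hp.sqrt_le_rpow_β hx) hK0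
    have h4 : g * x ≤ g * x ^ (θ / γ) := mul_le_mul_of_nonneg_left (hp.le_rpow_β hx) hg.le
    have h7 : 0 ≤ g * x := mul_nonneg hg.le hx.1
    have h8 : |S τ x| ≤ (R ^ (γ / θ) + g + K) * x ^ (θ / γ) := by
      rw [F.S_eq τ hτ.1 x hx, abs_le]
      constructor <;> nlinarith [h1.1, h1.2]
    rw [Real.norm_eq_abs, abs_mul, abs_neg, abs_of_pos hlam]
    exact (mul_le_mul_of_nonneg_left h8 hlam.le).trans_eq (by ring)
  have := (convex_Icc 0 T).norm_image_sub_le_of_norm_hasDerivWithin_le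
    (f := fun s => W s x) (f' := fun τ => -(θ * ρ) * S τ x)
    (fun τ hτ => (F.W_ode τ hτ.1 x hx).mono Icc_subset_Ici_self) key hs ht
  simpa only [Real.norm_eq_abs] using this

end RegularFlow

/-! ### Potential energy and weights -/

/-- The potential energy density of the state `s = (c Q)^θ` at `x`, relative to the stationary
state `s^{γ/θ} = g x` at which it attains its minimum `0`. -/
noncomputable def potential (g γ θ x s : ℝ) : ℝ :=
  s ^ ((γ - 1) / θ) / (γ - 1) + g * x * s ^ (-(1 / θ))
    - γ / (γ - 1) * (g * x) ^ ((γ - 1) / γ)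

theorem hasDerivAt_potential {g γ θ x s : ℝ} (hγ : 1 < γ) (hθ : 0 < θ) (hs : 0 < s) :
    HasDerivAt (potential g γ θ x)
      ((s ^ (γ / θ) - g * x) / (θ * s ^ ((1 + θ) / θ))) s := by
  have h1 := (Real.hasDerivAt_rpow_const (x := s) (p := (γ - 1) / θ) (Or.inl hs.ne')).div_const
    (γ - 1)
  have h2 := (Real.hasDerivAt_rpow_const (x := s) (p := -(1 / θ)) (Or.inl hs.ne')).const_mul (g * x)
  have h3 := (h1.fun_add h2).sub_const (γ / (γ - 1) * (g * x) ^ ((γ - 1) / γ))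
  refine h3.congr_deriv ?_
  have e1 : (γ - 1) / θ - 1 = γ / θ - (1 + θ) / θ := by field_simp; ring
  have e2 : -(1 / θ) - 1 = -((1 + θ) / θ) := by field_simp; ring
  have hq := (Real.rpow_pos_of_pos hs ((1 + θ) / θ)).ne'
  have hγ' : γ - 1 ≠ 0 := by linarith
  rw [e1, e2, Real.rpow_sub hs, Real.rpow_neg hs.le]
  field_simp
  ring

/-- The potential energy in terms of the ratio of `s^{1/θ} = c Q` to its stationary value, in
the form in which Bernoulli's inequality applies. -/
theorem potential_eq {g γ θ x s : ℝ} (hg : 0 < g) (hγ : 1 < γ) (hθ : 0 < θ) (hs : 0 < s)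
    (hx : 0 < x) :
    potential g γ θ x s = g * x / (s ^ (1 / θ) * (γ - 1)) *
      ((s ^ (1 / θ) / (g * x) ^ (1 / γ)) ^ γ - 1
        - γ * (s ^ (1 / θ) / (g * x) ^ (1 / γ) - 1)) := by
  have hγ0 : 0 < γ := by linarith
  have hgx : 0 < g * x := mul_pos hg hx
  set Q := s ^ (1 / θ) with hQ
  set R := (g * x) ^ (1 / γ) with hR
  have hQ0 : 0 < Q := Real.rpow_pos_of_pos hs _
  have hR0 : 0 < R := Real.rpow_pos_of_pos hgx _
  have e1 : s ^ ((γ - 1) / θ) = Q ^ γ / Q := by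
    rw [← Real.rpow_sub_one hQ0.ne', hQ, ← Real.rpow_mul hs.le]
    congr 1; field_simp
  have e2 : s ^ (-(1 / θ)) = Q⁻¹ := by rw [Real.rpow_neg hs.le]
  have e3 : R ^ γ = g * x := by
    rw [hR, ← Real.rpow_mul hgx.le, one_div_mul_cancel hγ0.ne', Real.rpow_one]
  have e4 : (g * x) ^ ((γ - 1) / γ) = g * x / R := by
    rw [sub_div, div_self hγ0.ne', Real.rpow_sub hgx, Real.rpow_one]
  have hγ' : γ - 1 ≠ 0 := by linarith
  unfold potential
  rw [e1, e2, e4, Real.div_rpow hQ0.le hR0.le, e3]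
  have := hgx.ne'; have := hQ0.ne'; have := hR0.ne'
  field_simp
  ring

/-- The stationary state minimises the potential energy: this is Bernoulli's inequality. -/
theorem potential_nonneg {g γ θ x s : ℝ} (hg : 0 < g) (hγ : 1 < γ) (hθ : 0 < θ) (hs : 0 < s)
    (hx : 0 < x) : 0 ≤ potential g γ θ x s := by
  rw [potential_eq hg hγ hθ hs hx]
  have hgx : 0 < g * x := mul_pos hg hx
  have hQ0 : 0 < s ^ (1 / θ) := Real.rpow_pos_of_pos hs _
  have hR0 : 0 < (g * x) ^ (1 / γ) := Real.rpow_pos_of_pos hgx _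
  have hr := div_pos hQ0 hR0
  have hb := one_add_mul_self_le_rpow_one_add
    (s := s ^ (1 / θ) / (g * x) ^ (1 / γ) - 1) (by linarith) hγ.le
  rw [add_sub_cancel] at hb
  refine mul_nonneg (div_nonneg hgx.le (mul_nonneg hQ0.le (by linarith))) (by linarith)

/-- The potential energy is controlled by the weighted distance of `c Q` to the stationary
profile. -/
theorem exists_potential_le {g γ θ C₁ C₂ : ℝ} (hg : 0 < g) (hγ : 1 < γ) (hθ : 0 < θ)
    (hC₁ : 0 < C₁) :
    ∃ C, 0 ≤ C ∧ ∀ x s, 0 < x → 0 < s → C₁ * x ^ (1 / γ) ≤ s ^ (1 / θ) →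
      s ^ (1 / θ) ≤ C₂ * x ^ (1 / γ) →
      potential g γ θ x s ≤ C * (x ^ (1 - 3 / γ) * (s ^ (1 / θ) - (g * x) ^ (1 / γ)) ^ 2) := by
  have hγ0 : 0 < γ := by linarith
  have hγ1 : 0 < γ - 1 := by linarith
  set G := g ^ (1 / γ) with hG
  have hG0 : 0 < G := Real.rpow_pos_of_pos hg _
  set a := min (C₁ / G) 1 with ha
  have ha0 : 0 < a := lt_min (div_pos hC₁ hG0) one_pos
  obtain ⟨C, hC0, hC⟩ := exists_taylor_bound (a := a) (b := max (C₂ / G) 1)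
    (η := fun r => r ^ γ) (η' := fun r => γ * r ^ (γ - 1))
    (η'' := fun r => γ * ((γ - 1) * r ^ (γ - 1 - 1)))
    (fun r _ => Real.hasDerivAt_rpow_const (Or.inr hγ.le))
    (fun r hr => (Real.hasDerivAt_rpow_const (Or.inl (ha0.trans_le hr.1).ne')).const_mul _)
    (fun r hr => ((((continuousAt_id (x := r)).rpow_const
      (Or.inl (ha0.trans_le hr.1).ne')).const_mul _).const_mul _).continuousWithinAt)
  refine ⟨g / (C₁ * (γ - 1)) * (C / G ^ 2), by positivity, fun x s hx hs h1 h2 => ?_⟩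
  rw [potential_eq hg hγ hθ hs hx]
  set Q := s ^ (1 / θ) with hQ
  have hX0 : 0 < x ^ (1 / γ) := Real.rpow_pos_of_pos hx _
  have hR : (g * x) ^ (1 / γ) = G * x ^ (1 / γ) := Real.mul_rpow hg.le hx.le
  set X := x ^ (1 / γ) with hX
  have hQ0 : 0 < Q := Real.rpow_pos_of_pos hs _
  have hm : Q / (G * X) ∈ Icc a (max (C₂ / G) 1) := by
    constructor
    · refine (min_le_left _ _).trans ?_
      rw [div_le_div_iff₀ hG0 (by positivity)]
      nlinarith
    · refine le_trans ?_ (le_max_left _ _)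
      rw [div_le_div_iff₀ (by positivity) hG0]
      nlinarith
  have h3 := (hC 1 ⟨min_le_right _ _, le_max_right _ _⟩ _ hm).2.2
  simp only [Real.one_rpow, mul_one] at h3
  have e : x ^ (1 - 3 / γ) = x / X ^ 3 := by
    rw [Real.rpow_sub hx, Real.rpow_one, hX, ← Real.rpow_natCast, ← Real.rpow_mul hx.le]
    congr 2
    push_cast
    ring
  rw [hR, e]
  calc g * x / (Q * (γ - 1)) * ((Q / (G * X)) ^ γ - 1 - γ * (Q / (G * X) - 1))
      ≤ g * x / (C₁ * X * (γ - 1)) * (C * (Q / (G * X) - 1) ^ 2) := by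
        refine mul_le_mul ?_ ((le_abs_self _).trans h3) ?_ (by positivity)
        · gcongr
        · have hb := one_add_mul_self_le_rpow_one_add (s := Q / (G * X) - 1)
            (by have : 0 < Q / (G * X) := by positivity
                linarith) hγ.le
          rw [add_sub_cancel] at hb
          linarith
    _ = g / (C₁ * (γ - 1)) * (C / G ^ 2) * (x / X ^ 3 * (Q - G * X) ^ 2) := by
        field_simp

/-- The weight `c / W^{(1+θ)/θ}`, which is the factor between the flux `S` and `ux`, is bounded by a
power of `x`. -/
theorem AdmissibleParams.weight_le {ρ g f γ α θ C₁ C₂ C₃ C₄ : ℝ}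
    (hp : AdmissibleParams ρ g f γ α θ C₁ C₂ C₃ C₄) {m x w k : ℝ} (hm : 0 < m)
    (hx : x ∈ Ioo (0 : ℝ) 1) (hk : k ≤ C₄ * x ^ α) (hw : m * x ^ (θ / γ) ≤ w) :
    k / w ^ ((1 + θ) / θ) ≤ C₄ / m ^ ((1 + θ) / θ) * x ^ (α - (1 + θ) / γ) := by
  have hC₄ := hp.C₄_pos
  have hxα : 0 < x ^ α := Real.rpow_pos_of_pos hx.1 _
  have hxq : 0 < x ^ ((1 + θ) / γ) := Real.rpow_pos_of_pos hx.1 _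
  have hmq : 0 < m ^ ((1 + θ) / θ) := Real.rpow_pos_of_pos hm _
  have hxβ : 0 < x ^ (θ / γ) := Real.rpow_pos_of_pos hx.1 _
  have h1 : m ^ ((1 + θ) / θ) * x ^ ((1 + θ) / γ) ≤ w ^ ((1 + θ) / θ) := by
    rw [← hp.profile_rpow_q hm.le hx.1.le]
    exact Real.rpow_le_rpow (by positivity) hw hp.q_pos.le
  calc k / w ^ ((1 + θ) / θ) ≤ C₄ * x ^ α / (m ^ ((1 + θ) / θ) * x ^ ((1 + θ) / γ)) :=
        div_le_div₀ (by positivity) hk (by positivity) h1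
    _ = _ := by rw [Real.rpow_sub hx.1]; field_simp

theorem AdmissibleParams.rpow_weight_le {ρ g f γ α θ C₁ C₂ C₃ C₄ : ℝ}
    (hp : AdmissibleParams ρ g f γ α θ C₁ C₂ C₃ C₄) {x : ℝ} (hx : x ∈ Ioo (0 : ℝ) 1) :
    x ^ (α - (1 + θ) / γ) ≤ x⁻¹ := by
  rw [← Real.rpow_neg_one]
  exact Real.rpow_le_rpow_of_exponent_ge hx.1 hx.2.le (by linarith [hp.βq_le_one, hp.α_nonneg])

theorem AdmissibleParams.weight_le_div {ρ g f γ α θ C₁ C₂ C₃ C₄ : ℝ}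
    (hp : AdmissibleParams ρ g f γ α θ C₁ C₂ C₃ C₄) {m x w k : ℝ} (hm : 0 < m)
    (hx : x ∈ Ioo (0 : ℝ) 1) (hk : k ≤ C₄ * x ^ α) (hw : m * x ^ (θ / γ) ≤ w) :
    k / w ^ ((1 + θ) / θ) ≤ C₄ / m ^ ((1 + θ) / θ) / x := by
  refine (hp.weight_le hm hx hk hw).trans ?_
  have hC₄ := hp.C₄_pos
  rw [div_eq_mul_inv _ x]
  exact mul_le_mul_of_nonneg_left (hp.rpow_weight_le hx) (by positivity)

/-- The energy of the flow: kinetic plus potential energy. -/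
noncomputable def flowEnergy (ρ g γ θ : ℝ) (c : ℝ → ℝ) (W u : ℝ → ℝ → ℝ) (t : ℝ) : ℝ :=
  (∫ x, u t x ^ 2 ∂unitMeasure) / 2 + (∫ x, c x * potential g γ θ x (W t x) ∂unitMeasure) / ρ

/-- The rate at which viscosity and friction dissipate the energy. -/
noncomputable def flowDissipation (θ : ℝ) (c : ℝ → ℝ) (W S u h : ℝ → ℝ → ℝ) (t : ℝ) : ℝ :=
  (∫ x, c x * S t x ^ 2 / W t x ^ ((1 + θ) / θ) ∂unitMeasure)
    + ∫ x, h t x * |u t x| ^ 3 ∂unitMeasure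

/-- Bounds that hold almost everywhere on `(0,1)` hold at points of continuity. -/
theorem le_on_Ioo_of_ae_le {a : ℝ → ℝ} {M : ℝ} (ha : ContinuousOn a (Ioo 0 1))
    (h : ∀ᵐ x ∂unitMeasure, a x ≤ M) : ∀ x ∈ Ioo (0 : ℝ) 1, a x ≤ M := by
  have h1 : EqOn (fun x => max (a x) M) (fun _ => M) (Ioo 0 1) :=
    Measure.eqOn_open_of_ae_eq (μ := volume) (h.mono fun x hx => max_eq_right hx) isOpen_Ioo
      (ha.sup continuousOn_const) continuousOn_const
  intro x hx
  exact (le_max_left _ _).trans_eq (h1 hx)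

namespace RegularFlow

variable {ρ g f γ α θ C₁ C₂ C₃ C₄ : ℝ} {c : ℝ → ℝ} {W S u ux ut H h : ℝ → ℝ → ℝ}

theorem W_pos {m t x : ℝ} (hm : 0 < m) (hW : ∀ x ∈ Icc (0 : ℝ) 1, m * x ^ (θ / γ) ≤ W t x)
    (hx : x ∈ Ioo (0 : ℝ) 1) : 0 < W t x :=
  (mul_pos hm (Real.rpow_pos_of_pos hx.1 _)).trans_le (hW x (Ioo_subset_Icc_self hx))

theorem ux_ae_eq (F : RegularFlow ρ g f γ α θ C₁ C₂ C₃ C₄ c W S u ux ut H h) {m t : ℝ}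
    (hm : 0 < m) (ht : 0 ≤ t) (hW : ∀ x ∈ Icc (0 : ℝ) 1, m * x ^ (θ / γ) ≤ W t x) :
    ∀ᵐ x ∂unitMeasure, ux t x = c x / W t x ^ ((1 + θ) / θ) * S t x := by
  filter_upwards [F.ux_eq t ht, unitMeasure_ae_mem] with x h1 h2
  have := (Real.rpow_pos_of_pos (W_pos hm hW h2) ((1 + θ) / θ)).ne'
  field_simp
  linarith

theorem ux_meas (F : RegularFlow ρ g f γ α θ C₁ C₂ C₃ C₄ c W S u ux ut H h) {t : ℝ}
    (ht : 0 ≤ t) : AEStronglyMeasurable (ux t) unitMeasure :=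
  (F.weakDeriv t ht).1.aestronglyMeasurable

theorem ux_le (F : RegularFlow ρ g f γ α θ C₁ C₂ C₃ C₄ c W S u ux ut H h)
    (hp : AdmissibleParams ρ g f γ α θ C₁ C₂ C₃ C₄) {m t M : ℝ}
    (hm : 0 < m) (ht : 0 ≤ t) (hW : ∀ x ∈ Icc (0 : ℝ) 1, m * x ^ (θ / γ) ≤ W t x)
    (hS : ∀ x ∈ Icc (0 : ℝ) 1, |S t x| ≤ M) :
    ∀ᵐ x ∂unitMeasure, |ux t x| ≤ C₄ / m ^ ((1 + θ) / θ) * M * x ^ (α - (1 + θ) / γ) := by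
  filter_upwards [F.ux_ae_eq hm ht hW, unitMeasure_ae_mem] with x h1 h2
  have hx := Ioo_subset_Icc_self h2
  have h3 := hp.weight_le hm h2 (F.c_upper x hx) (hW x hx)
  have h4 : 0 ≤ c x / W t x ^ ((1 + θ) / θ) :=
    div_nonneg (F.c_pos hp.C₃_pos h2).le (Real.rpow_pos_of_pos (W_pos hm hW h2) _).le
  rw [h1, abs_mul, abs_of_nonneg h4]
  exact (mul_le_mul h3 (hS x hx) (abs_nonneg _) (h4.trans h3)).trans_eq (by ring)

theorem ux_le_div (F : RegularFlow ρ g f γ α θ C₁ C₂ C₃ C₄ c W S u ux ut H h)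
    (hp : AdmissibleParams ρ g f γ α θ C₁ C₂ C₃ C₄) {m t M : ℝ}
    (hm : 0 < m) (ht : 0 ≤ t) (hW : ∀ x ∈ Icc (0 : ℝ) 1, m * x ^ (θ / γ) ≤ W t x)
    (hS : ∀ x ∈ Icc (0 : ℝ) 1, |S t x| ≤ M) :
    ∀ᵐ x ∂unitMeasure, |ux t x| ≤ C₄ / m ^ ((1 + θ) / θ) * M / x := by
  have hM : 0 ≤ M := (abs_nonneg _).trans (hS 0 (by simp))
  have hC₄ := hp.C₄_pos
  filter_upwards [F.ux_le hp hm ht hW hS, unitMeasure_ae_mem] with x h1 h2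
  refine h1.trans ?_
  rw [div_eq_mul_inv _ x]
  exact mul_le_mul_of_nonneg_left (hp.rpow_weight_le h2) (by positivity)

/-- The velocity is the primitive of `ux` that vanishes at `x = 1`. -/
theorem exists_u_primitive (F : RegularFlow ρ g f γ α θ C₁ C₂ C₃ C₄ c W S u ux ut H h)
    (hp : AdmissibleParams ρ g f γ α θ C₁ C₂ C₃ C₄) {m t : ℝ}
    (hm : 0 < m) (ht : 0 < t) (hW : ∀ x ∈ Icc (0 : ℝ) 1, m * x ^ (θ / γ) ≤ W t x) :
    ∃ C₀, (∀ᵐ x ∂unitMeasure, u t x = C₀ + ∫ y in (1 / 2 : ℝ)..x, ux t y) ∧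
      C₀ + ∫ y in (1 / 2 : ℝ)..1, ux t y = 0 := by
  obtain ⟨M, hM0, hM⟩ := F.exists_flux_bound hp
  obtain ⟨C₀, hC₀⟩ := (F.weakDeriv t ht.le).2
  exact ⟨C₀, hC₀, primitive_one_eq_zero (fun a ha => intervalIntegrable_of_le_div (F.ux_meas ht.le)
    (F.ux_le_div hp hm ht.le hW (hM t ht.le)) ha) hC₀ (F.boundary_u t ht)⟩

/-- Integration by parts for `∫ u k`. The boundary terms vanish, at `1` because `u` does and at `0`
because the primitive of `k` is `O(√x)` there and `u` is bounded. -/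
theorem integral_u_mul (F : RegularFlow ρ g f γ α θ C₁ C₂ C₃ C₄ c W S u ux ut H h)
    (hp : AdmissibleParams ρ g f γ α θ C₁ C₂ C₃ C₄) {m t : ℝ}
    (hm : 0 < m) (ht : 0 < t) (hW : ∀ x ∈ Icc (0 : ℝ) 1, m * x ^ (θ / γ) ≤ W t x) {k : ℝ → ℝ}
    (hk : MemLp k 2 unitMeasure) :
    ∫ x, u t x * k x ∂unitMeasure
      = - ∫ x, ux t x * (∫ y in (0 : ℝ)..x, k y) ∂unitMeasure := by
  obtain ⟨M, hM0, hM⟩ := F.exists_flux_bound hp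
  obtain ⟨B, hB0, hB⟩ := F.exists_u_bound
  obtain ⟨C₀, hC₀, h1⟩ := F.exists_u_primitive hp hm ht hW
  have hux := F.ux_le_div hp hm ht.le hW (hM t ht.le)
  have hc : ContinuousOn (fun x => C₀ + ∫ y in (1 / 2 : ℝ)..x, ux t y) (Ioc 0 1) :=
    continuousOn_const.fun_add (continuousOn_primitive_Ioc fun a ha =>
      intervalIntegrable_of_le_div (F.ux_meas ht.le) hux ha)
  rw [← integral_mul_eq_neg_integral_mul_primitive hk (F.ux_meas ht.le) hux (M := B) ?_ h1]
  · refine integral_congr_ae ?_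
    filter_upwards [hC₀] with x hx
    rw [hx]
  · refine le_on_Ioo_of_ae_le (hc.mono Ioo_subset_Ioc_self).abs ?_
    filter_upwards [hC₀, hB t ht.le] with x h2 h3
    rwa [← h2]

theorem friction_integrable (F : RegularFlow ρ g f γ α θ C₁ C₂ C₃ C₄ c W S u ux ut H h) {t : ℝ}
    (ht : 0 ≤ t) : Integrable (fun x => h t x * |u t x| ^ 3) unitMeasure := by
  obtain ⟨M, hM0, hM⟩ := F.exists_u_bound
  have hu := (F.u_C1.memLp ht).aestronglyMeasurable
  refine integrable_of_bound (M := |f * ρ ^ 2| * M ^ 3) ((F.h_meas t ht).mul (hu.norm.pow 3)) ?_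
  filter_upwards [hM t ht, F.h_nonneg t ht, F.h_le t ht] with x h1 h3 h4
  rw [abs_mul, abs_of_nonneg h3, abs_pow, abs_abs]
  have := h4.trans (le_abs_self _)
  gcongr

end RegularFlow

/-! ### The energy balance -/

theorem measurable_potential {g γ θ : ℝ} {V : ℝ → ℝ} (hV : Measurable V) :
    Measurable (fun x => potential g γ θ x (V x)) := by
  unfold potential
  fun_prop

theorem exists_potential_bound {g γ θ m R : ℝ} (hg : 0 < g) (hγ : 1 < γ) (hθ : 0 < θ)
    (hm : 0 < m) :
    ∃ B, 0 ≤ B ∧ ∀ x ∈ Ioo (0 : ℝ) 1, ∀ s, m * x ^ (θ / γ) ≤ s → s ≤ R * x ^ (θ / γ) →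
      |potential g γ θ x s| ≤ B := by
  have hγ0 : 0 < γ := by linarith
  have hγ1 : 0 < γ - 1 := by linarith
  refine ⟨|R| ^ ((γ - 1) / θ) / (γ - 1) + g * m ^ (-(1 / θ)), by positivity,
    fun x hx s h1 h2 => ?_⟩
  have hxβ : 0 < x ^ (θ / γ) := Real.rpow_pos_of_pos hx.1 _
  have hs : 0 < s := (mul_pos hm hxβ).trans_le h1
  rw [abs_of_nonneg (potential_nonneg hg hγ hθ hs hx.1)]
  have hgx : 0 < g * x := mul_pos hg hx.1
  have hsR : s ≤ |R| := by
    have : x ^ (θ / γ) ≤ 1 := Real.rpow_le_one hx.1.le hx.2.le (by positivity)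
    have := le_abs_self R
    have := abs_nonneg R
    nlinarith
  have e1 : s ^ ((γ - 1) / θ) ≤ |R| ^ ((γ - 1) / θ) := Real.rpow_le_rpow hs.le hsR (by positivity)
  have e2 : s ^ (-(1 / θ)) ≤ (m * x ^ (θ / γ)) ^ (-(1 / θ)) :=
    Real.rpow_le_rpow_of_nonpos (mul_pos hm hxβ) h1
      (neg_nonpos.2 (by positivity))
  have e3 : x * (m * x ^ (θ / γ)) ^ (-(1 / θ)) ≤ m ^ (-(1 / θ)) := by
    rw [Real.mul_rpow hm.le hxβ.le, ← Real.rpow_mul hx.1.le]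
    have e4 : x * x ^ (θ / γ * -(1 / θ)) = x ^ (1 - 1 / γ) := by
      rw [← Real.rpow_one_add' hx.1.le]
      · congr 1; field_simp
        ring
      · have : θ / γ * -(1 / θ) = -(1 / γ) := by field_simp
        rw [this]
        have : 1 / γ < 1 := by rw [div_lt_one hγ0]; exact hγ
        linarith
    have e5 : x ^ (1 - 1 / γ) ≤ 1 := by
      refine Real.rpow_le_one hx.1.le hx.2.le ?_
      have : 1 / γ < 1 := by rw [div_lt_one hγ0]; exact hγ
      linarith
    have e6 : 0 < m ^ (-(1 / θ)) := Real.rpow_pos_of_pos hm _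
    nlinarith
  have e7 : 0 ≤ γ / (γ - 1) * (g * x) ^ ((γ - 1) / γ) := by positivity
  have e8 : s ^ ((γ - 1) / θ) / (γ - 1) ≤ |R| ^ ((γ - 1) / θ) / (γ - 1) := by gcongr
  have e9 : g * x * s ^ (-(1 / θ)) ≤ g * m ^ (-(1 / θ)) := by
    rw [mul_assoc]
    refine mul_le_mul_of_nonneg_left ?_ hg.le
    exact (mul_le_mul_of_nonneg_left e2 hx.1.le).trans e3
  unfold potential
  linarith

namespace RegularFlow

variable {ρ g f γ α θ C₁ C₂ C₃ C₄ : ℝ} {c : ℝ → ℝ} {W S u ux ut H h : ℝ → ℝ → ℝ}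

theorem W_rpow_le (F : RegularFlow ρ g f γ α θ C₁ C₂ C₃ C₄ c W S u ux ut H h)
    (hp : AdmissibleParams ρ g f γ α θ C₁ C₂ C₃ C₄) {R t x : ℝ} (hR : 0 ≤ R) (ht : 0 ≤ t)
    (hx : x ∈ Icc (0 : ℝ) 1) (hW : W t x ≤ R * x ^ (θ / γ)) :
    W t x ^ (γ / θ) ≤ R ^ (γ / θ) * x := by
  rw [← hp.profile_rpow_p hR hx.1]
  exact Real.rpow_le_rpow (F.W_nonneg t ht x hx) hW hp.p_pos.le

/-- The flux is `O(√x)` at `0`, which makes the singular weight `c / W^{(1+θ)/θ} = O(1/x)` harmless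
in integrals that contain the flux twice. -/
theorem exists_flux_sqrt_bound (F : RegularFlow ρ g f γ α θ C₁ C₂ C₃ C₄ c W S u ux ut H h)
    (hp : AdmissibleParams ρ g f γ α θ C₁ C₂ C₃ C₄) {R T : ℝ} (hR : 0 ≤ R)
    (hW : ∀ t ∈ Icc 0 T, ∀ x ∈ Icc (0 : ℝ) 1, W t x ≤ R * x ^ (θ / γ)) :
    ∃ K, 0 ≤ K ∧ ∀ t ∈ Icc 0 T, ∀ x ∈ Icc (0 : ℝ) 1, |S t x| ≤ K * √x := by
  obtain ⟨K, hK0, hK⟩ := F.exists_forcing_bound T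
  have hg := hp.g_pos
  refine ⟨R ^ (γ / θ) + g + K, by positivity, fun t ht x hx => ?_⟩
  have h1 := abs_le.1 (hK t ht x hx)
  have h2 : 0 ≤ W t x ^ (γ / θ) := Real.rpow_nonneg (F.W_nonneg t ht.1 x hx) _
  have h3 := F.W_rpow_le hp hR ht.1 hx (hW t ht x hx)
  have h4 : x ≤ √x := Real.le_sqrt_of_sq_le (by nlinarith [hx.1, hx.2])
  have h5 : R ^ (γ / θ) * x ≤ R ^ (γ / θ) * √x := by gcongr
  have h6 : g * x ≤ g * √x := by gcongr
  have h7 : 0 ≤ g * x := mul_nonneg hg.le hx.1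
  rw [F.S_eq t ht.1 x hx, abs_le]
  constructor <;> nlinarith [h1.1, h1.2]

theorem weight_meas (F : RegularFlow ρ g f γ α θ C₁ C₂ C₃ C₄ c W S u ux ut H h) {t : ℝ}
    (ht : 0 ≤ t) : AEStronglyMeasurable (fun x => c x / W t x ^ ((1 + θ) / θ)) unitMeasure :=
  (F.c_meas.div ((F.W_cont t ht).measurable.pow_const _).aemeasurable).aestronglyMeasurable

theorem dissipation_le (F : RegularFlow ρ g f γ α θ C₁ C₂ C₃ C₄ c W S u ux ut H h)
    (hp : AdmissibleParams ρ g f γ α θ C₁ C₂ C₃ C₄) {m t K B x : ℝ} (hm : 0 < m)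
    (hW : ∀ x ∈ Icc (0 : ℝ) 1, m * x ^ (θ / γ) ≤ W t x)
    {a b : ℝ} (hx : x ∈ Ioo (0 : ℝ) 1) (ha : |a| ≤ K * √x) (hb : |b| ≤ B * √x) :
    |c x / W t x ^ ((1 + θ) / θ) * (a * b)| ≤ C₄ / m ^ ((1 + θ) / θ) * (K * B) := by
  have hxI := Ioo_subset_Icc_self hx
  have h3 := hp.weight_le_div hm hx (F.c_upper x hxI) (hW x hxI)
  have h4 : 0 ≤ c x / W t x ^ ((1 + θ) / θ) :=
    div_nonneg (F.c_pos hp.C₃_pos hx).le (Real.rpow_pos_of_pos (W_pos hm hW hx) _).le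
  rw [abs_mul, abs_mul, abs_of_nonneg h4]
  have hs : √x * √x = x := Real.mul_self_sqrt hx.1.le
  have hx0 := hx.1.ne'
  calc c x / W t x ^ ((1 + θ) / θ) * (|a| * |b|)
      ≤ C₄ / m ^ ((1 + θ) / θ) / x * ((K * √x) * (B * √x)) :=
        mul_le_mul h3 (mul_le_mul ha hb (abs_nonneg _) ((abs_nonneg _).trans ha))
          (by positivity) (h4.trans h3)
    _ = C₄ / m ^ ((1 + θ) / θ) * (K * B) * ((√x * √x) / x) := by ring
    _ = _ := by rw [hs, div_self hx0, mul_one]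

theorem flowDissipation_nonneg (F : RegularFlow ρ g f γ α θ C₁ C₂ C₃ C₄ c W S u ux ut H h)
    (hC₃ : 0 < C₃) {t : ℝ} (ht : 0 ≤ t) : 0 ≤ flowDissipation θ c W S u h t := by
  refine add_nonneg (integral_nonneg_of_ae ?_) (integral_nonneg_of_ae ?_)
  · filter_upwards [unitMeasure_ae_mem] with x hx
    have := F.W_nonneg t ht x (Ioo_subset_Icc_self hx)
    have := (F.c_pos hC₃ hx).le
    simp only [Pi.zero_apply]
    positivity
  · filter_upwards [F.h_nonneg t ht] with x hx
    simp only [Pi.zero_apply]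
    positivity

/-- Energy balance: the energy decreases at the rate of the dissipation, as long as `W` is
comparable with the stationary profile. -/
theorem hasDerivAt_flowEnergy (F : RegularFlow ρ g f γ α θ C₁ C₂ C₃ C₄ c W S u ux ut H h)
    (hp : AdmissibleParams ρ g f γ α θ C₁ C₂ C₃ C₄) {m R T : ℝ} (hm : 0 < m) (hR : 0 ≤ R)
    (hW : ∀ t ∈ Icc 0 T, ∀ x ∈ Icc (0 : ℝ) 1,
      m * x ^ (θ / γ) ≤ W t x ∧ W t x ≤ R * x ^ (θ / γ)) {t : ℝ} (ht : t ∈ Ioo 0 T) :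
    HasDerivAt (flowEnergy ρ g γ θ c W u) (-flowDissipation θ c W S u h t) t := by
  have hg := hp.g_pos
  have hρ := hp.ρ_pos
  have hC₄ := hp.C₄_pos
  obtain ⟨K, hK0, hK⟩ := F.exists_flux_sqrt_bound hp hR fun t ht x hx => (hW t ht x hx).2
  obtain ⟨B, hB0, hB⟩ := exists_potential_bound (θ := θ) (R := R) hg hp.one_lt_γ hp.θ_pos hm
  set wt : ℝ → ℝ → ℝ := fun s x => c x / W s x ^ ((1 + θ) / θ) with hwt
  set Pr : ℝ → ℝ → ℝ := fun s x => W s x ^ (γ / θ) - g * x with hPr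
  have hPrb : ∀ s ∈ Icc 0 T, ∀ x ∈ Icc (0 : ℝ) 1, |Pr s x| ≤ (R ^ (γ / θ) + g) * √x := by
    intro s hs x hx
    have h2 : 0 ≤ W s x ^ (γ / θ) := Real.rpow_nonneg (F.W_nonneg s hs.1 x hx) _
    have h3 := F.W_rpow_le hp hR hs.1 hx (hW s hs x hx).2
    have h4 : x ≤ √x := Real.le_sqrt_of_sq_le (by nlinarith [hx.1, hx.2])
    have h5 : R ^ (γ / θ) * x ≤ R ^ (γ / θ) * √x := by gcongr
    have h6 : g * x ≤ g * √x := by gcongr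
    have h7 : 0 ≤ g * x := mul_nonneg hg.le hx.1
    have h8 : 0 ≤ g * √x := by positivity
    have h9 : 0 ≤ R ^ (γ / θ) * √x := by positivity
    simp only [hPr]
    rw [abs_le]
    constructor <;> nlinarith
  have htI := Ioo_subset_Icc_self ht
  have hWt : ∀ x ∈ Icc (0 : ℝ) 1, m * x ^ (θ / γ) ≤ W t x := fun x hx => (hW t htI x hx).1
  have hSm : AEStronglyMeasurable (S t) unitMeasure :=
    aestronglyMeasurable_of_continuousOn_Icc (F.continuousOn_flux hp htI.1)
  have hPm : AEStronglyMeasurable (Pr t) unitMeasure := by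
    have := (F.W_cont t htI.1).measurable
    have : Measurable (Pr t) := by simp only [hPr]; fun_prop
    exact this.aestronglyMeasurable
  have iSS : Integrable (fun x => wt t x * (S t x * S t x)) unitMeasure :=
    integrable_of_bound ((F.weight_meas htI.1).mul (hSm.mul hSm)) (unitMeasure_ae fun x hx =>
      F.dissipation_le hp hm hWt hx (hK t htI x (Ioo_subset_Icc_self hx))
        (hK t htI x (Ioo_subset_Icc_self hx)))
  have iSP : Integrable (fun x => wt t x * (S t x * Pr t x)) unitMeasure :=
    integrable_of_bound ((F.weight_meas htI.1).mul (hSm.mul hPm)) (unitMeasure_ae fun x hx =>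
      F.dissipation_le hp hm hWt hx (hK t htI x (Ioo_subset_Icc_self hx))
        (hPrb t htI x (Ioo_subset_Icc_self hx)))
  -- the kinetic energy
  have hkin : ∫ x, u t x * ut t x ∂unitMeasure = -(∫ x, wt t x * (S t x * S t x) ∂unitMeasure)
      + (∫ x, wt t x * (S t x * Pr t x) ∂unitMeasure)
      - ∫ x, h t x * |u t x| ^ 3 ∂unitMeasure := by
    have h1 := F.integral_u_mul hp hm ht.1 hWt (F.memLp_forcing htI.1)
    have i1 : Integrable (fun x => u t x * ut t x) unitMeasure :=
      (F.u_C1.memLp htI.1).integrable_mul (F.u_C1.memLp_deriv htI.1)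
    have h2 : ∫ x, u t x * (ut t x + H t x) ∂unitMeasure
        = (∫ x, u t x * ut t x ∂unitMeasure) + ∫ x, h t x * |u t x| ^ 3 ∂unitMeasure := by
      rw [← integral_add i1 (F.friction_integrable htI.1)]
      refine integral_congr_ae ?_
      filter_upwards [F.H_eq t htI.1] with x hx
      rw [hx, pow_succ, sq_abs]
      ring
    have h3 : ∫ x, ux t x * (∫ y in (0 : ℝ)..x, (ut t y + H t y)) ∂unitMeasure
        = (∫ x, wt t x * (S t x * S t x) ∂unitMeasure)
          - ∫ x, wt t x * (S t x * Pr t x) ∂unitMeasure := by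
      rw [← integral_sub iSS iSP]
      refine integral_congr_ae ?_
      filter_upwards [F.ux_ae_eq hm htI.1 hWt, unitMeasure_ae_mem] with x h4 h5
      have h6 := F.S_eq t htI.1 x (Ioo_subset_Icc_self h5)
      have h7 : (∫ y in (0 : ℝ)..x, (ut t y + H t y)) = S t x - Pr t x := by
        simp only [hPr]; linarith
      rw [h4, h7]
      simp only [hwt]
      ring
    linarith
  have hdk := (F.u_C1.hasDerivWithinAt_half_integral_sq htI.1).hasDerivAt (Ici_mem_nhds ht.1)
  -- the potential energy
  have hdp := hasDerivAt_integral_of_dominated_loc_of_deriv_le (μ := unitMeasure) (x₀ := t)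
    (s := Ioo 0 T) (F := fun s x => c x * potential g γ θ x (W s x))
    (F' := fun s x => -ρ * (wt s x * (S s x * Pr s x)))
    (bound := fun _ => ρ * (C₄ / m ^ ((1 + θ) / θ) * (K * (R ^ (γ / θ) + g))))
    (Ioo_mem_nhds ht.1 ht.2)
    (by
      filter_upwards [Ioo_mem_nhds ht.1 ht.2] with s hs
      exact (F.c_meas.mul (measurable_potential
        (F.W_cont s hs.1.le).measurable).aemeasurable).aestronglyMeasurable)
    (by
      refine integrable_of_bound (M := C₄ * B) (F.c_meas.mul (measurable_potential
        (F.W_cont t htI.1).measurable).aemeasurable).aestronglyMeasurable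
        (unitMeasure_ae fun x hx => ?_)
      have hxI := Ioo_subset_Icc_self hx
      have h1 : |c x| ≤ C₄ := by
        rw [abs_of_pos (F.c_pos hp.C₃_pos hx)]
        refine (F.c_upper x hxI).trans ?_
        have := Real.rpow_le_one hx.1.le hx.2.le hp.α_nonneg
        nlinarith
      rw [abs_mul]
      exact mul_le_mul h1 (hB x hx _ (hW t htI x hxI).1 (hW t htI x hxI).2) (abs_nonneg _) hC₄.le)
    (iSP.const_mul _).aestronglyMeasurable
    (unitMeasure_ae fun x hx s hs => by
      have hsI := Ioo_subset_Icc_self hs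
      rw [Real.norm_eq_abs, abs_mul, abs_neg, abs_of_pos hρ]
      exact mul_le_mul_of_nonneg_left (F.dissipation_le hp hm (fun y hy => (hW s hsI y hy).1) hx
        (hK s hsI x (Ioo_subset_Icc_self hx)) (hPrb s hsI x (Ioo_subset_Icc_self hx))) hρ.le)
    (integrable_const _)
    (unitMeasure_ae fun x hx s hs => by
      have hsI := Ioo_subset_Icc_self hs
      have hpos : 0 < W s x := W_pos hm (fun y hy => (hW s hsI y hy).1) hx
      have h1 := ((hasDerivAt_potential (g := g) (x := x) hp.one_lt_γ hp.θ_pos hpos).comp s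
        (F.hasDerivAt_W hs.1 (Ioo_subset_Icc_self hx))).const_mul (c x)
      refine h1.congr_deriv ?_
      simp only [hwt, hPr]
      have := (Real.rpow_pos_of_pos hpos ((1 + θ) / θ)).ne'
      have := hp.θ_pos.ne'
      field_simp)
  have hE := hdk.fun_add (hdp.2.div_const ρ)
  refine hE.congr_deriv ?_
  rw [hkin, integral_const_mul]
  have e : ∫ x, c x * S t x ^ 2 / W t x ^ ((1 + θ) / θ) ∂unitMeasure
      = ∫ x, wt t x * (S t x * S t x) ∂unitMeasure := by
    congr 1; ext x; simp only [hwt]; ring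
  unfold flowDissipation
  rw [e]
  field_simp
  ring

theorem continuousOn_flowEnergy (F : RegularFlow ρ g f γ α θ C₁ C₂ C₃ C₄ c W S u ux ut H h)
    (hp : AdmissibleParams ρ g f γ α θ C₁ C₂ C₃ C₄) {m R T : ℝ} (hm : 0 < m)
    (hW : ∀ t ∈ Icc 0 T, ∀ x ∈ Icc (0 : ℝ) 1,
      m * x ^ (θ / γ) ≤ W t x ∧ W t x ≤ R * x ^ (θ / γ)) :
    ContinuousOn (flowEnergy ρ g γ θ c W u) (Icc 0 T) := by
  have hC₄ := hp.C₄_pos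
  obtain ⟨B, hB0, hB⟩ := exists_potential_bound (θ := θ) (R := R) hp.g_pos hp.one_lt_γ hp.θ_pos hm
  intro t ht
  have h1 : ContinuousWithinAt (fun t => (∫ x, u t x ^ 2 ∂unitMeasure) / 2) (Icc 0 T) t :=
    (F.u_C1.hasDerivWithinAt_half_integral_sq ht.1).continuousWithinAt.mono Icc_subset_Ici_self
  refine h1.fun_add (ContinuousWithinAt.div_const ?_ ρ)
  refine continuousWithinAt_of_dominated (bound := fun _ => C₄ * B) ?_ ?_ (integrable_const _) ?_
  · filter_upwards [self_mem_nhdsWithin] with s hs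
    exact (F.c_meas.mul (measurable_potential
        (F.W_cont s hs.1).measurable).aemeasurable).aestronglyMeasurable
  · filter_upwards [self_mem_nhdsWithin] with s hs
    refine unitMeasure_ae fun x hx => ?_
    have hxI := Ioo_subset_Icc_self hx
    have h1 : |c x| ≤ C₄ := by
      rw [abs_of_pos (F.c_pos hp.C₃_pos hx)]
      refine (F.c_upper x hxI).trans ?_
      have := Real.rpow_le_one hx.1.le hx.2.le hp.α_nonneg
      nlinarith
    rw [Real.norm_eq_abs, abs_mul]
    exact mul_le_mul h1 (hB x hx _ (hW s hs x hxI).1 (hW s hs x hxI).2) (abs_nonneg _) hC₄.le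
  · refine unitMeasure_ae fun x hx => ?_
    have hxI := Ioo_subset_Icc_self hx
    have hpos : 0 < W t x := W_pos hm (fun y hy => (hW t ht y hy).1) hx
    have h2 := (hasDerivAt_potential (g := g) (x := x) hp.one_lt_γ hp.θ_pos hpos).continuousAt
    exact continuousWithinAt_const.mul (h2.comp_continuousWithinAt
      (f := fun s => W s x) ((F.continuousOn_W_time hxI t ht.1).mono Icc_subset_Ici_self))

/-- The kinetic energy is at most the total energy. -/
theorem integral_sq_le_flowEnergy (F : RegularFlow ρ g f γ α θ C₁ C₂ C₃ C₄ c W S u ux ut H h)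
    (hp : AdmissibleParams ρ g f γ α θ C₁ C₂ C₃ C₄) {m t : ℝ} (hm : 0 < m)
    (hW : ∀ x ∈ Icc (0 : ℝ) 1, m * x ^ (θ / γ) ≤ W t x) :
    (∫ x, u t x ^ 2 ∂unitMeasure) / 2 ≤ flowEnergy ρ g γ θ c W u t := by
  refine le_add_of_nonneg_right (div_nonneg (integral_nonneg_of_ae ?_) hp.ρ_pos.le)
  exact unitMeasure_ae fun x hx => mul_nonneg (F.c_pos hp.C₃_pos hx).le
    (potential_nonneg hp.g_pos hp.one_lt_γ hp.θ_pos (W_pos hm hW hx) hx.1)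

end RegularFlow

/-! ### Barriers and the friction force -/

/-- If `y` decreases at rate at least `k ≥ 0` whenever it exceeds the level `L`, then it stays below
`L` once it got there, and it gets there at rate `k`. -/
theorem le_max_of_deriv_le_above {y y' : ℝ → ℝ} {a b L k : ℝ} (hab : a ≤ b) (hk : 0 ≤ k)
    (hc : ContinuousOn y (Icc a b)) (hd : ∀ t ∈ Ioo a b, HasDerivAt y (y' t) t)
    (hy : ∀ t ∈ Ioo a b, L < y t → y' t ≤ -k) : y b ≤ max L (y a - k * (b - a)) := by
  by_contra! hcon
  obtain ⟨hL, hya⟩ := max_lt_iff.1 hcon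
  have key : ∀ s ∈ Icc a b, (∀ t ∈ Ioo s b, L < y t) → y b ≤ y s - k * (b - s) := by
    intro s hs hsL
    have hanti : AntitoneOn (fun t => y t + k * t) (Icc s b) := by
      refine antitoneOn_of_hasDerivWithinAt_nonpos (convex_Icc s b) (f' := fun t => y' t + k) ?_ ?_ ?_
      · exact (hc.mono (Icc_subset_Icc_left hs.1)).add (by fun_prop)
      · intro t ht
        rw [interior_Icc] at ht
        have h1 : HasDerivAt (fun t => y t + k * t) (y' t + k * 1) t :=
          (hd t ⟨hs.1.trans_lt ht.1, ht.2⟩).fun_add ((hasDerivAt_id t).const_mul k)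
        rw [mul_one] at h1
        exact h1.hasDerivWithinAt
      · intro t ht
        rw [interior_Icc] at ht
        linarith [hy t ⟨hs.1.trans_lt ht.1, ht.2⟩ (hsL t ht)]
    have := hanti ⟨le_rfl, hs.2⟩ ⟨hs.2, le_rfl⟩ hs.2
    simp only at this
    linarith
  by_cases hex : ∃ s ∈ Icc a b, y s ≤ L
  · have hcl : IsCompact (Icc a b ∩ y ⁻¹' Iic L) :=
      isCompact_Icc.of_isClosed_subset (hc.preimage_isClosed_of_isClosed isClosed_Icc isClosed_Iic)
        inter_subset_left
    obtain ⟨s, hs⟩ := hcl.exists_isGreatest (hex.imp fun s hs => ⟨hs.1, hs.2⟩)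
    have h1 := key s hs.1.1 fun t ht => by
      by_contra! hle
      exact absurd (hs.2 ⟨⟨hs.1.1.1.trans ht.1.le, ht.2.le⟩, hle⟩) (not_le.2 ht.1)
    have h2 : y s ≤ L := hs.1.2
    have h3 : 0 ≤ k * (b - s) := mul_nonneg hk (sub_nonneg.2 hs.1.1.2)
    linarith
  · push Not at hex
    have h1 := key a ⟨le_rfl, hab⟩ fun t ht => hex t (Ioo_subset_Icc_self ht)
    linarith

namespace RegularFlow

variable {ρ g f γ α θ C₁ C₂ C₃ C₄ : ℝ} {c : ℝ → ℝ} {W S u ux ut H h : ℝ → ℝ → ℝ}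

/-- The impulse `∫₀ˣ H` of the friction force is controlled by the dissipation, up to a small
multiple of the weight `g x`. -/
theorem abs_force_primitive_le (F : RegularFlow ρ g f γ α θ C₁ C₂ C₃ C₄ c W S u ux ut H h)
    (hp : AdmissibleParams ρ g f γ α θ C₁ C₂ C₃ C₄) {R A t x : ℝ} (hR : 0 ≤ R) (hA : 0 < A)
    (ht : 0 ≤ t) (hW : ∀ x ∈ Icc (0 : ℝ) 1, W t x ≤ R * x ^ (θ / γ)) (hx : x ∈ Ioc (0 : ℝ) 1) :
    |∫ y in (0 : ℝ)..x, H t y| ≤ A * x ^ (1 / γ - α) * flowDissipation θ c W S u h t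
      + f * ρ ^ 2 * (R ^ (1 / θ) / C₃) ^ 2 / A ^ 2 * x := by
  have hC₃ := hp.C₃_pos
  have hf := hp.f_nonneg
  have hκ : 0 ≤ 1 / γ - α := by linarith [hp.α_lt]
  set X := x ^ (1 / γ - α) with hX
  have hX0 : 0 < X := Real.rpow_pos_of_pos hx.1 _
  set Ch := f * ρ ^ 2 * (R ^ (1 / θ) / C₃) ^ 2 with hCh
  have hsub : Ioc 0 x ⊆ Ioc 0 1 := Ioc_subset_Ioc_right hx.2
  have hres : unitMeasure = volume.restrict (Ioc (0 : ℝ) 1) :=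
    Measure.restrict_congr_set Ioo_ae_eq_Ioc
  have hae : ∀ {P : ℝ → Prop}, (∀ᵐ y ∂unitMeasure, P y) → ∀ᵐ y ∂(volume.restrict (Ioc 0 x)), P y := by
    intro P hP
    rw [hres] at hP
    exact ae_restrict_of_ae_restrict_of_subset hsub hP
  have hfi : IntegrableOn (fun y => h t y * |u t y| ^ 3) (Ioc 0 1) := by
    have := F.friction_integrable ht
    rwa [hres] at this
  have hbound : ∀ᵐ y ∂(volume.restrict (Ioc 0 x)),
      ‖H t y‖ ≤ A * X * (h t y * |u t y| ^ 3) + Ch / A ^ 2 := by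
    filter_upwards [hae (F.H_eq t ht), hae (F.h_nonneg t ht), hae (F.h_le_sq t ht),
      hae unitMeasure_ae_mem, ae_restrict_mem measurableSet_Ioc] with y h1 h2 h3 h4 h5
    have hyI := Ioo_subset_Icc_self h4
    have hyα : 0 < y ^ α := Real.rpow_pos_of_pos h4.1 _
    have hc := F.c_lower y hyI
    have hc0 : 0 < C₃ * y ^ α := by positivity
    have hW0 := F.W_nonneg t ht y hyI
    have e1 : W t y ^ (1 / θ) ≤ R ^ (1 / θ) * y ^ (1 / γ) := by
      have e : y ^ (1 / γ) = (y ^ (θ / γ)) ^ (1 / θ) := by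
        rw [← Real.rpow_mul h4.1.le]
        congr 1
        have := hp.θ_pos.ne'
        field_simp
      rw [e, ← Real.mul_rpow hR (Real.rpow_nonneg h4.1.le _)]
      exact Real.rpow_le_rpow hW0 (hW y hyI) (by have := hp.θ_pos; positivity)
    have e2 : W t y ^ (1 / θ) / c y ≤ R ^ (1 / θ) / C₃ * X := by
      have h6 : y ^ (1 / γ - α) ≤ X := Real.rpow_le_rpow h4.1.le h5.2 hκ
      calc W t y ^ (1 / θ) / c y ≤ (R ^ (1 / θ) * y ^ (1 / γ)) / (C₃ * y ^ α) :=
            div_le_div₀ (mul_nonneg (Real.rpow_nonneg hR _) (Real.rpow_nonneg h4.1.le _)) e1 hc0 hc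
        _ = R ^ (1 / θ) / C₃ * y ^ (1 / γ - α) := by rw [Real.rpow_sub h4.1]; field_simp
        _ ≤ _ := by gcongr
    have e3 : 0 ≤ W t y ^ (1 / θ) / c y := div_nonneg (Real.rpow_nonneg hW0 _) (hc0.le.trans hc)
    have e4 : h t y ≤ Ch * X ^ 2 := by
      refine h3.trans ?_
      have : (W t y ^ (1 / θ) / c y) ^ 2 ≤ (R ^ (1 / θ) / C₃ * X) ^ 2 := by gcongr
      calc _ ≤ f * ρ ^ 2 * (R ^ (1 / θ) / C₃ * X) ^ 2 := by gcongr
        _ = _ := by rw [hCh]; ring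
    have e5 : ‖H t y‖ = h t y * |u t y| ^ 2 := by
      rw [h1, Real.norm_eq_abs, abs_mul, abs_mul, abs_abs, abs_of_nonneg h2]; ring
    rw [e5]
    set v := |u t y| with hv
    have hv0 : 0 ≤ v := abs_nonneg _
    -- if `A X |u| ≥ 1`, the cubic dissipation dominates; otherwise `h ≤ Ch X²` bounds it
    rcases le_total 1 (A * X * v) with h7 | h7
    · have : h t y * v ^ 2 ≤ A * X * (h t y * v ^ 3) := by
        have h8 : 0 ≤ h t y * v ^ 2 := by positivity
        nlinarith
      have h9 : 0 ≤ Ch / A ^ 2 := by positivity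
      linarith
    · have h8 : 0 ≤ A * X * (h t y * v ^ 3) := by positivity
      have h9 : X ^ 2 * v ^ 2 ≤ 1 / A ^ 2 := by
        rw [le_div_iff₀ (by positivity)]
        have : (A * X * v) ^ 2 ≤ 1 := pow_le_one₀ (by positivity) h7
        nlinarith
      have h10 : h t y * v ^ 2 ≤ Ch / A ^ 2 := by
        calc h t y * v ^ 2 ≤ Ch * X ^ 2 * v ^ 2 := by gcongr
          _ = Ch * (X ^ 2 * v ^ 2) := by ring
          _ ≤ Ch * (1 / A ^ 2) := by
            refine mul_le_mul_of_nonneg_left h9 ?_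
            positivity
          _ = _ := by ring
      linarith
  have hgi : IntegrableOn (fun y => A * X * (h t y * |u t y| ^ 3) + Ch / A ^ 2) (Ioc 0 x) :=
    ((hfi.mono_set hsub).const_mul _).add (by simp)
  rw [intervalIntegral.integral_of_le hx.1.le]
  refine (norm_integral_le_of_norm_le hgi hbound).trans ?_
  rw [integral_add ((hfi.mono_set hsub).const_mul _) (by simp), integral_const_mul]
  have h1 : ∫ y in Ioc 0 x, h t y * |u t y| ^ 3 ≤ flowDissipation θ c W S u h t := by
    have h2 : ∫ y in Ioc 0 x, h t y * |u t y| ^ 3 ≤ ∫ y in Ioc 0 1, h t y * |u t y| ^ 3 := by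
      refine setIntegral_mono_set hfi ?_ hsub.eventuallyLE
      rw [← hres]
      filter_upwards [F.h_nonneg t ht] with y hy
      simp only [Pi.zero_apply]
      positivity
    rw [← hres] at h2
    refine h2.trans (le_add_of_nonneg_left (integral_nonneg_of_ae ?_))
    filter_upwards [unitMeasure_ae_mem] with y hy
    have := F.W_nonneg t ht y (Ioo_subset_Icc_self hy)
    have := (F.c_pos hC₃ hy).le
    simp only [Pi.zero_apply]
    positivity
  refine add_le_add (mul_le_mul_of_nonneg_left h1 (by positivity)) ?_
  simp [hx.1.le]
  linarith

/-- `W + θ ρ ∫₀ˣ u` obeys an equation without the acceleration term. -/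
theorem hasDerivWithinAt_W_add (F : RegularFlow ρ g f γ α θ C₁ C₂ C₃ C₄ c W S u ux ut H h)
    {t x : ℝ} (ht : 0 ≤ t) (hx : x ∈ Icc (0 : ℝ) 1) :
    HasDerivWithinAt (fun s => W s x + θ * ρ * ∫ y in (0 : ℝ)..x, u s y)
      (-(θ * ρ) * (W t x ^ (γ / θ) - g * x + ∫ y in (0 : ℝ)..x, H t y)) (Ici 0) t := by
  have h1 := (F.W_ode t ht x hx).fun_add
    ((F.u_C1.hasDerivWithinAt_primitive hx ht).const_mul (θ * ρ))
  refine h1.congr_deriv ?_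
  rw [F.S_eq t ht x hx, intervalIntegral.integral_add
    (intervalIntegrable_sub_zero (F.u_C1.integrable_deriv ht) hx)
    (intervalIntegrable_sub_zero ((F.memLp_force ht).integrable (by norm_num)) hx)]
  ring

theorem abs_u_primitive_le (F : RegularFlow ρ g f γ α θ C₁ C₂ C₃ C₄ c W S u ux ut H h)
    (hp : AdmissibleParams ρ g f γ α θ C₁ C₂ C₃ C₄) {t x : ℝ} (ht : 0 ≤ t)
    (hx : x ∈ Icc (0 : ℝ) 1) :
    |∫ y in (0 : ℝ)..x, u t y| ≤ √(∫ y, u t y ^ 2 ∂unitMeasure) * x ^ (θ / γ) :=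
  (abs_primitive_le (F.u_C1.memLp ht) hx).trans
    (mul_le_mul_of_nonneg_left (hp.sqrt_le_rpow_β hx) (Real.sqrt_nonneg _))

end RegularFlow

/-! ### Global bounds on `(c Q)^θ` -/

namespace RegularFlow

variable {ρ g f γ α θ C₁ C₂ C₃ C₄ : ℝ} {c : ℝ → ℝ} {W S u ux ut H h : ℝ → ℝ → ℝ}

theorem antitoneOn_flowEnergy (F : RegularFlow ρ g f γ α θ C₁ C₂ C₃ C₄ c W S u ux ut H h)
    (hp : AdmissibleParams ρ g f γ α θ C₁ C₂ C₃ C₄) {m R T : ℝ} (hm : 0 < m) (hR : 0 ≤ R)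
    (hW : ∀ t ∈ Icc 0 T, ∀ x ∈ Icc (0 : ℝ) 1,
      m * x ^ (θ / γ) ≤ W t x ∧ W t x ≤ R * x ^ (θ / γ)) :
    AntitoneOn (flowEnergy ρ g γ θ c W u) (Icc 0 T) := by
  refine antitoneOn_of_hasDerivWithinAt_nonpos (convex_Icc 0 T)
    (f' := fun t => -flowDissipation θ c W S u h t) (F.continuousOn_flowEnergy hp hm hW) ?_ ?_
  · intro t ht
    rw [interior_Icc] at ht
    exact (F.hasDerivAt_flowEnergy hp hm hR hW ht).hasDerivWithinAt
  · intro t ht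
    rw [interior_Icc] at ht
    linarith [F.flowDissipation_nonneg hp.C₃_pos ht.1.le]

/-- A priori bounds: as long as `W` stays within a factor four of the levels `m` and `R`, it stays
within a factor two, if the initial energy is small. The barriers are built from
`W + θ ρ ∫₀ˣ u ± θ ρ A x^{1/γ-α} E`, in whose time derivative the dissipation in `E'` absorbs the
friction force. -/
theorem improved_bounds (F : RegularFlow ρ g f γ α θ C₁ C₂ C₃ C₄ c W S u ux ut H h)
    (hp : AdmissibleParams ρ g f γ α θ C₁ C₂ C₃ C₄) {m R A E₀ T : ℝ} (hm : 0 < m) (hmR : m ≤ R)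
    (hmC : m ≤ C₁ ^ θ) (hmg : m ^ (γ / θ) ≤ g / 2) (hRC : C₂ ^ θ ≤ R) (hRg : 2 * g ≤ R ^ (γ / θ))
    (hA : 0 < A) (hAg : f * ρ ^ 2 * ((4 * R) ^ (1 / θ) / C₃) ^ 2 / A ^ 2 ≤ g / 2)
    (hE₀ : flowEnergy ρ g γ θ c W u 0 ≤ E₀)
    (hsmall : θ * ρ * (√(2 * E₀) + A * E₀) ≤ m / 4)
    (hW : ∀ t ∈ Icc 0 T, ∀ x ∈ Icc (0 : ℝ) 1,
      m / 4 * x ^ (θ / γ) ≤ W t x ∧ W t x ≤ 4 * R * x ^ (θ / γ)) :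
    ∀ t ∈ Icc 0 T, ∀ x ∈ Icc (0 : ℝ) 1,
      m / 2 * x ^ (θ / γ) ≤ W t x ∧ W t x ≤ 2 * R * x ^ (θ / γ) := by
  intro t ht x hx
  have hR0 : 0 < R := hm.trans_le hmR
  have hg := hp.g_pos
  have hlam : 0 < θ * ρ := mul_pos hp.θ_pos hp.ρ_pos
  rcases hx.1.eq_or_lt with rfl | hx0
  · have h1 := hW t ht 0 hx
    rw [Real.zero_rpow hp.β_pos.ne'] at h1 ⊢
    constructor <;> linarith [h1.1, h1.2]
  have hm4 : 0 < m / 4 := by positivity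
  have hR4 : 0 ≤ 4 * R := by positivity
  have hxI : x ∈ Ioc (0 : ℝ) 1 := ⟨hx0, hx.2⟩
  set X := x ^ (θ / γ) with hX
  have hX0 : 0 < X := Real.rpow_pos_of_pos hx0 _
  set Y := x ^ (1 / γ - α) with hY
  have hY0 : 0 < Y := Real.rpow_pos_of_pos hx0 _
  have hYX : Y ≤ X := Real.rpow_le_rpow_of_exponent_ge hx0 hx.2 hp.β_le_κ
  set E := flowEnergy ρ g γ θ c W u with hE
  set D := flowDissipation θ c W S u h with hD
  set U : ℝ → ℝ := fun s => ∫ y in (0 : ℝ)..x, u s y with hU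
  have hEle : ∀ s ∈ Icc 0 T, E s ≤ E₀ := fun s hs =>
    (F.antitoneOn_flowEnergy hp hm4 hR4 hW ⟨le_rfl, hs.1.trans hs.2⟩ hs hs.1).trans hE₀
  have hkin : ∀ s ∈ Icc 0 T, (∫ y, u s y ^ 2 ∂unitMeasure) / 2 ≤ E s := fun s hs =>
    F.integral_sq_le_flowEnergy hp hm4 fun x hx => (hW s hs x hx).1
  have hE0 : ∀ s ∈ Icc 0 T, 0 ≤ E s := fun s hs =>
    le_trans (div_nonneg (integral_nonneg fun y => sq_nonneg _) two_pos.le) (hkin s hs)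
  have hUb : ∀ s ∈ Icc 0 T, |U s| ≤ √(2 * E₀) * X := fun s hs => by
    refine (F.abs_u_primitive_le hp hs.1 hx).trans (mul_le_mul_of_nonneg_right ?_ hX0.le)
    exact Real.sqrt_le_sqrt (by linarith [hkin s hs, hEle s hs])
  have hEb : ∀ s ∈ Icc 0 T, A * Y * E s ≤ A * E₀ * X := fun s hs => by
    calc A * Y * E s ≤ A * X * E₀ := by
          have h1 := hEle s hs
          have h2 := hE0 s hs
          gcongr
      _ = _ := by ring
  have hEb0 : ∀ s ∈ Icc 0 T, 0 ≤ A * Y * E s := fun s hs => by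
    have := hE0 s hs
    positivity
  set d := θ * ρ * (√(2 * E₀) + A * E₀) with hd
  have hcE : ContinuousOn E (Icc 0 T) := F.continuousOn_flowEnergy hp hm4 hW
  have hdE : ∀ s ∈ Ioo 0 T, HasDerivAt E (-D s) s := fun s hs =>
    F.hasDerivAt_flowEnergy hp hm4 hR4 hW hs
  have hdZ : ∀ s, 0 ≤ s → HasDerivWithinAt (fun s => W s x + θ * ρ * U s)
      (-(θ * ρ) * (W s x ^ (γ / θ) - g * x + ∫ y in (0 : ℝ)..x, H s y)) (Ici 0) s :=
    fun s hs => F.hasDerivWithinAt_W_add hs hx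
  have hcZ : ContinuousOn (fun s => W s x + θ * ρ * U s) (Icc 0 T) := fun s hs =>
    (hdZ s hs.1).continuousWithinAt.mono Icc_subset_Ici_self
  have hF : ∀ s ∈ Icc 0 T, |∫ y in (0 : ℝ)..x, H s y| ≤ A * Y * D s + g / 2 * x := fun s hs =>
    (F.abs_force_primitive_le hp hR4 hA hs.1 (fun x hx => (hW s hs x hx).2) hxI).trans
      (by have := mul_le_mul_of_nonneg_right hAg hx0.le
          linarith)
  have h0 : (0 : ℝ) ∈ Icc 0 T := ⟨le_rfl, ht.1.trans ht.2⟩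
  have hsub : Icc 0 t ⊆ Icc 0 T := Icc_subset_Icc_right ht.2
  have hsub' : Ioo 0 t ⊆ Ioo 0 T := Ioo_subset_Ioo_right ht.2
  have hdX : d * X = θ * ρ * (√(2 * E₀) * X) + θ * ρ * (A * E₀ * X) := by rw [hd]; ring
  have hdm : d * X ≤ m / 4 * X := mul_le_mul_of_nonneg_right hsmall hX0.le
  have hUl : ∀ s ∈ Icc 0 T, |θ * ρ * U s| ≤ θ * ρ * (√(2 * E₀) * X) := fun s hs => by
    rw [abs_mul, abs_of_pos hlam]
    exact mul_le_mul_of_nonneg_left (hUb s hs) hlam.le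
  have hEl : ∀ s ∈ Icc 0 T, θ * ρ * (A * Y * E s) ≤ θ * ρ * (A * E₀ * X) := fun s hs =>
    mul_le_mul_of_nonneg_left (hEb s hs) hlam.le
  have hEl0 : ∀ s ∈ Icc 0 T, 0 ≤ θ * ρ * (A * Y * E s) := fun s hs =>
    mul_nonneg hlam.le (hEb0 s hs)
  have hinit := F.W_init x hx
  have hmX : m * X ≤ C₁ ^ θ * X := mul_le_mul_of_nonneg_right hmC hX0.le
  have hRX : C₂ ^ θ * X ≤ R * X := mul_le_mul_of_nonneg_right hRC hX0.le
  have hmRX : m * X ≤ R * X := mul_le_mul_of_nonneg_right hmR hX0.le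
  constructor
  · -- the lower barrier
    have hb := le_max_of_deriv_le_above (y := fun s => -((W s x + θ * ρ * U s)
        - θ * ρ * A * Y * E s)) (y' := fun s => -(-(θ * ρ) * (W s x ^ (γ / θ) - g * x
        + ∫ y in (0 : ℝ)..x, H s y) - θ * ρ * A * Y * (-D s)))
      (L := -(m * X - d * X)) (k := 0) ht.1 le_rfl
      (((hcZ.mono hsub).sub ((hcE.mono hsub).const_mul _)).neg)
      (fun s hs => (((hdZ s hs.1.le).hasDerivAt (Ici_mem_nhds hs.1)).fun_sub
        ((hdE s (hsub' hs)).const_mul _)).fun_neg) (fun s hs hlt => by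
        have hsT := hsub (Ioo_subset_Icc_self hs)
        have h1 := abs_le.1 (hUl s hsT)
        have h2 : W s x ≤ m * X := by linarith [hEl s hsT, h1.1, h1.2]
        have h3 := F.W_rpow_le hp hm.le hs.1.le hx h2
        have h4 := (abs_le.1 (hF s hsT)).2
        have h5 : m ^ (γ / θ) * x ≤ g / 2 * x := mul_le_mul_of_nonneg_right hmg hx0.le
        have h6 : W s x ^ (γ / θ) - g * x + (∫ y in (0 : ℝ)..x, H s y) - A * Y * D s ≤ 0 := by
          linarith
        have h8 := mul_le_mul_of_nonneg_left h6 hlam.le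
        linarith)
    have hle : -((W 0 x + θ * ρ * U 0) - θ * ρ * A * Y * E 0) ≤ -(m * X - d * X) := by
      have h1 := abs_le.1 (hUl 0 h0)
      linarith [hEl 0 h0, h1.1, h1.2, hinit.1, hinit.2]
    simp only [zero_mul, sub_zero, max_eq_left hle] at hb
    have h1 := abs_le.1 (hUl t ht)
    linarith [hEl0 t ht, h1.1, h1.2, hEl t ht, hEl0 t ht]
  · -- the upper barrier
    have hb := le_max_of_deriv_le_above (y := fun s => (W s x + θ * ρ * U s)
        + θ * ρ * A * Y * E s) (y' := fun s => -(θ * ρ) * (W s x ^ (γ / θ) - g * x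
        + ∫ y in (0 : ℝ)..x, H s y) + θ * ρ * A * Y * (-D s))
      (L := R * X + d * X) (k := 0) ht.1 le_rfl
      ((hcZ.mono hsub).add ((hcE.mono hsub).const_mul _))
      (fun s hs => ((hdZ s hs.1.le).hasDerivAt (Ici_mem_nhds hs.1)).fun_add
        ((hdE s (hsub' hs)).const_mul _)) (fun s hs hlt => by
        have hsT := hsub (Ioo_subset_Icc_self hs)
        have h1 := abs_le.1 (hUl s hsT)
        have h2 : R * X ≤ W s x := by linarith [hEl s hsT, h1.1, h1.2]
        have h3 : R ^ (γ / θ) * x ≤ W s x ^ (γ / θ) := by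
          rw [← hp.profile_rpow_p hR0.le hx.1]
          exact Real.rpow_le_rpow (by positivity) h2 hp.p_pos.le
        have h4 := (abs_le.1 (hF s hsT)).1
        have h5 : 2 * g * x ≤ R ^ (γ / θ) * x := mul_le_mul_of_nonneg_right hRg hx0.le
        have h7 : 0 ≤ g * x := by positivity
        have h6 : 0 ≤ W s x ^ (γ / θ) - g * x + (∫ y in (0 : ℝ)..x, H s y) + A * Y * D s := by
          linarith
        have h8 := mul_le_mul_of_nonneg_left h6 hlam.le
        linarith)
    have hle : (W 0 x + θ * ρ * U 0) + θ * ρ * A * Y * E 0 ≤ R * X + d * X := by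
      have h1 := abs_le.1 (hUl 0 h0)
      linarith [hEl 0 h0, h1.1, h1.2, hinit.1, hinit.2]
    simp only [zero_mul, sub_zero, max_eq_left hle] at hb
    have h1 := abs_le.1 (hUl t ht)
    linarith [hEl0 t ht, h1.1, h1.2, hEl t ht, hEl0 t ht]

/-- Global bounds: `W` stays comparable with the stationary profile for all times. The set of times
up to which the bounds hold is closed, and it is open to the right by `improved_bounds`. -/
theorem global_bounds (F : RegularFlow ρ g f γ α θ C₁ C₂ C₃ C₄ c W S u ux ut H h)
    (hp : AdmissibleParams ρ g f γ α θ C₁ C₂ C₃ C₄) {m R A E₀ : ℝ} (hm : 0 < m) (hmR : m ≤ R)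
    (hmC : m ≤ C₁ ^ θ) (hmg : m ^ (γ / θ) ≤ g / 2) (hRC : C₂ ^ θ ≤ R) (hRg : 2 * g ≤ R ^ (γ / θ))
    (hA : 0 < A) (hAg : f * ρ ^ 2 * ((4 * R) ^ (1 / θ) / C₃) ^ 2 / A ^ 2 ≤ g / 2)
    (hE₀ : flowEnergy ρ g γ θ c W u 0 ≤ E₀)
    (hsmall : θ * ρ * (√(2 * E₀) + A * E₀) ≤ m / 4) :
    ∀ t, 0 ≤ t → ∀ x ∈ Icc (0 : ℝ) 1,
      m / 4 * x ^ (θ / γ) ≤ W t x ∧ W t x ≤ 4 * R * x ^ (θ / γ) := by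
  intro T hT
  have hR0 : 0 < R := hm.trans_le hmR
  set s : Set ℝ := {t | ∀ x ∈ Icc (0 : ℝ) 1,
    m / 4 * x ^ (θ / γ) ≤ W t x ∧ W t x ≤ 4 * R * x ^ (θ / γ)} with hs
  suffices Icc 0 T ⊆ s from this ⟨hT, le_rfl⟩
  refine IsClosed.Icc_subset_of_forall_mem_nhdsGT_of_Icc_subset ?_ ?_ ?_
  · have e : s ∩ Icc 0 T = Icc 0 T ∩ ⋂ x ∈ Icc (0 : ℝ) 1,
        (Icc 0 T ∩ (fun t => W t x) ⁻¹' Icc (m / 4 * x ^ (θ / γ)) (4 * R * x ^ (θ / γ))) := by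
      ext t
      simp only [hs, mem_inter_iff, mem_ofPred_eq, mem_iInter, mem_preimage, mem_Icc]
      exact ⟨fun h1 => ⟨h1.2, fun x hx => ⟨h1.2, h1.1 x hx⟩⟩,
        fun h1 => ⟨fun x hx => (h1.2 x hx).2, h1.1⟩⟩
    rw [e]
    exact isClosed_Icc.inter (isClosed_biInter fun x hx =>
      ((F.continuousOn_W_time hx).mono Icc_subset_Ici_self).preimage_isClosed_of_isClosed
        isClosed_Icc isClosed_Icc)
  · intro x hx
    have hX0 : 0 ≤ x ^ (θ / γ) := Real.rpow_nonneg hx.1 _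
    have h1 := F.W_init x hx
    constructor <;> nlinarith [h1.1, h1.2]
  -- the improved bounds at `t` leave room for a short time, by the Lipschitz estimate
  · intro t ht hsub
    have himp := F.improved_bounds hp hm hmR hmC hmg hRC hRg hA hAg hE₀ hsmall
      (fun τ hτ x hx => hsub hτ x hx) t ⟨ht.1, le_rfl⟩
    obtain ⟨L, hL0, hL⟩ := F.exists_W_lipschitz hp (t + 1)
    have hr : 0 < min 1 (m / 4 / (L + 1)) := lt_min one_pos (by positivity)
    refine mem_of_superset (Ioo_mem_nhdsGT (lt_add_of_pos_right t hr)) fun τ hτ x hx => ?_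
    have hX0 : 0 ≤ x ^ (θ / γ) := Real.rpow_nonneg hx.1 _
    have h1 : τ - t < 1 := by linarith [hτ.2, min_le_left 1 (m / 4 / (L + 1))]
    have h2 : τ - t ≤ m / 4 / (L + 1) := by linarith [hτ.2, min_le_right 1 (m / 4 / (L + 1))]
    rw [le_div_iff₀ (by positivity)] at h2
    have h3 := hL t ⟨ht.1, by linarith⟩ τ ⟨ht.1.trans hτ.1.le, by linarith⟩ x hx
    rw [abs_of_pos (sub_pos.2 hτ.1)] at h3
    have h4 : L * (τ - t) ≤ m / 4 := by nlinarith [hτ.1]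
    have h5 : L * x ^ (θ / γ) * (τ - t) ≤ m / 4 * x ^ (θ / γ) := by nlinarith
    have h6 := abs_le.1 (h3.trans h5)
    have h7 := himp x hx
    constructor <;> nlinarith [h6.1, h6.2, h7.1, h7.2]

end RegularFlow

/-! ### Small data -/

/-- The initial energy is controlled by the norms of the data in the smallness assumption. -/
theorem exists_initial_energy_le {ρ g f γ α θ C₁ C₂ C₃ C₄ : ℝ}
    (hp : AdmissibleParams ρ g f γ α θ C₁ C₂ C₃ C₄) :
    ∃ C, 0 ≤ C ∧ ∀ (c : ℝ → ℝ) (W S u ux ut H h : ℝ → ℝ → ℝ),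
      RegularFlow ρ g f γ α θ C₁ C₂ C₃ C₄ c W S u ux ut H h →
      flowEnergy ρ g γ θ c W u 0 ≤ (∫ x, u 0 x ^ 2 ∂unitMeasure) / 2
        + C * ∫ x, x ^ (1 - 3 / γ) * (W 0 x ^ (1 / θ) - cQInfty g γ x) ^ 2 ∂unitMeasure := by
  have hg := hp.g_pos
  have hγ0 := hp.γ_pos
  have hθ := hp.θ_pos
  have hC₄ := hp.C₄_pos
  have hρ := hp.ρ_pos
  have hC₂ := hp.C₂_pos
  have hC₁ := hp.C₁_pos
  obtain ⟨C, hC0, hC⟩ := exists_potential_le (C₂ := C₂) hg hp.one_lt_γ hθ hC₁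
  refine ⟨C₄ * C / ρ, by positivity, fun c W S u ux ut H h F => ?_⟩
  unfold flowEnergy
  have hprof : ∀ r : ℝ, 0 ≤ r → ∀ x : ℝ, 0 ≤ x → (r ^ θ * x ^ (θ / γ)) ^ (1 / θ) = r * x ^ (1 / γ) := by
    intro r hr x hx
    rw [Real.mul_rpow (Real.rpow_nonneg hr _) (Real.rpow_nonneg hx _), ← Real.rpow_mul hr,
      ← Real.rpow_mul hx, mul_one_div_cancel hθ.ne', Real.rpow_one]
    congr 2
    field_simp
  have hW1 : ∀ x ∈ Icc (0 : ℝ) 1, C₁ * x ^ (1 / γ) ≤ W 0 x ^ (1 / θ) := fun x hx => by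
    rw [← hprof C₁ hC₁.le x hx.1]
    have := Real.rpow_nonneg hx.1 (θ / γ)
    exact Real.rpow_le_rpow (by positivity) (F.W_init x hx).1 (by positivity)
  have hW2 : ∀ x ∈ Icc (0 : ℝ) 1, W 0 x ^ (1 / θ) ≤ C₂ * x ^ (1 / γ) := fun x hx => by
    rw [← hprof C₂ hC₂.le x hx.1]
    exact Real.rpow_le_rpow (F.W_nonneg 0 le_rfl x hx) (F.W_init x hx).2 (by positivity)
  have hWpos : ∀ x ∈ Ioo (0 : ℝ) 1, 0 < W 0 x := fun x hx =>
    (mul_pos (Real.rpow_pos_of_pos hC₁ _) (Real.rpow_pos_of_pos hx.1 _)).trans_le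
      (F.W_init x (Ioo_subset_Icc_self hx)).1
  have hi : Integrable (fun x => x ^ (1 - 3 / γ) * (W 0 x ^ (1 / θ) - cQInfty g γ x) ^ 2)
      unitMeasure := by
    have hWm := (F.W_cont 0 le_rfl).measurable
    have hm : Measurable (fun x => x ^ (1 - 3 / γ) * (W 0 x ^ (1 / θ) - cQInfty g γ x) ^ 2) := by
      unfold cQInfty
      fun_prop
    refine integrable_of_bound (M := (C₂ + g ^ (1 / γ)) ^ 2) hm.aestronglyMeasurable
      (unitMeasure_ae fun x hx => ?_)
    have hxI := Ioo_subset_Icc_self hx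
    have hX : 0 < x ^ (1 / γ) := Real.rpow_pos_of_pos hx.1 _
    have hG : 0 < g ^ (1 / γ) := Real.rpow_pos_of_pos hg _
    have h1 : |W 0 x ^ (1 / θ) - cQInfty g γ x| ≤ (C₂ + g ^ (1 / γ)) * x ^ (1 / γ) := by
      unfold cQInfty
      rw [Real.mul_rpow hg.le hx.1.le, abs_le]
      have h2 := hW1 x hxI
      have h3 := hW2 x hxI
      have h4 : 0 < C₁ * x ^ (1 / γ) := by positivity
      have h5 : 0 < C₂ * x ^ (1 / γ) := by positivity
      have h6 : 0 < g ^ (1 / γ) * x ^ (1 / γ) := by positivity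
      constructor <;> nlinarith
    have h2 : 0 < x ^ (1 - 3 / γ) := Real.rpow_pos_of_pos hx.1 _
    rw [abs_mul, abs_of_pos h2, abs_pow]
    calc x ^ (1 - 3 / γ) * |W 0 x ^ (1 / θ) - cQInfty g γ x| ^ 2
        ≤ x ^ (1 - 3 / γ) * ((C₂ + g ^ (1 / γ)) * x ^ (1 / γ)) ^ 2 := by gcongr
      _ = (C₂ + g ^ (1 / γ)) ^ 2 * (x ^ (1 - 3 / γ) * (x ^ (1 / γ) * x ^ (1 / γ))) := by ring
      _ ≤ (C₂ + g ^ (1 / γ)) ^ 2 * 1 := by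
        refine mul_le_mul_of_nonneg_left ?_ (by positivity)
        rw [← Real.rpow_add hx.1, ← Real.rpow_add hx.1]
        refine Real.rpow_le_one hx.1.le hx.2.le ?_
        have : 1 / γ < 1 := by rw [div_lt_one hγ0]; exact hp.one_lt_γ
        have e : 1 - 3 / γ + (1 / γ + 1 / γ) = 1 - 1 / γ := by ring
        rw [e]; linarith
      _ = _ := mul_one _
  have hle : ∫ x, c x * potential g γ θ x (W 0 x) ∂unitMeasure
      ≤ ∫ x, C₄ * C * (x ^ (1 - 3 / γ) * (W 0 x ^ (1 / θ) - cQInfty g γ x) ^ 2) ∂unitMeasure := by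
    refine integral_mono_of_nonneg (unitMeasure_ae fun x hx => ?_) (hi.const_mul _)
      (unitMeasure_ae fun x hx => ?_)
    · exact mul_nonneg (F.c_pos hp.C₃_pos hx).le
        (potential_nonneg hg hp.one_lt_γ hθ (hWpos x hx) hx.1)
    · have hxI := Ioo_subset_Icc_self hx
      have h1 := hC x (W 0 x) hx.1 (hWpos x hx) (hW1 x hxI) (hW2 x hxI)
      have h2 : c x ≤ C₄ := by
        refine (F.c_upper x hxI).trans ?_
        have := Real.rpow_le_one hx.1.le hx.2.le hp.α_nonneg
        nlinarith
      simp only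
      rw [mul_assoc]
      exact mul_le_mul h2 h1 (potential_nonneg hg hp.one_lt_γ hθ (hWpos x hx) hx.1) hC₄.le
  rw [integral_const_mul] at hle
  have : (∫ x, c x * potential g γ θ x (W 0 x) ∂unitMeasure) / ρ
      ≤ (C₄ * C * ∫ x, x ^ (1 - 3 / γ) * (W 0 x ^ (1 / θ) - cQInfty g γ x) ^ 2 ∂unitMeasure) / ρ := by
    gcongr
  calc _ ≤ _ := add_le_add_right this _
    _ = _ := by ring

/-- For small data, `W` is comparable with the stationary profile for all times, with constants
that depend only on the parameters. -/
theorem exists_small_data_bounds {ρ g f γ α θ C₁ C₂ C₃ C₄ : ℝ}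
    (hp : AdmissibleParams ρ g f γ α θ C₁ C₂ C₃ C₄) :
    ∃ ε m R, 0 < ε ∧ ε < 1 ∧ 0 < m ∧ 0 ≤ R ∧ ∀ (c : ℝ → ℝ) (W S u ux ut H h : ℝ → ℝ → ℝ),
      RegularFlow ρ g f γ α θ C₁ C₂ C₃ C₄ c W S u ux ut H h →
      ∫ x, u 0 x ^ 2 ∂unitMeasure ≤ ε →
      ∫ x, x ^ (1 - 3 / γ) * (W 0 x ^ (1 / θ) - cQInfty g γ x) ^ 2 ∂unitMeasure ≤ ε →
      ∀ t, 0 ≤ t → ∀ x ∈ Icc (0 : ℝ) 1,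
        m * x ^ (θ / γ) ≤ W t x ∧ W t x ≤ R * x ^ (θ / γ) := by
  have hg := hp.g_pos
  have hγ0 := hp.γ_pos
  have hθ := hp.θ_pos
  have hf := hp.f_nonneg
  obtain ⟨C, hC0, hC⟩ := exists_initial_energy_le hp
  -- below the level `m` the pressure is at most half of the weight, above `R` at least twice
  set m := min (C₁ ^ θ) ((g / 2) ^ (θ / γ)) with hm
  set R := max (C₂ ^ θ) ((2 * g) ^ (θ / γ)) with hR
  have hm0 : 0 < m := lt_min (Real.rpow_pos_of_pos hp.C₁_pos _)
    (Real.rpow_pos_of_pos (by positivity) _)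
  have hmR : m ≤ R := (min_le_left _ _).trans
    ((Real.rpow_le_rpow hp.C₁_pos.le hp.C₁_le hθ.le).trans (le_max_left _ _))
  have hR0 : 0 < R := hm0.trans_le hmR
  have hpow : ∀ r : ℝ, 0 ≤ r → (r ^ (θ / γ)) ^ (γ / θ) = r := fun r hr => by
    rw [← Real.rpow_mul hr, hp.β_mul_p, Real.rpow_one]
  have hmg : m ^ (γ / θ) ≤ g / 2 := by
    conv_rhs => rw [← hpow (g / 2) (by positivity)]
    exact Real.rpow_le_rpow hm0.le (min_le_right _ _) hp.p_pos.le
  have hRg : 2 * g ≤ R ^ (γ / θ) := by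
    conv_lhs => rw [← hpow (2 * g) (by positivity)]
    exact Real.rpow_le_rpow (by positivity) (le_max_right _ _) hp.p_pos.le
  set Ch := f * ρ ^ 2 * ((4 * R) ^ (1 / θ) / C₃) ^ 2 with hCh
  have hCh0 : 0 ≤ Ch := by positivity
  -- with this `A`, the part of the friction that is not absorbed by the dissipation is at most
  -- half of the weight
  set A := 1 + 2 * Ch / g with hA
  have hA1 : 1 ≤ A := le_add_of_nonneg_right (by positivity)
  have hAg : Ch / A ^ 2 ≤ g / 2 := by
    rw [div_le_iff₀ (by positivity)]
    have h1 : A ≤ A ^ 2 := by nlinarith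
    have h2 : g / 2 * A = g / 2 + Ch := by rw [hA]; field_simp
    nlinarith
  have hcont : Tendsto (fun e : ℝ => θ * ρ * (√(2 * ((1 / 2 + C) * e)) + A * ((1 / 2 + C) * e)))
      (𝓝[>] 0) (𝓝 0) := by
    have h1 : Continuous (fun e : ℝ =>
        θ * ρ * (√(2 * ((1 / 2 + C) * e)) + A * ((1 / 2 + C) * e))) := by fun_prop
    have h2 := h1.tendsto 0
    simp only [mul_zero, Real.sqrt_zero, add_zero] at h2
    exact h2.mono_left nhdsWithin_le_nhds
  obtain ⟨ε, hε1, hε⟩ := ((hcont.eventually_le_const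
    (by positivity : (0 : ℝ) < m / 4)).and (Ioo_mem_nhdsGT (zero_lt_one (α := ℝ)))).exists
  refine ⟨ε, m / 4, 4 * R, hε.1, hε.2, by positivity, by positivity,
    fun c W S u ux ut H h F h1 h2 => ?_⟩
  refine F.global_bounds hp (A := A) (E₀ := (1 / 2 + C) * ε) hm0 hmR (min_le_left _ _) hmg
    (le_max_left _ _) hRg (by linarith) hAg ?_ hε1
  have := hC c W S u ux ut H h F
  nlinarith

/-! ### Decay of the velocity in `L²(0,1)` -/

/-- If the nonnegative energy `E` is dissipated at a rate that is at least proportional to `k ≥ 0`,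
and `k` grows at a bounded rate, then `k` tends to `0`. -/
theorem tendsto_zero_of_dissipation {k k' E D : ℝ → ℝ} {B a : ℝ} (hB : 0 < B) (ha : 0 < a)
    (hk0 : ∀ t, 0 < t → 0 ≤ k t) (hk : ∀ t, 0 < t → HasDerivAt k (k' t) t)
    (hk' : ∀ t, 0 < t → k' t ≤ B) (hE0 : ∀ t, 0 < t → 0 ≤ E t)
    (hE : ∀ t, 0 < t → HasDerivAt E (-D t) t) (hD : ∀ t, 0 < t → a * k t ≤ D t) :
    Tendsto k atTop (𝓝 0) := by
  have hEanti : AntitoneOn E (Ioi 0) := by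
    refine antitoneOn_of_hasDerivWithinAt_nonpos (convex_Ioi 0) (f' := fun t => -D t)
      (fun t ht => (hE t ht).continuousAt.continuousWithinAt) ?_ ?_
    · intro t ht
      rw [interior_Ioi] at ht
      exact (hE t ht).hasDerivWithinAt
    · intro t ht
      rw [interior_Ioi] at ht
      have h1 := hk0 t ht
      have h2 := hD t ht
      have h3 : 0 ≤ a * k t := by positivity
      linarith
  set e : ℝ → ℝ := fun t => E (max t 1) with he
  have hm : ∀ t : ℝ, 0 < max t 1 := fun t => one_pos.trans_le (le_max_right _ _)
  have heanti : Antitone e := fun s t hst => hEanti (hm s) (hm t) (max_le_max_right _ hst)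
  have hebdd : BddBelow (range e) := ⟨0, by rintro _ ⟨t, rfl⟩; exact hE0 _ (hm t)⟩
  have helim := tendsto_atTop_ciInf heanti hebdd
  rw [Metric.tendsto_atTop]
  intro ε hε
  set δ := min (ε / (2 * B)) 1 with hδ
  have hδ0 : 0 < δ := lt_min (by positivity) one_pos
  have hδB : B * δ ≤ ε / 2 := by
    have : δ ≤ ε / (2 * B) := min_le_left _ _
    rw [le_div_iff₀ (by positivity)] at this
    linarith
  have hdiff : Tendsto (fun t => e (t - δ) - e t) atTop (𝓝 0) := by
    have := (helim.comp (tendsto_atTop_add_const_right atTop (-δ) tendsto_id)).sub helim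
    simpa [Function.comp_def, sub_eq_add_neg] using this
  obtain ⟨N, hN⟩ := eventually_atTop.1
    (hdiff.eventually_lt_const (by positivity : (0 : ℝ) < a * (ε / 2) * δ))
  refine ⟨max N 2, fun t ht => ?_⟩
  have ht2 : 2 ≤ t := (le_max_right _ _).trans ht
  have hδ1 : δ ≤ 1 := min_le_right _ _
  have h1 := hN t ((le_max_left _ _).trans ht)
  simp only [he] at h1
  rw [max_eq_left (by linarith), max_eq_left (by linarith)] at h1
  rw [Real.dist_eq, sub_zero, abs_of_nonneg (hk0 t (by linarith))]
  by_contra! hcon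
  have hpos : ∀ s ∈ Icc (t - δ) t, 0 < s := fun s hs => by linarith [hs.1]
  -- `k` stays above `ε / 2` on `[t - δ, t]`
  have hkl : ∀ s ∈ Icc (t - δ) t, ε / 2 ≤ k s := by
    intro s hs
    have hanti : AntitoneOn (fun r => k r - B * r) (Icc (t - δ) t) := by
      refine antitoneOn_of_hasDerivWithinAt_nonpos (convex_Icc _ _) (f' := fun r => k' r - B) ?_ ?_ ?_
      · exact fun r hr => ((hk r (hpos r hr)).continuousAt.sub (by fun_prop)).continuousWithinAt
      · intro r hr
        have hr' := hpos r (interior_subset hr)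
        have h2 := (hk r hr').fun_sub ((hasDerivAt_id r).const_mul B)
        simp only [id, mul_one] at h2
        exact h2.hasDerivWithinAt
      · intro r hr
        linarith [hk' r (hpos r (interior_subset hr))]
    have h2 := hanti hs ⟨by linarith, le_rfl⟩ hs.2
    simp only at h2
    nlinarith [hs.1]
  have hanti : AntitoneOn (fun r => E r + a * (ε / 2) * r) (Icc (t - δ) t) := by
    refine antitoneOn_of_hasDerivWithinAt_nonpos (convex_Icc _ _)
      (f' := fun r => -D r + a * (ε / 2)) ?_ ?_ ?_
    · exact fun r hr => ((hE r (hpos r hr)).continuousAt.add (by fun_prop)).continuousWithinAt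
    · intro r hr
      have h2 := (hE r (hpos r (interior_subset hr))).fun_add
        ((hasDerivAt_id r).const_mul (a * (ε / 2)))
      simp only [id, mul_one] at h2
      exact h2.hasDerivWithinAt
    · intro r hr
      have h2 := hD r (hpos r (interior_subset hr))
      have h3 := mul_le_mul_of_nonneg_left (hkl r (interior_subset hr)) ha.le
      linarith
  have h2 := hanti ⟨le_rfl, by linarith⟩ ⟨by linarith, le_rfl⟩ (by linarith : t - δ ≤ t)
  simp only at h2
  linarith

namespace RegularFlow

variable {ρ g f γ α θ C₁ C₂ C₃ C₄ : ℝ} {c : ℝ → ℝ} {W S u ux ut H h : ℝ → ℝ → ℝ}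

theorem dissipation_integrable (F : RegularFlow ρ g f γ α θ C₁ C₂ C₃ C₄ c W S u ux ut H h)
    (hp : AdmissibleParams ρ g f γ α θ C₁ C₂ C₃ C₄) {m R t : ℝ} (hm : 0 < m) (hR : 0 ≤ R)
    (hW : ∀ t, 0 ≤ t → ∀ x ∈ Icc (0 : ℝ) 1,
      m * x ^ (θ / γ) ≤ W t x ∧ W t x ≤ R * x ^ (θ / γ)) (ht : 0 ≤ t) :
    Integrable (fun x => c x / W t x ^ ((1 + θ) / θ) * (S t x * S t x)) unitMeasure := by
  obtain ⟨K, hK0, hK⟩ := F.exists_flux_sqrt_bound (T := t) hp hR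
    fun s hs x hx => (hW s hs.1 x hx).2
  have hSm : AEStronglyMeasurable (S t) unitMeasure :=
    aestronglyMeasurable_of_continuousOn_Icc (F.continuousOn_flux hp ht)
  exact integrable_of_bound ((F.weight_meas ht).mul (hSm.mul hSm)) (unitMeasure_ae fun x hx =>
    F.dissipation_le hp hm (fun x hx => (hW t ht x hx).1) hx
      (hK t ⟨ht, le_rfl⟩ x (Ioo_subset_Icc_self hx))
      (hK t ⟨ht, le_rfl⟩ x (Ioo_subset_Icc_self hx)))

/-- A Poincaré inequality: the kinetic energy is controlled by the viscous dissipation. It follows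
by pairing `u` with itself and integrating by parts. -/
theorem integral_sq_le_dissipation (F : RegularFlow ρ g f γ α θ C₁ C₂ C₃ C₄ c W S u ux ut H h)
    (hp : AdmissibleParams ρ g f γ α θ C₁ C₂ C₃ C₄) {m R t : ℝ} (hm : 0 < m) (hR : 0 ≤ R)
    (hW : ∀ t, 0 ≤ t → ∀ x ∈ Icc (0 : ℝ) 1,
      m * x ^ (θ / γ) ≤ W t x ∧ W t x ≤ R * x ^ (θ / γ)) (ht : 0 < t) :
    ∫ x, u t x ^ 2 ∂unitMeasure
      ≤ C₄ / m ^ ((1 + θ) / θ) * flowDissipation θ c W S u h t := by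
  have hC₄ := hp.C₄_pos
  have hWt : ∀ x ∈ Icc (0 : ℝ) 1, m * x ^ (θ / γ) ≤ W t x := fun x hx => (hW t ht.le x hx).1
  set C := C₄ / m ^ ((1 + θ) / θ) with hC
  have hC0 : 0 < C := by positivity
  set N := ∫ x, u t x ^ 2 ∂unitMeasure with hN
  have hN0 : 0 ≤ N := integral_nonneg fun x => sq_nonneg _
  set I := ∫ x, c x / W t x ^ ((1 + θ) / θ) * (S t x * S t x) ∂unitMeasure with hI
  have hiSS := F.dissipation_integrable hp hm hR hW ht.le
  have h1 : N = - ∫ x, ux t x * (∫ y in (0 : ℝ)..x, u t y) ∂unitMeasure := by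
    rw [← F.integral_u_mul hp hm ht hWt (F.u_C1.memLp ht.le)]
    simp only [hN, sq]
  have h2 : N ≤ ∫ x, (C / 2 * (c x / W t x ^ ((1 + θ) / θ) * (S t x * S t x)) + N / 2)
      ∂unitMeasure := by
    have hi : Integrable (fun x => C / 2 * (c x / W t x ^ ((1 + θ) / θ) * (S t x * S t x)) + N / 2)
        unitMeasure := (hiSS.const_mul _).add (integrable_const _)
    refine h1.le.trans ((neg_le_abs _).trans ?_)
    rw [← Real.norm_eq_abs]
    refine norm_integral_le_of_norm_le hi ?_
    filter_upwards [F.ux_ae_eq hm ht.le hWt, unitMeasure_ae_mem] with x h3 h4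
    have hxI := Ioo_subset_Icc_self h4
    have h5 := abs_primitive_le (F.u_C1.memLp ht.le) hxI
    rw [← hN] at h5
    have h6 := hp.weight_le_div hm h4 (F.c_upper x hxI) (hWt x hxI)
    rw [← hC] at h6
    have h7 : 0 ≤ c x / W t x ^ ((1 + θ) / θ) :=
      div_nonneg (F.c_pos hp.C₃_pos h4).le (Real.rpow_pos_of_pos (W_pos hm hWt h4) _).le
    rw [h3, Real.norm_eq_abs, abs_mul, abs_mul, abs_of_nonneg h7]
    set ω := c x / W t x ^ ((1 + θ) / θ) with hω
    rw [le_div_iff₀ h4.1] at h6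
    have h8 : ω * |S t x| * |∫ y in (0 : ℝ)..x, u t y| ≤ ω * (|S t x| * (√N * √x)) := by
      rw [mul_assoc]
      gcongr
    refine h8.trans ?_
    have h9 : |S t x| * (√N * √x) ≤ C / 2 * (S t x * S t x) + N * x / (2 * C) := by
      have e1 : |S t x| ^ 2 = S t x * S t x := by rw [sq_abs, sq]
      have e2 : (√N * √x) ^ 2 = N * x := by
        rw [mul_pow, Real.sq_sqrt hN0, Real.sq_sqrt h4.1.le]
      rw [← e1, ← e2]
      have h10 : 0 ≤ (C * |S t x| - √N * √x) ^ 2 / (2 * C) := by positivity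
      have e3 : (C * |S t x| - √N * √x) ^ 2 / (2 * C)
          = C / 2 * |S t x| ^ 2 + (√N * √x) ^ 2 / (2 * C) - |S t x| * (√N * √x) := by
        field_simp
        ring
      linarith
    calc ω * (|S t x| * (√N * √x)) ≤ ω * (C / 2 * (S t x * S t x) + N * x / (2 * C)) := by gcongr
      _ = C / 2 * (ω * (S t x * S t x)) + N / (2 * C) * (ω * x) := by ring
      _ ≤ C / 2 * (ω * (S t x * S t x)) + N / (2 * C) * C := by gcongr
      _ = _ := by field_simp
  rw [integral_add (hiSS.const_mul _) (integrable_const _), integral_const_mul, ← hI] at h2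
  have h3 : ∫ _, N / 2 ∂unitMeasure = N / 2 := by simp
  rw [h3] at h2
  have h4 : I ≤ flowDissipation θ c W S u h t := by
    have e : ∫ x, c x * S t x ^ 2 / W t x ^ ((1 + θ) / θ) ∂unitMeasure = I := by
      rw [hI]
      congr 1; ext x; ring
    unfold flowDissipation
    rw [e]
    refine le_add_of_nonneg_right (integral_nonneg_of_ae ?_)
    filter_upwards [F.h_nonneg t ht.le] with x hx
    simp only [Pi.zero_apply]
    positivity
  have h5 := mul_le_mul_of_nonneg_left h4 hC0.le
  linarith

/-- The kinetic energy grows at a bounded rate. With `P = W^{γ/θ} - g x`, the rate is at most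
`-∫ ω S (S - P)`, where `ω = c / W^{(1+θ)/θ}`, and completing the square in `S` bounds it by
`∫ ω P²`. -/
theorem integral_u_mul_ut_le (F : RegularFlow ρ g f γ α θ C₁ C₂ C₃ C₄ c W S u ux ut H h)
    (hp : AdmissibleParams ρ g f γ α θ C₁ C₂ C₃ C₄) {m R t : ℝ} (hm : 0 < m) (hR : 0 ≤ R)
    (hW : ∀ t, 0 ≤ t → ∀ x ∈ Icc (0 : ℝ) 1,
      m * x ^ (θ / γ) ≤ W t x ∧ W t x ≤ R * x ^ (θ / γ)) (ht : 0 < t) :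
    ∫ x, u t x * ut t x ∂unitMeasure
      ≤ C₄ / m ^ ((1 + θ) / θ) * (R ^ (γ / θ) + g) ^ 2 := by
  have hC₄ := hp.C₄_pos
  have hg := hp.g_pos
  have hWt : ∀ x ∈ Icc (0 : ℝ) 1, m * x ^ (θ / γ) ≤ W t x := fun x hx => (hW t ht.le x hx).1
  set C := C₄ / m ^ ((1 + θ) / θ) with hC
  have hC0 : 0 < C := by positivity
  have h1 := F.integral_u_mul hp hm ht hWt (F.memLp_forcing ht.le)
  have i1 : Integrable (fun x => u t x * ut t x) unitMeasure :=
    (F.u_C1.memLp ht.le).integrable_mul (F.u_C1.memLp_deriv ht.le)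
  have i2 : Integrable (fun x => u t x * (ut t x + H t x)) unitMeasure :=
    (F.u_C1.memLp ht.le).integrable_mul (F.memLp_forcing ht.le)
  have h2 : ∫ x, u t x * ut t x ∂unitMeasure ≤ ∫ x, u t x * (ut t x + H t x) ∂unitMeasure := by
    refine integral_mono_ae i1 i2 ?_
    filter_upwards [F.H_eq t ht.le, F.h_nonneg t ht.le] with x h3 h4
    have : 0 ≤ h t x * u t x ^ 2 * |u t x| := by positivity
    rw [h3]
    nlinarith
  refine h2.trans ?_
  rw [h1, ← integral_neg]
  have h3 : ∀ᵐ x ∂unitMeasure, -(ux t x * ∫ y in (0 : ℝ)..x, (ut t y + H t y))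
      ≤ C * (R ^ (γ / θ) + g) ^ 2 := by
    filter_upwards [F.ux_ae_eq hm ht.le hWt, unitMeasure_ae_mem] with x h4 h5
    have hxI := Ioo_subset_Icc_self h5
    have h6 := F.S_eq t ht.le x hxI
    have h7 : (∫ y in (0 : ℝ)..x, (ut t y + H t y)) = S t x - (W t x ^ (γ / θ) - g * x) := by
      linarith
    have h8 := hp.weight_le_div hm h5 (F.c_upper x hxI) (hWt x hxI)
    rw [← hC] at h8
    have h9 : 0 ≤ c x / W t x ^ ((1 + θ) / θ) :=
      div_nonneg (F.c_pos hp.C₃_pos h5).le (Real.rpow_pos_of_pos (W_pos hm hWt h5) _).le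
    rw [h4, h7]
    set ω := c x / W t x ^ ((1 + θ) / θ) with hω
    set P := W t x ^ (γ / θ) - g * x with hP
    have h10 : P ^ 2 ≤ ((R ^ (γ / θ) + g) * x) ^ 2 := by
      have h11 : 0 ≤ W t x ^ (γ / θ) := Real.rpow_nonneg (F.W_nonneg t ht.le x hxI) _
      have h12 := F.W_rpow_le hp hR ht.le hxI (hW t ht.le x hxI).2
      have h13 : 0 ≤ g * x := mul_nonneg hg.le h5.1.le
      have h14 : 0 ≤ R ^ (γ / θ) * x := h11.trans h12
      refine sq_le_sq' ?_ ?_ <;> rw [hP] <;> linarith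
    rw [le_div_iff₀ h5.1] at h8
    calc -(ω * S t x * (S t x - P)) ≤ ω * P ^ 2 := by
          have := mul_nonneg h9 (sq_nonneg (S t x - P / 2))
          have := mul_nonneg h9 (sq_nonneg P)
          nlinarith
      _ ≤ ω * ((R ^ (γ / θ) + g) * x) ^ 2 := by gcongr
      _ = (ω * x) * x * (R ^ (γ / θ) + g) ^ 2 := by ring
      _ ≤ C * 1 * (R ^ (γ / θ) + g) ^ 2 := by
          have := h5.2.le
          have := h5.1.le
          gcongr
      _ = _ := by ring
  by_cases hi : Integrable (fun x => -(ux t x * ∫ y in (0 : ℝ)..x, (ut t y + H t y))) unitMeasure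
  · have := integral_mono_ae hi (integrable_const _) h3
    simpa using this
  · rw [integral_undef hi]
    positivity

/-- The velocity decays in `L²(0,1)`. -/
theorem tendsto_integral_sq (F : RegularFlow ρ g f γ α θ C₁ C₂ C₃ C₄ c W S u ux ut H h)
    (hp : AdmissibleParams ρ g f γ α θ C₁ C₂ C₃ C₄) {m R : ℝ} (hm : 0 < m) (hR : 0 ≤ R)
    (hW : ∀ t, 0 ≤ t → ∀ x ∈ Icc (0 : ℝ) 1,
      m * x ^ (θ / γ) ≤ W t x ∧ W t x ≤ R * x ^ (θ / γ)) :
    Tendsto (fun t => ∫ x, u t x ^ 2 ∂unitMeasure) atTop (𝓝 0) := by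
  have hC₄ := hp.C₄_pos
  have hg := hp.g_pos
  set C := C₄ / m ^ ((1 + θ) / θ) with hC
  have hC0 : 0 < C := by positivity
  have hlim := tendsto_zero_of_dissipation (k := fun t => (∫ x, u t x ^ 2 ∂unitMeasure) / 2)
    (k' := fun t => ∫ x, u t x * ut t x ∂unitMeasure) (E := flowEnergy ρ g γ θ c W u)
    (D := flowDissipation θ c W S u h) (B := C * (R ^ (γ / θ) + g) ^ 2) (a := 2 / C)
    (by positivity) (by positivity)
    (fun t _ => div_nonneg (integral_nonneg fun x => sq_nonneg _) two_pos.le)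
    (fun t ht => (F.u_C1.hasDerivWithinAt_half_integral_sq ht.le).hasDerivAt (Ici_mem_nhds ht))
    (fun t ht => F.integral_u_mul_ut_le hp hm hR hW ht)
    (fun t ht => le_trans (div_nonneg (integral_nonneg fun x => sq_nonneg _) two_pos.le)
      (F.integral_sq_le_flowEnergy hp hm fun x hx => (hW t ht.le x hx).1))
    (fun t ht => F.hasDerivAt_flowEnergy (T := t + 1) hp hm hR (fun s hs => hW s hs.1)
      ⟨ht, by linarith⟩)
    (fun t ht => by
      have := F.integral_sq_le_dissipation hp hm hR hW ht
      rw [← hC] at this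
      calc 2 / C * ((∫ x, u t x ^ 2 ∂unitMeasure) / 2)
          = (∫ x, u t x ^ 2 ∂unitMeasure) / C := by field_simp
        _ ≤ _ := by rw [div_le_iff₀ hC0]; linarith)
  have := hlim.mul_const 2
  simpa using this

end RegularFlow

/-! ### Uniform convergence -/

/-- A family of functions with a common modulus of continuity on `[a,1]` that tends to `0` in
`L²(0,1)` tends to `0` uniformly. -/
theorem tendstoUniformlyOn_zero_of_integral_sq {v w : ℝ → ℝ → ℝ} {G : ℝ → ℝ} {a : ℝ} (ha0 : 0 ≤ a)
    (ha1 : a < 1) (hG : ContinuousOn G (Icc a 1))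
    (hvG : ∀ t, 0 ≤ t → ∀ x ∈ Icc a 1, ∀ y ∈ Icc a 1, |v t x - v t y| ≤ |G x - G y|)
    (hvw : ∀ t, 0 ≤ t → ∀ᵐ x ∂unitMeasure, w t x = v t x)
    (hw : ∀ t, 0 ≤ t → MemLp (w t) 2 unitMeasure)
    (hlim : Tendsto (fun t => ∫ x, w t x ^ 2 ∂unitMeasure) atTop (𝓝 0)) :
    TendstoUniformlyOn v (fun _ => 0) atTop (Icc a 1) := by
  rw [Metric.tendstoUniformlyOn_iff]
  intro ε hε
  have hGu := isCompact_Icc.uniformContinuousOn_of_continuous hG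
  obtain ⟨δ₀, hδ₀, hδG⟩ := Metric.uniformContinuousOn_iff.1 hGu (ε / 2) (by positivity)
  set δ := min (δ₀ / 2) (1 - a) with hδ
  have hδ0 : 0 < δ := lt_min (by positivity) (by linarith)
  have hδ1 : δ < δ₀ := (min_le_left _ _).trans_lt (by linarith)
  have hδ2 : δ ≤ 1 - a := min_le_right _ _
  filter_upwards [eventually_ge_atTop 0,
    hlim.eventually_lt_const (by positivity : (0 : ℝ) < δ * (ε / 2) ^ 2)] with t ht hlt x hx
  rw [dist_comm, Real.dist_eq, sub_zero]
  -- if `|v t x| ≥ ε`, then `|v t| ≥ ε / 2` on an interval of length `δ`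
  by_contra! hcon
  set l := max a (x - δ) with hl
  have hl1 : a ≤ l := le_max_left _ _
  have hl2 : x - δ ≤ l := le_max_right _ _
  have hl3 : l ≤ x := max_le hx.1 (by linarith)
  have hl4 : l + δ ≤ 1 := by
    rcases max_choice a (x - δ) with h | h <;> rw [hl, h] <;> linarith [hx.2]
  have hsub : Ioo l (l + δ) ⊆ Ioo 0 1 := Ioo_subset_Ioo (ha0.trans hl1) hl4
  have hlow : ∀ᵐ y ∂(volume.restrict (Ioo l (l + δ))), (ε / 2) ^ 2 ≤ w t y ^ 2 := by
    filter_upwards [ae_restrict_of_ae_restrict_of_subset hsub (hvw t ht),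
      ae_restrict_mem measurableSet_Ioo] with y h1 h2
    have hy : y ∈ Icc a 1 := ⟨hl1.trans h2.1.le, h2.2.le.trans hl4⟩
    have h3 := hδG x hx y hy (by
      rw [Real.dist_eq, abs_lt]; constructor <;> linarith [h2.1, h2.2])
    rw [Real.dist_eq] at h3
    have h4 := hvG t ht x hx y hy
    have h5 : ε / 2 ≤ |v t y| := by
      have := abs_sub_abs_le_abs_sub (v t x) (v t y)
      linarith
    rw [h1, ← sq_abs (v t y)]
    gcongr
  have hi := (hw t ht).integrable_sq
  have h1 : ∫ _ in Ioo l (l + δ), (ε / 2) ^ 2 ≤ ∫ y in Ioo l (l + δ), w t y ^ 2 :=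
    integral_mono_ae (by simp) (IntegrableOn.mono_set hi hsub) hlow
  have h2 : ∫ y in Ioo l (l + δ), w t y ^ 2 ≤ ∫ y, w t y ^ 2 ∂unitMeasure :=
    setIntegral_mono_set hi (ae_of_all _ fun y => sq_nonneg _) hsub.eventuallyLE
  have h3 : ∫ _ in Ioo l (l + δ), (ε / 2) ^ 2 = δ * (ε / 2) ^ 2 := by
    rw [setIntegral_const, smul_eq_mul, measureReal_def, Real.volume_Ioo, add_sub_cancel_left,
      ENNReal.toReal_ofReal hδ0.le]
  linarith

namespace RegularFlow

variable {ρ g f γ α θ C₁ C₂ C₃ C₄ : ℝ} {c : ℝ → ℝ} {W S u ux ut H h : ℝ → ℝ → ℝ}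

/-- The impulse of the friction force is controlled by the kinetic energy. -/
theorem abs_force_primitive_le_integral_sq
    (F : RegularFlow ρ g f γ α θ C₁ C₂ C₃ C₄ c W S u ux ut H h) (hf : 0 ≤ f) {t x : ℝ}
    (ht : 0 ≤ t) (hx : x ∈ Icc (0 : ℝ) 1) :
    |∫ y in (0 : ℝ)..x, H t y| ≤ f * ρ ^ 2 * ∫ y, u t y ^ 2 ∂unitMeasure := by
  have hres : unitMeasure = volume.restrict (Ioc (0 : ℝ) 1) :=
    Measure.restrict_congr_set Ioo_ae_eq_Ioc
  have hsub : Ioc 0 x ⊆ Ioc 0 1 := Ioc_subset_Ioc_right hx.2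
  have hb : ∀ᵐ y ∂unitMeasure, ‖H t y‖ ≤ f * ρ ^ 2 * u t y ^ 2 := by
    filter_upwards [F.H_eq t ht, F.h_nonneg t ht, F.h_le t ht] with y h1 h2 h3
    rw [h1, Real.norm_eq_abs, abs_mul, abs_mul, abs_abs, abs_of_nonneg h2, mul_assoc,
      abs_mul_abs_self, ← sq]
    gcongr
  have hi : Integrable (fun y => f * ρ ^ 2 * u t y ^ 2) unitMeasure :=
    (F.u_C1.memLp ht).integrable_sq.const_mul _
  rw [← integral_const_mul, intervalIntegral.integral_of_le hx.1]
  have hi' := hi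
  rw [hres] at hb hi'
  refine (norm_integral_le_of_norm_le (IntegrableOn.mono_set hi' hsub)
    (ae_restrict_of_ae_restrict_of_subset hsub hb)).trans ?_
  rw [hres]
  exact setIntegral_mono_set hi' (ae_of_all _ fun y => by positivity) hsub.eventuallyLE

/-- `W` tends to the stationary profile. For `Z = W + θ ρ ∫₀ˣ u`, where the second summand becomes
small, `Z' = -θ ρ (W^{γ/θ} - g x + ∫₀ˣ H)` has a definite sign as long as `W` is not close to
`(g x)^{θ/γ}`. -/
theorem tendstoUniformlyOn_W (F : RegularFlow ρ g f γ α θ C₁ C₂ C₃ C₄ c W S u ux ut H h)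
    (hp : AdmissibleParams ρ g f γ α θ C₁ C₂ C₃ C₄) {m R : ℝ} (hm : 0 < m) (hR : 0 ≤ R)
    (hW : ∀ t, 0 ≤ t → ∀ x ∈ Icc (0 : ℝ) 1,
      m * x ^ (θ / γ) ≤ W t x ∧ W t x ≤ R * x ^ (θ / γ)) :
    TendstoUniformlyOn W (fun x => (g * x) ^ (θ / γ)) atTop (Icc 0 1) := by
  have hg := hp.g_pos
  have hlam : 0 < θ * ρ := mul_pos hp.θ_pos hp.ρ_pos
  have hu := F.tendsto_integral_sq hp hm hR hW
  rw [Metric.tendstoUniformlyOn_iff]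
  intro ε' hε'
  set ε := ε' / 2 with hε
  have hε0 : 0 < ε := by positivity
  set k₀ := (ε / 2) ^ (γ / θ) with hk₀
  have hk₀0 : 0 < k₀ := Real.rpow_pos_of_pos (by positivity) _
  have hlimU : Tendsto (fun t => θ * ρ * √(∫ x, u t x ^ 2 ∂unitMeasure)) atTop (𝓝 0) := by
    simpa using (hu.sqrt).const_mul (θ * ρ)
  have hlimF : Tendsto (fun t => f * ρ ^ 2 * ∫ x, u t x ^ 2 ∂unitMeasure) atTop (𝓝 0) := by
    simpa using hu.const_mul (f * ρ ^ 2)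
  obtain ⟨T₀, hT₀⟩ := eventually_atTop.1 ((hlimU.eventually_le_const
    (by positivity : (0 : ℝ) < ε / 4)).and (hlimF.eventually_le_const
    (by positivity : (0 : ℝ) < k₀ / 2)))
  set T := max T₀ 1 with hT
  have hT0 : 0 < T := one_pos.trans_le (le_max_right _ _)
  set G := g ^ (θ / γ) with hG
  have hG0 : 0 < G := Real.rpow_pos_of_pos hg _
  set k := θ * ρ * (k₀ / 2) with hk
  have hk0 : 0 < k := by positivity
  filter_upwards [eventually_ge_atTop (T + (R + G + ε) / k)] with t ht x hx
  have hTt : T ≤ t := by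
    have : 0 ≤ (R + G + ε) / k := by positivity
    linarith
  have hkt : R + G + ε ≤ k * (t - T) := by
    have h1 : (R + G + ε) / k ≤ t - T := by linarith
    rw [div_le_iff₀ hk0] at h1
    linarith
  set U : ℝ → ℝ := fun s => ∫ y in (0 : ℝ)..x, u s y with hU
  set B := (g * x) ^ (θ / γ) with hB
  have hgx : 0 ≤ g * x := mul_nonneg hg.le hx.1
  have hB0 : 0 ≤ B := Real.rpow_nonneg hgx _
  have hx1 : x ^ (θ / γ) ≤ 1 := Real.rpow_le_one hx.1 hx.2 hp.β_pos.le
  have hx0 : 0 ≤ x ^ (θ / γ) := Real.rpow_nonneg hx.1 _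
  have hBG : B ≤ G := by
    rw [hB, Real.mul_rpow hg.le hx.1]
    nlinarith
  have hBp : B ^ (γ / θ) = g * x := by rw [hB, ← Real.rpow_mul hgx, hp.β_mul_p, Real.rpow_one]
  have hUb : ∀ s, T ≤ s → |θ * ρ * U s| ≤ ε / 4 := fun s hs => by
    have hs0 : 0 ≤ s := hT0.le.trans hs
    rw [abs_mul, abs_of_pos hlam]
    have h1 := F.abs_u_primitive_le hp hs0 hx
    have h2 : √(∫ y, u s y ^ 2 ∂unitMeasure) * x ^ (θ / γ) ≤ √(∫ y, u s y ^ 2 ∂unitMeasure) :=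
      mul_le_of_le_one_right (Real.sqrt_nonneg _) hx1
    exact (mul_le_mul_of_nonneg_left (h1.trans h2) hlam.le).trans
      (hT₀ s ((le_max_left _ _).trans hs)).1
  have hFb : ∀ s, T ≤ s → |∫ y in (0 : ℝ)..x, H s y| ≤ k₀ / 2 := fun s hs =>
    (F.abs_force_primitive_le_integral_sq hp.f_nonneg (hT0.le.trans hs) hx).trans
      (hT₀ s ((le_max_left _ _).trans hs)).2
  have hdZ : ∀ s, 0 ≤ s → HasDerivWithinAt (fun s => W s x + θ * ρ * U s)
      (-(θ * ρ) * (W s x ^ (γ / θ) - g * x + ∫ y in (0 : ℝ)..x, H s y)) (Ici 0) s :=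
    fun s hs => F.hasDerivWithinAt_W_add hs hx
  have hcZ : ContinuousOn (fun s => W s x + θ * ρ * U s) (Icc T t) := fun s hs =>
    (hdZ s (hT0.le.trans hs.1)).continuousWithinAt.mono fun r hr => hT0.le.trans hr.1
  have hdZ' : ∀ s ∈ Ioo T t, HasDerivAt (fun s => W s x + θ * ρ * U s)
      (-(θ * ρ) * (W s x ^ (γ / θ) - g * x + ∫ y in (0 : ℝ)..x, H s y)) s := fun s hs =>
    (hdZ s (hT0.trans hs.1).le).hasDerivAt (Ici_mem_nhds (hT0.trans hs.1))
  have hWT := hW T hT0.le x hx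
  have hW0 := F.W_nonneg T hT0.le x hx
  have hRx : R * x ^ (θ / γ) ≤ R := mul_le_of_le_one_right hR hx1
  have hUT := abs_le.1 (hUb T le_rfl)
  have hUt := abs_le.1 (hUb t hTt)
  have upper : W t x ≤ B + ε := by
    have hb := le_max_of_deriv_le_above (L := B + 3 * ε / 4) hTt hk0.le hcZ hdZ'
      fun s hs hlt => by
        have hs0 : 0 ≤ s := (hT0.trans hs.1).le
        have h1 := abs_le.1 (hUb s hs.1.le)
        have h2 := abs_le.1 (hFb s hs.1.le)
        have h3 : B + ε / 2 ≤ W s x := by linarith [h1.2]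
        have h4 : g * x + k₀ ≤ W s x ^ (γ / θ) := by
          rw [← hBp]
          exact (Real.add_rpow_le_rpow_add hB0 (by positivity) hp.one_le_p).trans
            (Real.rpow_le_rpow (by positivity) h3 hp.p_pos.le)
        have h5 : k₀ / 2 ≤ W s x ^ (γ / θ) - g * x + ∫ y in (0 : ℝ)..x, H s y := by
          linarith [h2.1]
        have h6 := mul_le_mul_of_nonneg_left h5 hlam.le
        rw [hk]
        linarith
    have hle : W T x + θ * ρ * U T - k * (t - T) ≤ B + 3 * ε / 4 := by
      linarith [hUT.2, hWT.2]
    rw [max_eq_left hle] at hb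
    linarith [hUt.1]
  have lower : B - ε ≤ W t x := by
    have hb := le_max_of_deriv_le_above (y := fun s => -(W s x + θ * ρ * U s))
      (L := -(B - 3 * ε / 4)) hTt hk0.le hcZ.neg
      (fun s hs => (hdZ' s hs).fun_neg)
      fun s hs hlt => by
        have hs0 : 0 ≤ s := (hT0.trans hs.1).le
        have h1 := abs_le.1 (hUb s hs.1.le)
        have h2 := abs_le.1 (hFb s hs.1.le)
        have h3 : W s x + ε / 2 ≤ B := by linarith [h1.1]
        have hWs := F.W_nonneg s hs0 x hx
        have h4 : W s x ^ (γ / θ) + k₀ ≤ g * x := by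
          rw [← hBp]
          exact (Real.add_rpow_le_rpow_add hWs (by positivity) hp.one_le_p).trans
            (Real.rpow_le_rpow (by positivity) h3 hp.p_pos.le)
        have h5 : W s x ^ (γ / θ) - g * x + (∫ y in (0 : ℝ)..x, H s y) ≤ -(k₀ / 2) := by
          linarith [h2.2]
        have h6 := mul_le_mul_of_nonneg_left h5 hlam.le
        rw [hk]
        linarith
    have hle : -(W T x + θ * ρ * U T) - k * (t - T) ≤ -(B - 3 * ε / 4) := by
      linarith [hUT.1]
    rw [max_eq_left hle] at hb
    linarith [hUt.2]
  rw [dist_comm, Real.dist_eq, abs_lt]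
  constructor <;> linarith

theorem tendstoUniformlyOn_W_rpow (F : RegularFlow ρ g f γ α θ C₁ C₂ C₃ C₄ c W S u ux ut H h)
    (hp : AdmissibleParams ρ g f γ α θ C₁ C₂ C₃ C₄) {m R : ℝ} (hm : 0 < m) (hR : 0 ≤ R)
    (hW : ∀ t, 0 ≤ t → ∀ x ∈ Icc (0 : ℝ) 1,
      m * x ^ (θ / γ) ≤ W t x ∧ W t x ≤ R * x ^ (θ / γ)) :
    TendstoUniformlyOn (fun t x => W t x ^ (1 / θ)) (cQInfty g γ) atTop (Icc 0 1) := by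
  have hg := hp.g_pos
  have hθ := hp.θ_pos
  have hγ := hp.γ_pos
  have hlim := F.tendstoUniformlyOn_W hp hm hR hW
  rw [Metric.tendstoUniformlyOn_iff] at hlim ⊢
  intro ε hε
  set K := max R (g ^ (θ / γ)) with hK
  have huc : UniformContinuousOn (fun s : ℝ => s ^ (1 / θ)) (Icc 0 K) :=
    isCompact_Icc.uniformContinuousOn_of_continuous
      (continuousOn_id.rpow_const fun x _ => Or.inr (by positivity))
  obtain ⟨δ, hδ, hδε⟩ := Metric.uniformContinuousOn_iff.1 huc ε hε
  filter_upwards [hlim δ hδ, eventually_ge_atTop 0] with t h1 ht x hx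
  have hgx : 0 ≤ g * x := mul_nonneg hg.le hx.1
  have hx1 : x ^ (θ / γ) ≤ 1 := Real.rpow_le_one hx.1 hx.2 hp.β_pos.le
  have e : cQInfty g γ x = ((g * x) ^ (θ / γ)) ^ (1 / θ) := by
    rw [← Real.rpow_mul hgx]
    unfold cQInfty
    congr 1
    field_simp
  rw [e]
  refine hδε _ ⟨Real.rpow_nonneg hgx _, ?_⟩ _ ⟨F.W_nonneg t ht x hx, ?_⟩ (h1 x hx)
  · refine le_trans ?_ (le_max_right _ _)
    exact Real.rpow_le_rpow hgx (by nlinarith [hx.2]) hp.β_pos.le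
  · exact ((hW t ht x hx).2.trans (mul_le_of_le_one_right hR hx1)).trans (le_max_left _ _)

/-- Uniform decay of the velocity on `[a,1]` if the weight `x^{α-(1+θ)/γ}`, to which `ux` is
proportional, is integrable there. -/
theorem velocity_decay (F : RegularFlow ρ g f γ α θ C₁ C₂ C₃ C₄ c W S u ux ut H h)
    (hp : AdmissibleParams ρ g f γ α θ C₁ C₂ C₃ C₄) {m R : ℝ} (hm : 0 < m) (hR : 0 ≤ R)
    (hW : ∀ t, 0 ≤ t → ∀ x ∈ Icc (0 : ℝ) 1,
      m * x ^ (θ / γ) ≤ W t x ∧ W t x ≤ R * x ^ (θ / γ)) {C : ℝ → ℝ}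
    (hC : ∀ t, 0 ≤ t → ∀ᵐ x ∂unitMeasure, u t x = C t + ∫ y in (1 / 2 : ℝ)..x, ux t y)
    {a : ℝ} (ha0 : 0 ≤ a) (ha1 : a ≤ 1 / 2)
    (hint : IntervalIntegrable (fun x : ℝ => x ^ (α - (1 + θ) / γ)) volume a 1) :
    (∀ t, 0 ≤ t → ContinuousOn (fun x => C t + ∫ y in (1 / 2 : ℝ)..x, ux t y) (Icc a 1)) ∧
      TendstoUniformlyOn (fun t x => C t + ∫ y in (1 / 2 : ℝ)..x, ux t y) (fun _ => 0) atTop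
        (Icc a 1) := by
  obtain ⟨M, hM0, hM⟩ := F.exists_flux_bound hp
  have ha1' : a ≤ 1 := by linarith
  have hhalf : (1 / 2 : ℝ) ∈ uIcc a 1 := by
    rw [uIcc_of_le ha1']; exact ⟨ha1, by norm_num⟩
  set r := α - (1 + θ) / γ with hr
  set B := C₄ / m ^ ((1 + θ) / θ) * M with hB
  have hres : unitMeasure = volume.restrict (Ioc (0 : ℝ) 1) :=
    Measure.restrict_congr_set Ioo_ae_eq_Ioc
  have hux : ∀ t, 0 ≤ t → ∀ᵐ x ∂(volume.restrict (Ioc a 1)), ‖ux t x‖ ≤ B * x ^ r := fun t ht => by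
    have := F.ux_le hp hm ht (fun x hx => (hW t ht x hx).1) (hM t ht)
    rw [hres] at this
    exact ae_restrict_of_ae_restrict_of_subset (Ioc_subset_Ioc_left ha0) this
  have hgi : IntervalIntegrable (fun x : ℝ => B * x ^ r) volume a 1 := hint.const_mul B
  have huxi : ∀ t, 0 ≤ t → IntervalIntegrable (ux t) volume a 1 := fun t ht => by
    have hm' := F.ux_meas ht
    rw [hres] at hm'
    rw [intervalIntegrable_iff_integrableOn_Ioc_of_le ha1'] at hgi ⊢
    exact Integrable.mono' hgi (hm'.mono_measure
      (Measure.restrict_mono (Ioc_subset_Ioc_left ha0) le_rfl)) (hux t ht)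
  refine ⟨fun t ht => ?_, ?_⟩
  · have := intervalIntegral.continuousOn_primitive_interval' (huxi t ht) hhalf
    rw [uIcc_of_le ha1'] at this
    exact continuousOn_const.fun_add this
  · have hGc := intervalIntegral.continuousOn_primitive_interval' hgi hhalf
    rw [uIcc_of_le ha1'] at hGc
    refine tendstoUniformlyOn_zero_of_integral_sq ha0 (by linarith) hGc ?_ hC
      (fun t ht => F.u_C1.memLp ht) (F.tendsto_integral_sq hp hm hR hW)
    intro t ht x hx y hy
    have hsub : ∀ {v : ℝ → ℝ}, IntervalIntegrable v volume a 1 → ∀ z ∈ Icc a 1,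
        ∀ z' ∈ Icc a 1, IntervalIntegrable v volume z z' := by
      intro v hv z hz z' hz'
      refine hv.mono_set ?_
      rw [uIcc_of_le ha1']
      exact uIcc_subset_Icc hz hz'
    have hhalf' : (1 / 2 : ℝ) ∈ Icc a 1 := ⟨ha1, by norm_num⟩
    rw [add_sub_add_left_eq_sub,
      intervalIntegral.integral_interval_sub_left (hsub (huxi t ht) _ hhalf' _ hx)
        (hsub (huxi t ht) _ hhalf' _ hy),
      intervalIntegral.integral_interval_sub_left (hsub hgi _ hhalf' _ hx)
        (hsub hgi _ hhalf' _ hy)]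
    rw [← Real.norm_eq_abs]
    refine intervalIntegral.norm_integral_le_abs_of_norm_le ?_ (hsub hgi _ hy _ hx)
    refine ae_restrict_of_ae_restrict_of_subset ?_ (hux t ht)
    rw [uIoc]
    exact Ioc_subset_Ioc (le_min hy.1 hx.1) (max_le hy.2 hx.2)

end RegularFlow

theorem theorem2p3
    (ρl g f γ α θ C₁ C₂ C₃ C₄ : ℝ)
    (hρl : 0 < ρl) (hg : 0 < g) (hf : 0 ≤ f) (hγ : 1 < γ)
    (hα₀ : 0 ≤ α) (hα₁ : α < 1 / γ)
    (hθ₀ : 0 < θ) (hθ₁ : θ ≤ γ / 2) (hθ₂ : θ ≤ γ - 1) (hθ₃ : θ ≤ 1 - α * γ)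
    (hC₁ : 0 < C₁) (hC₁₂ : C₁ ≤ C₂) (hC₃ : 0 < C₃) (hC₃₄ : C₃ ≤ C₄) :
    ∃ ε₀ : ℝ, 0 < ε₀ ∧ ε₀ < 1 ∧
      ∀ c₀ Q₀ u₀ : ℝ → ℝ, AEMeasurable c₀ unitMeasure →
        AssumptionA1 γ α C₁ C₂ C₃ C₄ c₀ Q₀ →
        AssumptionA2 g γ α θ c₀ Q₀ u₀ →
        AssumptionA3 θ c₀ Q₀ u₀ →
        (∫ x in Ioo (0 : ℝ) 1, u₀ x ^ 2) ≤ ε₀ →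
        (∫ x in Ioo (0 : ℝ) 1, x ^ (1 - 3 / γ) * (c₀ x * Q₀ x - cQInfty g γ x) ^ 2) ≤ ε₀ →
        ∀ Q u : ℝ → ℝ → ℝ, IsWeakSolution ρl g f γ θ c₀ Q₀ u₀ Q u →
          ∃ cQ' u' : ℝ → ℝ → ℝ,
            IsContinuousVersion cQ' (fun t x => c₀ x * Q t x) (Icc 0 1) ∧
            IsContinuousVersion u' u (Ioc 0 1) ∧
            TendstoUniformlyOn cQ' (cQInfty g γ) atTop (Icc 0 1) ∧
            (∀ δ : ℝ, 0 < δ → δ < 1 →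
              TendstoUniformlyOn u' (fun _ => 0) atTop (Icc δ 1)) ∧
            (θ < γ - 1 →
              IsContinuousVersion u' u (Icc 0 1) ∧
              TendstoUniformlyOn u' (fun _ => 0) atTop (Icc 0 1)) := by
  have hp : AdmissibleParams ρl g f γ α θ C₁ C₂ C₃ C₄ :=
    ⟨hρl, hg, hf, hγ, hα₀, hα₁, hθ₀, hθ₁, hθ₂, hθ₃, hC₁, hC₁₂, hC₃, hC₃₄⟩
  obtain ⟨ε₀, m, R, hε0, hε1, hm, hR, hmain⟩ := exists_small_data_bounds hp
  refine ⟨ε₀, hε0, hε1, ?_⟩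
  intro c₀ Q₀ u₀ hcm hA1 hA2 _ hs1 hs2 Q u ⟨ux, wt, hsol⟩
  obtain ⟨W, S, ut, H, η, F, hWQ, hu0⟩ :=
    hsol.exists_regularFlow hρl hf hγ hθ₀ hθ₁ hp.θ_le_one hC₁ hC₁₂ hC₃ hcm hA1 hA2
  have hW : ∀ t, 0 ≤ t → ∀ x ∈ Icc (0 : ℝ) 1,
      m * x ^ (θ / γ) ≤ W t x ∧ W t x ≤ R * x ^ (θ / γ) := by
    refine hmain c₀ W S u ux ut H η F ?_ ?_
    · refine le_trans (le_of_eq (integral_congr_ae ?_)) hs1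
      filter_upwards [hu0] with x hx
      rw [hx]
    · refine le_trans (le_of_eq (integral_congr_ae ?_)) hs2
      filter_upwards [hWQ 0 le_rfl, hsol.initial_cQ] with x h1 h2
      rw [h1, h2]
  -- `C t` is the value at `1/2` of the continuous representative of `u t`
  have hcex : ∀ t, ∃ C, 0 ≤ t → ∀ᵐ x ∂unitMeasure, u t x = C + ∫ y in (1 / 2 : ℝ)..x, ux t y := by
    intro t
    by_cases ht : 0 ≤ t
    · obtain ⟨C, hC⟩ := (F.weakDeriv t ht).2
      exact ⟨C, fun _ => hC⟩
    · exact ⟨0, fun h => absurd h ht⟩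
  choose C hC using hcex
  have hvel : ∀ a : ℝ, 0 < a → a ≤ 1 / 2 →
      (∀ t, 0 ≤ t → ContinuousOn (fun x => C t + ∫ y in (1 / 2 : ℝ)..x, ux t y) (Icc a 1)) ∧
        TendstoUniformlyOn (fun t x => C t + ∫ y in (1 / 2 : ℝ)..x, ux t y) (fun _ => 0) atTop
          (Icc a 1) := fun a ha0 ha1 =>
    F.velocity_decay hp hm hR hW hC ha0.le ha1
      (intervalIntegral.intervalIntegrable_rpow (Or.inr (by
        rw [uIcc_of_le (by linarith)]
        exact fun h => absurd h.1 (not_le.2 ha0))))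
  refine ⟨fun t x => W t x ^ (1 / θ), fun t x => C t + ∫ y in (1 / 2 : ℝ)..x, ux t y,
    fun t ht => ⟨?_, hWQ t ht⟩, fun t ht => ⟨?_, ?_⟩, F.tendstoUniformlyOn_W_rpow hp hm hR hW,
    fun δ hδ0 hδ1 => ?_, fun hlt => ?_⟩
  · exact ((F.W_cont t ht).rpow_const fun x => Or.inr (by positivity)).continuousOn
  · intro x hx
    have h1 : 0 < min (x / 2) (1 / 2) := lt_min (by linarith [hx.1]) (by norm_num)
    have h2 : min (x / 2) (1 / 2) < x := (min_le_left _ _).trans_lt (by linarith [hx.1])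
    refine ((hvel _ h1 (min_le_right _ _)).1 t ht x ⟨h2.le, hx.2⟩).mono_of_mem_nhdsWithin ?_
    refine mem_of_superset (inter_mem_nhdsWithin _ (Ioi_mem_nhds h2)) ?_
    exact fun y hy => ⟨le_of_lt hy.2, hy.1.2⟩
  · filter_upwards [hC t ht] with x hx
    exact hx.symm
  · exact (hvel (min δ (1 / 2)) (lt_min hδ0 (by norm_num)) (min_le_right _ _)).2.mono
      (Icc_subset_Icc_left (min_le_left _ _))
  -- for `θ < γ - 1` the exponent `α - (1+θ)/γ` exceeds `-1`, so that the weight is integrable at `0`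
  · have h := F.velocity_decay hp hm hR hW hC le_rfl (by norm_num)
      (intervalIntegral.intervalIntegrable_rpow' (by
        have : (1 + θ) / γ < 1 := by rw [div_lt_one hp.γ_pos]; linarith
        linarith))
    refine ⟨fun t ht => ⟨h.1 t ht, ?_⟩, h.2⟩
    filter_upwards [hC t ht] with x hx
    exact hx.symm
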